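/- **Setting.** An episodic two-player zero-sum Markov game has horizon $H$, a measurable state space $\mathcal X$, finite nonempty action sets $\mathcal A,\mathcal B$, transition kernels $\mathbb P_h(\cdot\mid x,a,b)$, deterministic measurable rewards $r^h(x,a,b)\in[0,1]$ and a fixed initial state $x^1$. For Markov policies $\mu,\nu$ of the max- and min-player, $V_h^{\mu,\nu}$ and $Q_h^{\mu,\nu}$ are the expected total reward from step $h$ on, given $x^h$, respectively $(x^h,a^h,b^h)$. Let $(\mu^*,\nu^*)$ be a Nash equilibrium, $V^*=V^{\mu^*,\nu^*}$, $Q^*=Q^{\mu^*,\nu^*}$. Let $\mathcal F=\mathcal F_1\times\dots\times\mathcal F_H$, where $\mathcal F_h$ is a set of functions $\mathcal X\times\mathcal A\times\mathcal B\to\mathbb R$ with a $\sigma$-algebra making evaluation jointly measurable, and let $p_0^h$ be a probability measure on $\mathcal F_h$. For $f,g\in\mathcal F$ and a policy $\mu$ put $V_{f,h}(x)=\max_{p\in\Delta_{\mathcal A}}\min_{q\in\Delta_{\mathcal B}}p^\top f^h(x,\cdot,\cdot)q$ and $V^\mu_{g,h}(x)=\min_{q}\mu_h(x)^\top g^h(x,\cdot,\cdot)q$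 (both $0$ for $h=H+1$), $\mathcal T_hf=r^h+\mathbb P_hV_{f,h+1}$, $\mathcal T_h^\mu g=r^h+\mathbb P_hV^\mu_{g,h+1}$, $\mathcal E_h(f)=f^h-\mathcal T_hf$, $\mathcal E^\mu_h(g)=g^h-\mathcal T^\mu_hg$. Let $\mu_{f,h}(x)\in\operatorname{argmax}_p\min_q p^\top f^h(x,\cdot,\cdot)q$ and $\nu_{f,g,h}(x)\in\operatorname{argmin}_q\mu_{f,h}(x)^\top g^h(x,\cdot,\cdot)q$ be chosen measurably. **Algorithm.** Given $\eta,\lambda$ and the history $S_{t-1}$ of trajectories $(x_s^h,a_s^h,b_s^h)_{h\le H}$, $s<t$, draw $f_t\sim p_t$ with $$p_t(df)\propto e^{\lambda V_{f,1}(x^1)}\prod_{h=1}^H\frac{e^{-\eta L^h(f^h,f^{h+1})}\,p_0^h(df^h)}{\mathbb E_{u\sim p_0^h}e^{-\eta L^h(u,f^{h+1})}},\qquad L^h(u,f^{h+1})=\sum_{s<t}\bigl(u(x_s^h,a_s^h,b_s^h)-r_s^h-V_{f,h+1}(x_s^{h+1})\bigr)^2,$$ set $\mu_t=\mu_{f_t}$,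 draw $g_t\sim p_t^{\mu_t}$, where $p_t^{\mu}$ is defined in the same way with $e^{-\lambda V^\mu_{g,1}(x^1)}$ in place of $e^{\lambda V_{f,1}(x^1)}$ and $V^\mu_{g,h+1}$ in place of $V_{f,h+1}$, set $\nu_t=\nu_{f_t,g_t}$, and play $(\mu_t,\nu_t)$ for one episode to obtain $S_t$. **Complexities.** Let $\kappa(\varepsilon)=\sup_{f,g\in\mathcal F}\sum_{h=1}^H\ln\bigl(1/p_0^h\{u\in\mathcal F_h:\sup|u-\mathcal T_h^{\mu_f}g|\le\varepsilon\}\bigr)$. For $m>0$ let $dc(\mathcal F,MG,T,m)$ be the smallest integer $K$ such that for all $f_1,g_1,\dots,f_T,g_T\in\mathcal F$, with $\pi_t=(\mu_{f_t},\nu_{f_t,g_t})$, $$\sum_{h=1}^H\sum_{t=1}^T\mathbb E_{\pi_t}[e_{t,h}(x^h,a^h,b^h)]\le m\sum_{h=1}^H\sum_{t=1}^T\sum_{s=1}^{t-1}\mathbb E_{\pi_s}[e_{t,h}(x^h,a^h,b^h)^2]+\frac K{4m}$$ holds both for $e_{t,h}=\mathcal E_h^{\mu_{f_t}}(g_t)$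 and for $e_{t,h}=\mathcal E_h(f_t)$. **Theorem 2 (bound of the main agent).** There are a universal constant $C$ and constants $C_{H,\beta}$ depending only on $H$ and $\beta$ such that the following holds. Assume realizability ($Q^*_h\in\mathcal F_h$, and $Q_h^{\mu_f,\nu^\dagger}\in\mathcal F_h$ for every $f\in\mathcal F$ and every best response $\nu^\dagger$ to $\mu_f$, for all $h$), completeness ($\mathcal T_h^{\mu_f}g\in\mathcal F_h$ for all $f,g\in\mathcal F$ and all $h$) and boundedness ($f^h(x,a,b)\in[0,\beta-1]$ for all $f\in\mathcal F$, $h$, $x,a,b$, where $\beta>1$). Let $T\ge1$, $\kappa:=\kappa(\beta/T^2)<\infty$, let $D=dc(\mathcal F,MG,T)\ge1$ be a real upper bound of $dc(\mathcal F,MG,T,m)$ over $0<m\le1$, and let $\eta=\frac1{4\beta^2}$ (so $\eta\beta^2\le0.5$) and $\lambda=\sqrt{\frac{T\kappa}{\beta^2D}}$, where $\lambda\beta^2\ge1$. Then $$\sum_{t=1}^T\mathbb E_{S_{t-1}}\mathbb E_{f_t\sim p_t}\mathbb E_{g_t\sim p_t^{\mu_t}}\bigl[V_1^*(x^1)-V_1^{\mu_t,\nu_t}(x^1)\bigr]\le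 C_{H,\beta}\Bigl(\beta\sqrt{D\,\kappa(\beta/T^2)\,T}+D\Bigr),$$ and if moreover $H\le T\,\kappa(\beta/T^2)$, then the same bound holds with the universal constant $C$ in place of $C_{H,\beta}$. -/

import Mathlib

open MeasureTheory ProbabilityTheory
open scoped ENNReal

noncomputable section

namespace SelfPlay

/-! ### Matrix games -/

section MatrixGame

variable {A B : Type*} [Fintype A] [Fintype B]

/-- The bilinear payoff `pᵀ M q`. -/
def payoff (p : A → ℝ) (M : A → B → ℝ) (q : B → ℝ) : ℝ :=
  ∑ a, ∑ b, p a * M a b * q b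

/-- `min_{q ∈ Δ_B} pᵀ M q`. -/
def responseValue (p : A → ℝ) (M : A → B → ℝ) : ℝ :=
  ⨅ q : stdSimplex ℝ B, payoff p M q.1

/-- `max_{p ∈ Δ_A} min_{q ∈ Δ_B} pᵀ M q`. -/
def gameValue (M : A → B → ℝ) : ℝ :=
  ⨆ p : stdSimplex ℝ A, responseValue p.1 M

end MatrixGame

/-! ### Markov games, policies and values.  Steps are numbered `0, …, H - 1`. -/

/-- An episodic two-player zero-sum Markov game with horizon `H`, deterministic rewards in
`[0, 1]` and a fixed initial state. -/
structure MarkovGame (H : ℕ) (X A B : Type*) [MeasurableSpace X] [MeasurableSpace A]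
    [MeasurableSpace B] where
  P : Fin H → Kernel (X × A × B) X
  markov : ∀ h, IsMarkovKernel (P h)
  r : Fin H → X → A → B → ℝ
  measurable_r : ∀ h a b, Measurable fun x => r h x a b
  r_mem : ∀ h x a b, r h x a b ∈ Set.Icc (0 : ℝ) 1
  init : X

/-- A Markov policy `{π_h : X → Δ_A}_h`. -/
structure Policy (H : ℕ) (X A : Type*) [MeasurableSpace X] [Fintype A] where
  prob : Fin H → X → A → ℝ
  mem : ∀ h x, prob h x ∈ stdSimplex ℝ A
  measurable_prob : ∀ h a, Measurable fun x => prob h x a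

/-- A trajectory `(x^h, a^h, b^h)_h` of one episode; the rewards are functions of it. -/
abbrev Traj (H : ℕ) (X A B : Type*) : Type _ := Fin H → X × A × B

section Values

variable {H : ℕ} {X A B : Type*} [MeasurableSpace X]
  [Fintype A] [MeasurableSpace A] [Fintype B] [MeasurableSpace B]

/-- Law of the action pair at step `h`: given the state, `a ∼ μ_h(x)` and `b ∼ ν_h(x)`
independently. -/
def actKernel (μ : Policy H X A) (ν : Policy H X B) (h : Fin H) : Kernel X (A × B) where
  toFun x := ∑ a, ∑ b, ENNReal.ofReal (μ.prob h x a * ν.prob h x b) • Measure.dirac (a, b)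
  measurable' := by
    refine Measure.measurable_of_measurable_coe _ fun s _ => ?_
    simp only [Measure.coe_finsetSum, Finset.sum_apply, Measure.smul_apply, smul_eq_mul]
    refine Finset.measurable_sum _ fun a _ => Finset.measurable_sum _ fun b _ => ?_
    exact (((μ.measurable_prob h a).mul (ν.measurable_prob h b)).ennreal_ofReal).mul_const _

/-- Law of the last part of an episode, from step `h` to the end, when the first state and action
pair are given and the part after the first transition has the law `K`. -/
def consKernel (M : MarkovGame H X A B) (h : Fin H) {n : ℕ}
    (K : Kernel X (Traj n X A B)) : Kernel (X × A × B) (Traj (n + 1) X A B) :=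
  (Kernel.id ×ₖ (K ∘ₖ M.P h)).map fun z => (Fin.cons z.1 z.2 : Traj (n + 1) X A B)

/-- Law of `(x^{h'}, a^{h'}, b^{h'})_{h' ≥ h}` given `x^h = x` when `(μ, ν)` is played.  Here `n`
is the number of remaining steps, so the `i`-th entry belongs to step `h + i`. -/
def rollout (M : MarkovGame H X A B) (μ : Policy H X A) (ν : Policy H X B) :
    (n h : ℕ) → h + n = H → Kernel X (Traj n X A B)
  | 0, _, _ => Kernel.const X (Measure.dirac Fin.elim0)
  | n + 1, h, hh =>
      consKernel M ⟨h, by omega⟩ (rollout M μ ν n (h + 1) (by omega)) ∘ₖ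
        (Kernel.id ×ₖ actKernel μ ν ⟨h, by omega⟩)

/-- Law of a whole episode played with `(μ, ν)`. -/
def episodeLaw (M : MarkovGame H X A B) (μ : Policy H X A) (ν : Policy H X B) :
    Measure (Traj H X A B) :=
  rollout M μ ν H 0 (by omega) M.init

/-- Total reward collected from step `h` on. -/
def totalReward (M : MarkovGame H X A B) (n h : ℕ) (hh : h + n = H) (ζ : Traj n X A B) : ℝ :=
  ∑ i : Fin n, M.r ⟨h + i, by omega⟩ (ζ i).1 (ζ i).2.1 (ζ i).2.2

/-- `V_h^{μ,ν}(x) = E_{μ,ν}[∑_{h' ≥ h} r^{h'} | x^h = x]`. -/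
def value (M : MarkovGame H X A B) (μ : Policy H X A) (ν : Policy H X B) (h : Fin H) (x : X) : ℝ :=
  ∫ ζ, totalReward M (H - h) h (by omega) ζ ∂(rollout M μ ν (H - h) h (by omega) x)

/-- `Q_h^{μ,ν}(x,a,b) = E_{μ,ν}[∑_{h' ≥ h} r^{h'} | (x^h, a^h, b^h) = (x, a, b)]`. -/
def qValue (M : MarkovGame H X A B) (μ : Policy H X A) (ν : Policy H X B) (h : Fin H)
    (x : X) (a : A) (b : B) : ℝ :=
  ∫ ζ, totalReward M (H - (h + 1) + 1) h (by omega) ζ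
    ∂(consKernel M h (rollout M μ ν (H - (h + 1)) (h + 1) (by omega)) (x, a, b))

/-- The value `V_1^{μ,ν}(x^1)` of the game from its initial state. -/
def initValue (M : MarkovGame H X A B) (μ : Policy H X A) (ν : Policy H X B) : ℝ :=
  ∫ ζ, totalReward M H 0 (by omega) ζ ∂(episodeLaw M μ ν)

/-- `(μ, ν)` is a Nash equilibrium (a saddle point at every step and state). -/
def IsNash (M : MarkovGame H X A B) (μ : Policy H X A) (ν : Policy H X B) : Prop :=
  ∀ h x, (∀ μ', value M μ' ν h x ≤ value M μ ν h x) ∧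
    (∀ ν', value M μ ν h x ≤ value M μ ν' h x)

/-- `ν` is a best response of the min-player to `μ`. -/
def IsBestResponse (M : MarkovGame H X A B) (μ : Policy H X A) (ν : Policy H X B) : Prop :=
  ∀ h x ν', value M μ ν h x ≤ value M μ ν' h x

end Values

/-! ### Function classes and induced policies -/

/-- A function class `F = F_0 × ⋯ × F_{H-1}`; every `F_h` carries a σ-algebra (so that one can put
a prior on it) for which evaluation is jointly measurable. -/
structure FunctionClass (H : ℕ) (X A B : Type*) [MeasurableSpace X] where
  carrier : Fin H → Set (X → A → B → ℝ)
  mspace : ∀ h, MeasurableSpace (carrier h)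
  measurable_eval : ∀ h a b,
    @Measurable _ _ (@Prod.instMeasurableSpace _ _ (mspace h) _) _
      fun p : carrier h × X => p.1.1 p.2 a b

/-- The elements of `F_h`, with the σ-algebra of the class. -/
def FunctionClass.Elem {H : ℕ} {X A B : Type*} [MeasurableSpace X]
    (F : FunctionClass H X A B) (h : Fin H) : Type _ :=
  F.carrier h

instance {H : ℕ} {X A B : Type*} [MeasurableSpace X] (F : FunctionClass H X A B) (h : Fin H) :
    MeasurableSpace (F.Elem h) :=
  F.mspace h

/-- The elements `f = (f^h)_h` of the class. -/
abbrev FunctionClass.Elems {H : ℕ} {X A B : Type*} [MeasurableSpace X]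
    (F : FunctionClass H X A B) : Type _ :=
  (h : Fin H) → F.Elem h

/-- A (measurable) choice of the induced policies
`μ_{f,h}(x) ∈ argmax_p min_q pᵀ f^h(x,·,·) q` and
`ν_{f,g,h}(x) ∈ argmin_q μ_{f,h}(x)ᵀ g^h(x,·,·) q`. -/
structure InducedPolicies {H : ℕ} {X A B : Type*} [MeasurableSpace X] [Fintype A] [Fintype B]
    (F : FunctionClass H X A B) where
  mu : (h : Fin H) → F.Elem h → X → A → ℝ
  nu : (h : Fin H) → F.Elem h → F.Elem h → X → B → ℝ
  mu_mem : ∀ h f x, mu h f x ∈ stdSimplex ℝ A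
  nu_mem : ∀ h f g x, nu h f g x ∈ stdSimplex ℝ B
  mu_max : ∀ h f x, IsMaxOn (fun p => responseValue p (f.1 x)) (stdSimplex ℝ A) (mu h f x)
  nu_min : ∀ h f g x,
    IsMinOn (fun q => payoff (mu h f x) (g.1 x) q) (stdSimplex ℝ B) (nu h f g x)
  measurable_mu : ∀ h a, Measurable fun p : F.Elem h × X => mu h p.1 p.2 a
  measurable_nu : ∀ h b, Measurable fun p : (F.Elem h × F.Elem h) × X => nu h p.1.1 p.1.2 p.2 b

section Learning

variable {H : ℕ} {X A B : Type*} [MeasurableSpace X]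
  [Fintype A] [MeasurableSpace A] [Fintype B] [MeasurableSpace B]
  {F : FunctionClass H X A B}

/-- The max-player policy `μ_f`. -/
def InducedPolicies.maxPolicy (I : InducedPolicies F) (f : F.Elems) : Policy H X A where
  prob h x := I.mu h (f h) x
  mem h x := I.mu_mem h (f h) x
  measurable_prob h a := (I.measurable_mu h a).comp measurable_prodMk_left

/-- The min-player policy `ν_{f,g}`. -/
def InducedPolicies.minPolicy (I : InducedPolicies F) (f g : F.Elems) : Policy H X B where
  prob h x := I.nu h (f h) (g h) x
  mem h x := I.nu_mem h (f h) (g h) x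
  measurable_prob h b := (I.measurable_nu h b).comp (measurable_prodMk_left (x := (f h, g h)))

/-- `V_{f,h}(x) = max_p min_q pᵀ f^h(x,·,·) q`, and `0` after the last step. -/
def maxminValue (f : F.Elems) (h : ℕ) (x : X) : ℝ :=
  if hh : h < H then gameValue ((f ⟨h, hh⟩).1 x) else 0

/-- `V_{g,h}^μ(x) = min_q μ_h(x)ᵀ g^h(x,·,·) q`, and `0` after the last step. -/
def policyValue (μ : Policy H X A) (g : F.Elems) (h : ℕ) (x : X) : ℝ :=
  if hh : h < H then responseValue (μ.prob ⟨h, hh⟩ x) ((g ⟨h, hh⟩).1 x) else 0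

/-- `r^h + P_h V`. -/
def backup (M : MarkovGame H X A B) (h : Fin H) (V : X → ℝ) (x : X) (a : A) (b : B) : ℝ :=
  M.r h x a b + ∫ x', V x' ∂(M.P h (x, a, b))

/-- The Bellman operator `T_h f = r^h + P_h V_{f,h+1}`. -/
def bellman (M : MarkovGame H X A B) (h : Fin H) (f : F.Elems) : X → A → B → ℝ :=
  backup M h (maxminValue f (h + 1))

/-- The Bellman operator `T_h^μ g = r^h + P_h V_{g,h+1}^μ`. -/
def bellmanPolicy (M : MarkovGame H X A B) (μ : Policy H X A) (h : Fin H) (g : F.Elems) :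
    X → A → B → ℝ :=
  backup M h (policyValue μ g (h + 1))

/-- The Bellman residual `E_h(f; x, a, b)`. -/
def residual (M : MarkovGame H X A B) (h : Fin H) (f : F.Elems) (z : X × A × B) : ℝ :=
  (f h).1 z.1 z.2.1 z.2.2 - bellman M h f z.1 z.2.1 z.2.2

/-- The Bellman residual `E_h^μ(g; x, a, b)`. -/
def residualPolicy (M : MarkovGame H X A B) (μ : Policy H X A) (h : Fin H) (g : F.Elems)
    (z : X × A × B) : ℝ :=
  (g h).1 z.1 z.2.1 z.2.2 - bellmanPolicy M μ h g z.1 z.2.1 z.2.2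

/-! ### Assumptions -/

/-- Realizability with respect to the Nash equilibrium `(μs, νs)`: `Q_h^* ∈ F_h`, and
`Q_h^{μ_f,†} ∈ F_h` for every `f` in the class. -/
def Realizable (M : MarkovGame H X A B) (I : InducedPolicies F) (μs : Policy H X A)
    (νs : Policy H X B) : Prop :=
  (∀ h, qValue M μs νs h ∈ F.carrier h) ∧
    ∀ (f : F.Elems) (ν : Policy H X B), IsBestResponse M (I.maxPolicy f) ν →
      ∀ h, qValue M (I.maxPolicy f) ν h ∈ F.carrier h

/-- Completeness: `T_h^{μ_f} g ∈ F_h` for all `f, g` in the class. -/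
def Complete (M : MarkovGame H X A B) (I : InducedPolicies F) : Prop :=
  ∀ (f g : F.Elems) (h : Fin H), bellmanPolicy M (I.maxPolicy f) h g ∈ F.carrier h

/-- Boundedness: all functions of the class take values in `[0, β - 1]`. -/
def BoundedBy (F : FunctionClass H X A B) (β : ℝ) : Prop :=
  ∀ h, ∀ f ∈ F.carrier h, ∀ x a b, f x a b ∈ Set.Icc 0 (β - 1)

/-! ### The complexity measures -/

/-- `κ_μ(ε) = sup_g ∑_h ln (1 / p_0^h {u ∈ F_h : sup |u - T_h^μ g| ≤ ε})`, possibly `∞`. -/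
def kappaPolicy (M : MarkovGame H X A B) (p₀ : (h : Fin H) → Measure (F.Elem h))
    (μ : Policy H X A) (ε : ℝ) : EReal :=
  ⨆ g : F.Elems, ∑ h, ENNReal.log
    (1 / p₀ h {u | ∀ x a b, |u.1 x a b - bellmanPolicy M μ h g x a b| ≤ ε})

/-- `κ(ε) = sup_f κ_{μ_f}(ε)`. -/
def kappa (M : MarkovGame H X A B) (I : InducedPolicies F)
    (p₀ : (h : Fin H) → Measure (F.Elem h)) (ε : ℝ) : EReal :=
  ⨆ f : F.Elems, kappaPolicy M p₀ (I.maxPolicy f) ε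

/-- The inequality that defines the decoupling coefficient, for episode laws `π t` and
residuals `e t h`. -/
def Decouples {T : ℕ} (π : Fin T → Measure (Traj H X A B))
    (e : Fin T → Fin H → X × A × B → ℝ) (m : ℝ) (K : ℤ) : Prop :=
  ∑ h, ∑ t, ∫ ζ, e t h (ζ h) ∂(π t) ≤
    m * ∑ h, ∑ t, ∑ s ∈ Finset.Iio t, ∫ ζ, (e t h (ζ h)) ^ 2 ∂(π s) + K / (4 * m)

/-- The multi-agent decoupling coefficient `dc(F, MG, T, m)`: the smallest integer `K` such that
for all `f_t, g_t` in the class, with `π_t` the law of an episode under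
`(μ_{f_t}, ν_{f_t,g_t})`, the decoupling inequality holds for the residuals
`E_h^{μ_{f_t}}(g_t)` of the booster agent and for the residuals `E_h(f_t)` of the main agent. -/
def decouplingCoeff (M : MarkovGame H X A B) (I : InducedPolicies F) (T : ℕ) (m : ℝ) : ℤ :=
  sInf {K : ℤ | ∀ f g : Fin T → F.Elems,
    Decouples (fun t => episodeLaw M (I.maxPolicy (f t)) (I.minPolicy (f t) (g t)))
      (fun t h => residualPolicy M (I.maxPolicy (f t)) h (g t)) m K ∧
    Decouples (fun t => episodeLaw M (I.maxPolicy (f t)) (I.minPolicy (f t) (g t)))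
      (fun t h => residual M h (f t)) m K}

/-! ### The algorithm: conditional posterior sampling with booster -/

/-- The state `x^{h+1}` of a trajectory.  At the last step the value is irrelevant, because the
value functions after the last step are zero. -/
def nextState (ζ : Traj H X A B) (h : Fin H) : X :=
  if hh : (h : ℕ) + 1 < H then (ζ ⟨h + 1, hh⟩).1 else (ζ h).1

/-- The squared loss `∑_s (u(x_s^h, a_s^h, b_s^h) - r_s^h - V(x_s^{h+1}))²` over the history `S` of
`t` episodes. -/
def sqLoss (M : MarkovGame H X A B) (h : Fin H) (u : X → A → B → ℝ) (V : X → ℝ) {t : ℕ}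
    (S : Fin t → Traj H X A B) : ℝ :=
  ∑ s, (u (S s h).1 (S s h).2.1 (S s h).2.2 - M.r h (S s h).1 (S s h).2.1 (S s h).2.2
    - V (nextState (S s) h)) ^ 2

/-- `ln` of `exp(-η L^h(u, V; S)) / E_{ũ ∼ p_0^h} exp(-η L^h(ũ, V; S))`. -/
def logLikelihood (M : MarkovGame H X A B) (p₀ : (h : Fin H) → Measure (F.Elem h)) (η : ℝ)
    (h : Fin H) (u : F.Elem h) (V : X → ℝ) {t : ℕ} (S : Fin t → Traj H X A B) : ℝ :=
  -η * sqLoss M h u.1 V S -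
    Real.log (∫ u' : F.Elem h, Real.exp (-η * sqLoss M h u'.1 V S) ∂(p₀ h))

/-- The posterior of the main agent,
`p(f | S) ∝ exp(lam V_{f,1}(x^1)) ∏_h q(f^h | f^{h+1}, S)` with respect to `∏_h p_0^h`. -/
def mainPosterior (M : MarkovGame H X A B) (p₀ : (h : Fin H) → Measure (F.Elem h))
    (η lam : ℝ) {t : ℕ} (S : Fin t → Traj H X A B) : Measure F.Elems :=
  (Measure.pi p₀).tilted fun f =>
    lam * maxminValue f 0 M.init +
      ∑ h, logLikelihood M p₀ η h (f h) (maxminValue f (h + 1)) S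

/-- The posterior of the booster agent,
`p^μ(g | S) ∝ exp(-lam V_{g,1}^μ(x^1)) ∏_h q^μ(g^h | g^{h+1}, S)` with respect to `∏_h p_0^h`. -/
def boosterPosterior (M : MarkovGame H X A B) (p₀ : (h : Fin H) → Measure (F.Elem h))
    (η lam : ℝ) (μ : Policy H X A) {t : ℕ} (S : Fin t → Traj H X A B) : Measure F.Elems :=
  (Measure.pi p₀).tilted fun g =>
    -lam * policyValue μ g 0 M.init +
      ∑ h, logLikelihood M p₀ η h (g h) (policyValue μ g (h + 1)) S

/-- The law of the history `S_t` of the first `t` episodes: given `S_t`, draw `f` from the main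
posterior, then `g` from the booster posterior for `μ_f`, play `(μ_f, ν_{f,g})` and append the
trajectory. -/
def historyLaw (M : MarkovGame H X A B) (I : InducedPolicies F)
    (p₀ : (h : Fin H) → Measure (F.Elem h)) (η lam : ℝ) :
    (t : ℕ) → Measure (Fin t → Traj H X A B)
  | 0 => Measure.dirac Fin.elim0
  | t + 1 => (historyLaw M I p₀ η lam t).bind fun S =>
      (mainPosterior M p₀ η lam S).bind fun f =>
        (boosterPosterior M p₀ η lam (I.maxPolicy f) S).bind fun g =>
          (episodeLaw M (I.maxPolicy f) (I.minPolicy f g)).map fun ζ =>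
            (Fin.snoc S ζ : Fin (t + 1) → Traj H X A B)

/-- The main-agent part of the regret,
`∑_{t=1}^T E_{S_{t-1}} E_{f_t} E_{g_t} [V_1^*(x^1) - V_1^{μ_t,ν_t}(x^1)]`, where `V^* = V^{μs,νs}`. -/
def mainRegret (M : MarkovGame H X A B) (I : InducedPolicies F)
    (p₀ : (h : Fin H) → Measure (F.Elem h)) (η lam : ℝ) (μs : Policy H X A) (νs : Policy H X B)
    (T : ℕ) : ℝ :=
  ∑ t ∈ Finset.range T,
    ∫ S, ∫ f, ∫ g, (initValue M μs νs - initValue M (I.maxPolicy f) (I.minPolicy f g))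
      ∂(boosterPosterior M p₀ η lam (I.maxPolicy f) S)
      ∂(mainPosterior M p₀ η lam S)
      ∂(historyLaw M I p₀ η lam t)

end Learning

end SelfPlay

end

open SelfPlay

noncomputable section

namespace SelfPlay

set_option linter.unusedSectionVars false
set_option linter.style.haveILetI false

/-! ### Matrix games -/

section MatrixGame

variable {A B : Type*} [Fintype A] [Fintype B]

/-! Write `V_f` for the max-min value of `f` at the initial state and `E_h(f)` for the Bellman
residual. In each round `V^* - V^{μ_t,ν_t} = (V^* - V_{f_t}) + (V_{f_t} - V^{μ_t,ν_t})`. Since `μ_f`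
guarantees the max-min value of `f` against every response, unrolling the Bellman equation bounds
the second bracket by `∑_h E_{π_t} E_h(f_t)`, whatever the booster plays
(`maxminValue_sub_initValue_le`). The decoupling inequality with `m = η / (2 lam)` trades these
on-policy residuals for the squared residuals of `f_t` under the past policies `π_s`, at a cost `D
lam / (2 η)` (`sum_optimism_sub_value_le`). So it suffices to show, in every round, `E[(η/2) ∑_{h,s}
E_{π_s} E_h(f_t)² - lam V_{f_t}] ≤ 2κ - lam V^* + small`, which is `integral_cumSq_sub_optimism_le`.

This is a Gibbs posterior estimate. Let `W` be the log-density of the posterior. The part of the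
squared loss that does not involve `f^h` cancels in the conditional likelihood, so `W = lam V_f +
∑_h (-η ΔL^h - ln Z_h)`, where `ΔL^h` is the excess loss over the Bayes predictor `T_h f` and `Z_h`
is a normalizer that depends on `f^{h+1}` only. Put `G_h = -η ΔL^h + (η/2) ∑_s E_{π_s} E_h(f)²`.
Jensen's inequality under the posterior gives `E[∑ G_h - W] ≤ ln E_{p₀} e^{∑ G_h} - ln E_{p₀} e^W`.
Three facts finish the estimate.

(1) Hoeffding's lemma makes `e^{2 G_h}` a supermartingale for each fixed `f`
(`integral_exp_potential_le`); this needs `2ηβ² ≤ 1/2` and holds for any adaptively chosen policies.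
As `G_h` involves only the coordinates `h` and `h + 1`, the even links are independent under the
prior and so are the odd ones, and averaging the two halves reduces `ln E e^{∑ G_h}` to `(1/2) ∑_h
ln E e^{2 G_h}` (`integral_tilted_chain_le`), whose mean is at most `0`.

(2) `∑_h ln Z_h ≥ -κ - small`, because `T_h f` has a neighbourhood of sufficient prior mass
(`neg_kappa_le_sum_log`, `log_bellmanBall_sub_le_log_normalizer`). This is the first `κ`.

(3) `-ln E_{p₀} e^W` is at most `κ + E_Q[-W]` for any probability `Q` with density at most `e^κ`.
The measure `Q` of `exists_comparator` lives on approximate solutions of the optimality equation;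
for these `ΔL^h` is small, `V_f ≥ V^* - Hε` by the saddle point property, and `E ln Z_h ≤ 0` because
`f` is now independent of the data (`integral_neg_log_evidence_le`). This is the second `κ`.

The choice of `lam` balances `2Tκ/lam` against `D lam / (2η)`. For the universal constant, the case
`κ ≥ DT` is covered by the trivial bound `T(β - 1)`. -/

theorem payoff_mono {p : A → ℝ} {q : B → ℝ} (hp : p ∈ stdSimplex ℝ A) (hq : q ∈ stdSimplex ℝ B)
    {M N : A → B → ℝ} (h : ∀ a b, M a b ≤ N a b) : payoff p M q ≤ payoff p N q :=
  Finset.sum_le_sum fun a _ => Finset.sum_le_sum fun b _ =>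
    mul_le_mul_of_nonneg_right (mul_le_mul_of_nonneg_left (h a b) (hp.1 a)) (hq.1 b)

theorem payoff_const {p : A → ℝ} {q : B → ℝ} (hp : p ∈ stdSimplex ℝ A) (hq : q ∈ stdSimplex ℝ B)
    (c : ℝ) : payoff p (fun _ _ => c) q = c := by
  simp only [payoff, ← Finset.mul_sum, hq.2, mul_one, ← Finset.sum_mul, hp.2, one_mul]

theorem payoff_sub (p : A → ℝ) (M N : A → B → ℝ) (q : B → ℝ) :
    payoff p (fun a b => M a b - N a b) q = payoff p M q - payoff p N q := by
  simp only [payoff, ← Finset.sum_sub_distrib]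
  exact Finset.sum_congr rfl fun a _ => Finset.sum_congr rfl fun b _ => by ring

theorem payoff_mem_Icc {p : A → ℝ} {q : B → ℝ} (hp : p ∈ stdSimplex ℝ A)
    (hq : q ∈ stdSimplex ℝ B) {M : A → B → ℝ} {c d : ℝ} (h : ∀ a b, M a b ∈ Set.Icc c d) :
    payoff p M q ∈ Set.Icc c d :=
  ⟨(payoff_const hp hq c).symm.le.trans (payoff_mono hp hq fun a b => (h a b).1),
    (payoff_mono hp hq fun a b => (h a b).2).trans (payoff_const hp hq d).le⟩

theorem exists_entry_bounds [Nonempty A] [Nonempty B] (M : A → B → ℝ) :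
    ∃ c d, ∀ a b, M a b ∈ Set.Icc c d := by
  obtain ⟨d, hd⟩ := (Set.finite_range fun z : A × B => M z.1 z.2).bddAbove
  obtain ⟨c, hc⟩ := (Set.finite_range fun z : A × B => M z.1 z.2).bddBelow
  exact ⟨c, d, fun a b => ⟨hc ⟨(a, b), rfl⟩, hd ⟨(a, b), rfl⟩⟩⟩

theorem bddBelow_payoff [Nonempty A] [Nonempty B] {p : A → ℝ} (hp : p ∈ stdSimplex ℝ A)
    (M : A → B → ℝ) : BddBelow (Set.range fun q : stdSimplex ℝ B => payoff p M q.1) := by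
  obtain ⟨c, d, h⟩ := exists_entry_bounds M
  exact ⟨c, by rintro _ ⟨q, rfl⟩; exact (payoff_mem_Icc hp q.2 h).1⟩

theorem responseValue_le [Nonempty A] [Nonempty B] {p : A → ℝ} {q : B → ℝ}
    (hp : p ∈ stdSimplex ℝ A) (hq : q ∈ stdSimplex ℝ B) (M : A → B → ℝ) :
    responseValue p M ≤ payoff p M q :=
  ciInf_le (bddBelow_payoff hp M) ⟨q, hq⟩

theorem le_responseValue [Nonempty B] {p : A → ℝ} {M : A → B → ℝ} {c : ℝ}
    (h : ∀ q ∈ stdSimplex ℝ B, c ≤ payoff p M q) : c ≤ responseValue p M := by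
  haveI : Nonempty (stdSimplex ℝ B) := inferInstance
  exact le_ciInf fun q => h q.1 q.2

theorem responseValue_eq_payoff [Nonempty A] [Nonempty B] {p : A → ℝ} {q : B → ℝ}
    (hp : p ∈ stdSimplex ℝ A) (hq : q ∈ stdSimplex ℝ B) {M : A → B → ℝ}
    (h : IsMinOn (fun q => payoff p M q) (stdSimplex ℝ B) q) :
    responseValue p M = payoff p M q :=
  le_antisymm (responseValue_le hp hq M) (le_responseValue fun _ hq' => h hq')

theorem gameValue_eq_responseValue [Nonempty A] {p : A → ℝ} (hp : p ∈ stdSimplex ℝ A)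
    {M : A → B → ℝ} (h : IsMaxOn (fun p => responseValue p M) (stdSimplex ℝ A) p) :
    gameValue M = responseValue p M := by
  haveI : Nonempty (stdSimplex ℝ A) := inferInstance
  refine le_antisymm (ciSup_le fun p' => h p'.2) (le_ciSup (f := fun p : stdSimplex ℝ A =>
    responseValue p.1 M) ⟨responseValue p M, ?_⟩ ⟨p, hp⟩)
  rintro _ ⟨p', rfl⟩
  exact h p'.2

end MatrixGame

section Induced

variable {H : ℕ} {X A B : Type*} [MeasurableSpace X]
  [Fintype A] [Nonempty A] [MeasurableSpace A] [MeasurableSingletonClass A]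
  [Fintype B] [Nonempty B] [MeasurableSpace B] [MeasurableSingletonClass B]
  {F : FunctionClass H X A B}

/-! ### Induced policies attain the values -/

theorem policyValue_eq_payoff (I : InducedPolicies F) (f g : F.Elems) {h : ℕ} (hh : h < H) (x : X) :
    policyValue (I.maxPolicy f) g h x =
      payoff (I.mu ⟨h, hh⟩ (f ⟨h, hh⟩) x) ((g ⟨h, hh⟩).1 x)
        (I.nu ⟨h, hh⟩ (f ⟨h, hh⟩) (g ⟨h, hh⟩) x) := by
  rw [policyValue, dif_pos hh]
  exact responseValue_eq_payoff (I.mu_mem _ _ _) (I.nu_mem _ _ _ _) (I.nu_min _ _ _ _)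

/-- Because `μ_f` attains the maximum, the main agent's operators are the policy operators with `g =
f`. This is how `kappa`, defined through `T_h^{μ_f} g`, controls the neighbourhoods of `T_h f`. -/
theorem maxminValue_eq_policyValue (I : InducedPolicies F) (f : F.Elems) (h : ℕ) :
    maxminValue f h = policyValue (I.maxPolicy f) f h := by
  funext x
  rw [maxminValue, policyValue]
  split_ifs with hh
  · exact gameValue_eq_responseValue (I.mu_mem _ _ _) (I.mu_max _ _ _)
  · rfl

theorem responseValue_le_maxminValue (I : InducedPolicies F) (f : F.Elems) {h : ℕ} (hh : h < H)
    (x : X) {p : A → ℝ} (hp : p ∈ stdSimplex ℝ A) :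
    responseValue p ((f ⟨h, hh⟩).1 x) ≤ maxminValue f h x := by
  rw [maxminValue, dif_pos hh,
    gameValue_eq_responseValue (I.mu_mem _ (f ⟨h, hh⟩) x) (I.mu_max _ _ _)]
  exact I.mu_max _ _ _ hp

/-- The max-min policy secures its value against every mixed reply. This is why the comparison of
`V_f` with the value actually achieved needs nothing about the min-player. -/
theorem maxminValue_le_payoff (I : InducedPolicies F) (f : F.Elems) {h : ℕ} (hh : h < H)
    (x : X) {q : B → ℝ} (hq : q ∈ stdSimplex ℝ B) :
    maxminValue f h x ≤ payoff (I.mu ⟨h, hh⟩ (f ⟨h, hh⟩) x) ((f ⟨h, hh⟩).1 x) q := by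
  rw [maxminValue, dif_pos hh,
    gameValue_eq_responseValue (I.mu_mem _ (f ⟨h, hh⟩) x) (I.mu_max _ _ _)]
  exact responseValue_le (I.mu_mem _ _ _) hq _

theorem policyValue_mem_Icc (I : InducedPolicies F) {β : ℝ} (hβ : 1 < β) (hF : BoundedBy F β)
    (f g : F.Elems) (h : ℕ) (x : X) :
    policyValue (I.maxPolicy f) g h x ∈ Set.Icc 0 (β - 1) := by
  by_cases hh : h < H
  · rw [policyValue_eq_payoff I f g hh]
    exact payoff_mem_Icc (I.mu_mem _ _ _) (I.nu_mem _ _ _ _) fun a b => hF _ _ (g ⟨h, hh⟩).2 x a b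
  · rw [policyValue, dif_neg hh]
    exact ⟨le_rfl, by linarith⟩

theorem maxminValue_mem_Icc (I : InducedPolicies F) {β : ℝ} (hβ : 1 < β) (hF : BoundedBy F β)
    (f : F.Elems) (h : ℕ) (x : X) : maxminValue f h x ∈ Set.Icc 0 (β - 1) := by
  rw [maxminValue_eq_policyValue I]
  exact policyValue_mem_Icc I hβ hF f f h x

theorem bellman_eq_bellmanPolicy (M : MarkovGame H X A B) (I : InducedPolicies F) (f : F.Elems)
    (h : Fin H) : bellman M h f = bellmanPolicy M (I.maxPolicy f) h f := by
  rw [bellman, bellmanPolicy, maxminValue_eq_policyValue I]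

theorem maxminValue_horizon (f : F.Elems) {h : ℕ} (hh : H ≤ h) (x : X) : maxminValue f h x = 0 := by
  rw [maxminValue, dif_neg (by omega)]

theorem maxminValue_congr {f g : F.Elems} {h : ℕ} (hfg : ∀ hh : h < H, f ⟨h, hh⟩ = g ⟨h, hh⟩) :
    maxminValue f h = maxminValue g h := by
  funext x
  rw [maxminValue, maxminValue]
  split_ifs with hh
  · rw [hfg hh]
  · rfl

/-! ### Joint measurability -/

theorem measurable_action {α β : Type*} [MeasurableSpace α] [MeasurableSpace β]
    {g : α → A → B → β} (hg : ∀ a b, Measurable fun x => g x a b) :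
    Measurable fun z : α × A × B => g z.1 z.2.1 z.2.2 :=
  measurable_from_prod_countable_left (f := fun z : α × A × B => g z.1 z.2.1 z.2.2)
    fun ab => hg ab.1 ab.2

theorem measurable_reward (M : MarkovGame H X A B) (h : Fin H) :
    Measurable fun z : X × A × B => M.r h z.1 z.2.1 z.2.2 :=
  measurable_action (M.measurable_r h)

theorem measurable_eval' (h : Fin H) (a : A) (b : B) :
    Measurable fun p : F.Elem h × X => p.1.1 p.2 a b :=
  F.measurable_eval h a b

theorem measurable_elem (h : Fin H) :
    Measurable fun p : F.Elem h × (X × A × B) => p.1.1 p.2.1 p.2.2.1 p.2.2.2 := by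
  have : Measurable fun z : (F.Elem h × X) × A × B => z.1.1.1 z.1.2 z.2.1 z.2.2 :=
    measurable_action (g := fun (z : F.Elem h × X) a b => z.1.1 z.2 a b)
      fun a b => measurable_eval' h a b
  exact this.comp (by fun_prop : Measurable fun p : F.Elem h × (X × A × B) =>
    ((p.1, p.2.1), p.2.2))

/-- The infimum over the simplex is replaced by the payoff at the measurable minimizer `ν_{f,g}`, so
that no measurability of an uncountable infimum has to be shown. -/
theorem measurable_policyValue (I : InducedPolicies F) (h : ℕ) :
    Measurable fun p : (F.Elems × F.Elems) × X => policyValue (I.maxPolicy p.1.1) p.1.2 h p.2 := by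
  by_cases hh : h < H
  · simp only [policyValue_eq_payoff I _ _ hh, payoff]
    refine Finset.measurable_sum _ fun a _ => Finset.measurable_sum _ fun b _ => ?_
    refine Measurable.mul (Measurable.mul ?_ ?_) ?_
    · exact (I.measurable_mu ⟨h, hh⟩ a).comp (by fun_prop : Measurable fun p :
        (F.Elems × F.Elems) × X => (p.1.1 ⟨h, hh⟩, p.2))
    · exact (measurable_eval' ⟨h, hh⟩ a b).comp (by fun_prop : Measurable fun p :
        (F.Elems × F.Elems) × X => (p.1.2 ⟨h, hh⟩, p.2))
    · exact (I.measurable_nu ⟨h, hh⟩ b).comp (by fun_prop : Measurable fun p :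
        (F.Elems × F.Elems) × X => ((p.1.1 ⟨h, hh⟩, p.1.2 ⟨h, hh⟩), p.2))
  · simp only [policyValue, dif_neg hh, measurable_const]

theorem measurable_maxminValue (I : InducedPolicies F) (h : ℕ) :
    Measurable fun p : F.Elems × X => maxminValue p.1 h p.2 := by
  simp only [maxminValue_eq_policyValue I]
  have := (measurable_policyValue I h).comp (by fun_prop : Measurable fun p : F.Elems × X =>
    ((p.1, p.1), p.2))
  exact this

theorem measurable_backup {Θ : Type*} [MeasurableSpace Θ] (M : MarkovGame H X A B) (h : Fin H)
    {V : Θ → X → ℝ} (hV : Measurable fun p : Θ × X => V p.1 p.2) :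
    Measurable fun p : Θ × (X × A × B) => backup M h (V p.1) p.2.1 p.2.2.1 p.2.2.2 := by
  haveI := M.markov h
  refine ((measurable_reward M h).comp measurable_snd).add ?_
  have hs : Measurable (Prod.snd : Θ × (X × A × B) → X × A × B) := measurable_snd
  have : StronglyMeasurable fun p : Θ × (X × A × B) => ∫ x', V p.1 x' ∂((M.P h).comap _ hs p) := by
    refine StronglyMeasurable.integral_kernel_prod_right
      (f := fun (p : Θ × (X × A × B)) x' => V p.1 x') ?_
    exact (hV.comp (by fun_prop : Measurable fun p : (Θ × (X × A × B)) × X =>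
      (p.1.1, p.2))).stronglyMeasurable
  simpa [Kernel.comap_apply] using this.measurable

theorem measurable_bellman (M : MarkovGame H X A B) (I : InducedPolicies F) (h : Fin H) :
    Measurable fun p : F.Elems × (X × A × B) => bellman M h p.1 p.2.1 p.2.2.1 p.2.2.2 :=
  measurable_backup M h (V := fun f : F.Elems => maxminValue f (h + 1))
    (measurable_maxminValue I (h + 1))

theorem measurable_residual (M : MarkovGame H X A B) (I : InducedPolicies F) (h : Fin H) :
    Measurable fun p : F.Elems × (X × A × B) => residual M h p.1 p.2 :=
  ((measurable_elem h).comp (by fun_prop : Measurable fun p : F.Elems × (X × A × B) =>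
    (p.1 h, p.2))).sub (measurable_bellman M I h)

theorem backup_sub_reward_mem_Icc (M : MarkovGame H X A B) (h : Fin H) {V : X → ℝ} {c : ℝ}
    (hVm : Measurable V) (hV : ∀ x, V x ∈ Set.Icc 0 c) (x : X) (a : A) (b : B) :
    ∫ x', V x' ∂(M.P h (x, a, b)) ∈ Set.Icc 0 c := by
  haveI := M.markov h
  refine ⟨integral_nonneg fun x => (hV x).1, ?_⟩
  have hint : Integrable V (M.P h (x, a, b)) :=
    Integrable.of_mem_Icc 0 c hVm.aemeasurable (Filter.Eventually.of_forall hV)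
  calc ∫ x', V x' ∂(M.P h (x, a, b)) ≤ ∫ _, c ∂(M.P h (x, a, b)) :=
        integral_mono hint (integrable_const _) fun x => (hV x).2
    _ = c := by simp

theorem backup_mem_Icc (M : MarkovGame H X A B) (h : Fin H) {V : X → ℝ} {β : ℝ}
    (hVm : Measurable V) (hV : ∀ x, V x ∈ Set.Icc 0 (β - 1)) (x : X) (a : A) (b : B) :
    backup M h V x a b ∈ Set.Icc 0 β := by
  have h1 := backup_sub_reward_mem_Icc M h hVm hV x a b
  have h2 := M.r_mem h x a b
  exact ⟨add_nonneg h2.1 h1.1, by unfold backup; linarith [h1.2, h2.2]⟩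

theorem measurable_maxminValue_right (I : InducedPolicies F) (f : F.Elems) (h : ℕ) :
    Measurable (maxminValue f h) := by
  have := (measurable_maxminValue I h).comp (measurable_prodMk_left (x := f))
  exact this

theorem abs_residual_le (M : MarkovGame H X A B) (I : InducedPolicies F) {β : ℝ} (hβ : 1 < β)
    (hF : BoundedBy F β) (h : Fin H) (f : F.Elems) (z : X × A × B) : |residual M h f z| ≤ β := by
  have h1 := hF h _ (f h).2 z.1 z.2.1 z.2.2
  have h2 := backup_mem_Icc M h (measurable_maxminValue_right I f (h + 1))
    (fun x => maxminValue_mem_Icc I hβ hF f (h + 1) x) z.1 z.2.1 z.2.2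
  rw [residual, bellman, abs_le]
  constructor <;> linarith [h1.1, h1.2, h2.1, h2.2]

end Induced

section Rollout

variable {H : ℕ} {X A B : Type*} [MeasurableSpace X]
  [Fintype A] [Nonempty A] [MeasurableSpace A] [MeasurableSingletonClass A]
  [Fintype B] [Nonempty B] [MeasurableSpace B] [MeasurableSingletonClass B]

/-! ### The law of an episode -/

theorem sum_prob_mul_prob (μ : Policy H X A) (ν : Policy H X B) (h : Fin H) (x : X) :
    ∑ a, ∑ b, μ.prob h x a * ν.prob h x b = 1 := by
  simp only [← Finset.mul_sum, (ν.mem h x).2, mul_one, (μ.mem h x).2]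

theorem prob_mul_prob_nonneg (μ : Policy H X A) (ν : Policy H X B) (h : Fin H) (x : X) (a : A)
    (b : B) : 0 ≤ μ.prob h x a * ν.prob h x b :=
  mul_nonneg ((μ.mem h x).1 a) ((ν.mem h x).1 b)

theorem sum_ofReal_prob_mul_prob (μ : Policy H X A) (ν : Policy H X B) (h : Fin H) (x : X) :
    ∑ a, ∑ b, ENNReal.ofReal (μ.prob h x a * ν.prob h x b) = 1 := by
  rw [← ENNReal.ofReal_one, ← sum_prob_mul_prob μ ν h x,
    ENNReal.ofReal_sum_of_nonneg fun a _ => Finset.sum_nonneg fun b _ =>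
      prob_mul_prob_nonneg μ ν h x a b]
  exact Finset.sum_congr rfl fun a _ =>
    (ENNReal.ofReal_sum_of_nonneg fun b _ => prob_mul_prob_nonneg μ ν h x a b).symm

theorem lintegral_actKernel (μ : Policy H X A) (ν : Policy H X B) (h : Fin H) (x : X)
    (φ : A × B → ℝ≥0∞) :
    ∫⁻ ab, φ ab ∂(actKernel μ ν h x) =
      ∑ a, ∑ b, ENNReal.ofReal (μ.prob h x a * ν.prob h x b) * φ (a, b) := by
  change ∫⁻ ab, φ ab ∂(∑ a, ∑ b, ENNReal.ofReal (μ.prob h x a * ν.prob h x b) •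
    Measure.dirac (a, b)) = _
  simp [lintegral_finsetSum_measure, lintegral_smul_measure]

instance (μ : Policy H X A) (ν : Policy H X B) (h : Fin H) : IsMarkovKernel (actKernel μ ν h) := by
  refine ⟨fun x => ⟨?_⟩⟩
  rw [← lintegral_one, lintegral_actKernel]
  simpa using sum_ofReal_prob_mul_prob μ ν h x

theorem measurable_cons {n : ℕ} :
    Measurable fun z : (X × A × B) × Traj n X A B => (Fin.cons z.1 z.2 : Traj (n + 1) X A B) := by
  refine measurable_pi_iff.2 fun i => ?_
  refine Fin.cases ?_ (fun i => ?_) i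
  · simpa using measurable_fst
  · simp only [Fin.cons_succ]
    exact (measurable_pi_apply i).comp measurable_snd

theorem measurable_cons_right {n : ℕ} (z : X × A × B) :
    Measurable fun ζ : Traj n X A B => (Fin.cons z ζ : Traj (n + 1) X A B) :=
  measurable_cons.comp (measurable_prodMk_left (x := z))

instance (M : MarkovGame H X A B) (h : Fin H) {n : ℕ} (K : Kernel X (Traj n X A B))
    [IsMarkovKernel K] : IsMarkovKernel (consKernel M h K) := by
  haveI := M.markov h
  exact Kernel.IsMarkovKernel.map _ measurable_cons

theorem consKernel_apply (M : MarkovGame H X A B) (h : Fin H) {n : ℕ}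
    (K : Kernel X (Traj n X A B)) [IsMarkovKernel K] (z : X × A × B) :
    consKernel M h K z = ((M.P h z).bind K).map
      fun ζ => (Fin.cons z ζ : Traj (n + 1) X A B) := by
  haveI := M.markov h
  rw [consKernel, Kernel.map_apply _ measurable_cons, Kernel.prod_apply, Kernel.id_apply,
    Measure.dirac_prod, Measure.map_map measurable_cons measurable_prodMk_left, Kernel.comp_apply]
  rfl

theorem lintegral_consKernel (M : MarkovGame H X A B) (h : Fin H) {n : ℕ}
    (K : Kernel X (Traj n X A B)) [IsMarkovKernel K] (z : X × A × B)
    {φ : Traj (n + 1) X A B → ℝ≥0∞} (hφ : Measurable φ) :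
    ∫⁻ ζ, φ ζ ∂(consKernel M h K z) = ∫⁻ x', ∫⁻ ζ, φ (Fin.cons z ζ) ∂(K x') ∂(M.P h z) := by
  rw [consKernel_apply, lintegral_map hφ (measurable_cons_right z),
    Measure.lintegral_bind (f := fun ζ => φ (Fin.cons z ζ)) K.measurable.aemeasurable
      (hφ.comp (measurable_cons_right z)).aemeasurable]

instance isMarkovKernel_rollout (M : MarkovGame H X A B) (μ : Policy H X A) (ν : Policy H X B)
    (n h : ℕ) (hh : h + n = H) : IsMarkovKernel (rollout M μ ν n h hh) := by
  induction n generalizing h with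
  | zero => unfold rollout; infer_instance
  | succ n ih =>
    haveI := ih (h + 1) (by omega)
    unfold rollout
    infer_instance

instance (M : MarkovGame H X A B) (μ : Policy H X A) (ν : Policy H X B) :
    IsProbabilityMeasure (episodeLaw M μ ν) := by
  unfold episodeLaw
  infer_instance

theorem lintegral_rollout_succ_eq_consKernel (M : MarkovGame H X A B) (μ : Policy H X A)
    (ν : Policy H X B) (n h : ℕ) (hh : h + (n + 1) = H) (x : X) {φ : Traj (n + 1) X A B → ℝ≥0∞}
    (hφ : Measurable φ) :
    ∫⁻ ζ, φ ζ ∂(rollout M μ ν (n + 1) h hh x) =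
      ∑ a, ∑ b, ENNReal.ofReal (μ.prob ⟨h, by omega⟩ x a * ν.prob ⟨h, by omega⟩ x b) *
        ∫⁻ ζ, φ ζ ∂(consKernel M ⟨h, by omega⟩ (rollout M μ ν n (h + 1) (by omega)) (x, a, b)) := by
  rw [rollout, Kernel.lintegral_comp _ _ _ hφ, Kernel.prod_apply, Kernel.id_apply,
    Measure.dirac_prod, lintegral_map _ measurable_prodMk_left, lintegral_actKernel]
  exact hφ.lintegral_kernel

theorem lintegral_rollout_succ (M : MarkovGame H X A B) (μ : Policy H X A) (ν : Policy H X B)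
    (n h : ℕ) (hh : h + (n + 1) = H) (x : X) {φ : Traj (n + 1) X A B → ℝ≥0∞} (hφ : Measurable φ) :
    ∫⁻ ζ, φ ζ ∂(rollout M μ ν (n + 1) h hh x) =
      ∑ a, ∑ b, ENNReal.ofReal (μ.prob ⟨h, by omega⟩ x a * ν.prob ⟨h, by omega⟩ x b) *
        ∫⁻ x', ∫⁻ ζ, φ (Fin.cons (x, a, b) ζ) ∂(rollout M μ ν n (h + 1) (by omega) x')
          ∂(M.P ⟨h, by omega⟩ (x, a, b)) := by
  rw [lintegral_rollout_succ_eq_consKernel M μ ν n h hh x hφ]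
  simp only [lintegral_consKernel M _ _ _ hφ]

theorem rollout_succ_apply (M : MarkovGame H X A B) (μ : Policy H X A) (ν : Policy H X B)
    (n h : ℕ) (hh : h + (n + 1) = H) (x : X) :
    rollout M μ ν (n + 1) h hh x =
      ∑ a, ∑ b, ENNReal.ofReal (μ.prob ⟨h, by omega⟩ x a * ν.prob ⟨h, by omega⟩ x b) •
        consKernel M ⟨h, by omega⟩ (rollout M μ ν n (h + 1) (by omega)) (x, a, b) := by
  ext s hs
  rw [← lintegral_indicator_one hs, lintegral_rollout_succ_eq_consKernel M μ ν n h hh x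
    (measurable_one.indicator hs)]
  simp [lintegral_indicator_one hs]

theorem integrable_of_bounded {Ω : Type*} [MeasurableSpace Ω] {P : Measure Ω} [IsFiniteMeasure P]
    {φ : Ω → ℝ} (hφ : Measurable φ) {c : ℝ} (hc : ∀ ω, |φ ω| ≤ c) : Integrable φ P :=
  Integrable.of_bound hφ.aestronglyMeasurable c (Filter.Eventually.of_forall hc)

theorem abs_integral_le_of_bounded {Ω : Type*} [MeasurableSpace Ω] {P : Measure Ω}
    [IsProbabilityMeasure P] {φ : Ω → ℝ} {c : ℝ} (hc : ∀ ω, |φ ω| ≤ c) : |∫ ω, φ ω ∂P| ≤ c := by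
  have := norm_integral_le_of_norm_le_const (μ := P) (f := φ) (C := c)
    (Filter.Eventually.of_forall hc)
  simpa using this

theorem integral_consKernel (M : MarkovGame H X A B) (h : Fin H) {n : ℕ}
    (K : Kernel X (Traj n X A B)) [IsMarkovKernel K] (z : X × A × B)
    {φ : Traj (n + 1) X A B → ℝ} (hφ : Measurable φ) {c : ℝ} (hc : ∀ ζ, |φ ζ| ≤ c) :
    ∫ ζ, φ ζ ∂(consKernel M h K z) = ∫ x', ∫ ζ, φ (Fin.cons z ζ) ∂(K x') ∂(M.P h z) := by
  haveI := M.markov h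
  rw [consKernel_apply, integral_map (measurable_cons_right z).aemeasurable
    hφ.aestronglyMeasurable, ← Kernel.comp_apply, Kernel.integral_comp]
  exact integrable_of_bounded (hφ.comp (measurable_cons_right z)) fun ζ => hc _

theorem integral_rollout_succ_eq_consKernel (M : MarkovGame H X A B) (μ : Policy H X A)
    (ν : Policy H X B) (n h : ℕ) (hh : h + (n + 1) = H) (x : X) {φ : Traj (n + 1) X A B → ℝ}
    (hφ : Measurable φ) {c : ℝ} (hc : ∀ ζ, |φ ζ| ≤ c) :
    ∫ ζ, φ ζ ∂(rollout M μ ν (n + 1) h hh x) =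
      payoff (μ.prob ⟨h, by omega⟩ x) (fun a b => ∫ ζ, φ ζ
        ∂(consKernel M ⟨h, by omega⟩ (rollout M μ ν n (h + 1) (by omega)) (x, a, b)))
        (ν.prob ⟨h, by omega⟩ x) := by
  have hint : ∀ (h' : Fin H) (n : ℕ) (K : Kernel X (Traj n X A B)) [IsMarkovKernel K]
      (φ : Traj (n + 1) X A B → ℝ) (_ : Measurable φ) (_ : ∀ ζ, |φ ζ| ≤ c) (w : ℝ) z,
      Integrable φ (ENNReal.ofReal w • consKernel M h' K z) :=
    fun h' n K _ φ hφ hc w z => (integrable_of_bounded hφ hc).smul_measure (by simp)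
  rw [rollout_succ_apply, integral_finsetSum_measure]
  · refine Finset.sum_congr rfl fun a _ => ?_
    rw [integral_finsetSum_measure]
    · refine Finset.sum_congr rfl fun b _ => ?_
      rw [integral_smul_measure, ENNReal.toReal_ofReal (prob_mul_prob_nonneg _ _ _ _ _ _),
        smul_eq_mul]
      ring
    · exact fun b _ => hint _ _ _ _ hφ hc _ _
  · intro a _
    exact integrable_finsetSum_measure.2 fun b _ => hint _ _ _ _ hφ hc _ _

theorem integral_rollout_succ (M : MarkovGame H X A B) (μ : Policy H X A)
    (ν : Policy H X B) (n h : ℕ) (hh : h + (n + 1) = H) (x : X) {φ : Traj (n + 1) X A B → ℝ}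
    (hφ : Measurable φ) {c : ℝ} (hc : ∀ ζ, |φ ζ| ≤ c) :
    ∫ ζ, φ ζ ∂(rollout M μ ν (n + 1) h hh x) =
      payoff (μ.prob ⟨h, by omega⟩ x) (fun a b => ∫ x', ∫ ζ, φ (Fin.cons (x, a, b) ζ)
        ∂(rollout M μ ν n (h + 1) (by omega) x') ∂(M.P ⟨h, by omega⟩ (x, a, b)))
        (ν.prob ⟨h, by omega⟩ x) := by
  rw [integral_rollout_succ_eq_consKernel M μ ν n h hh x hφ hc]
  simp only [integral_consKernel M _ _ _ hφ hc]

/-! ### The Markov property -/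

/-- The Markov property for one transition inside an episode: given the state and actions at one
step, the next state can be redrawn from the transition kernel. It turns the regression noise into a
conditionally centred variable. -/
theorem lintegral_rollout_next (M : MarkovGame H X A B) (μ : Policy H X A) (ν : Policy H X B)
    (n h : ℕ) (hh : h + n = H) (i j : Fin n) (hij : (i : ℕ) + 1 = j) (k : Fin H)
    (hk : h + (i : ℕ) = k) (x : X) {G : (X × A × B) × X → ℝ≥0∞} (hG : Measurable G) :
    ∫⁻ ζ, G (ζ i, (ζ j).1) ∂(rollout M μ ν n h hh x) =
      ∫⁻ ζ, ∫⁻ x', G (ζ i, x') ∂(M.P k (ζ i)) ∂(rollout M μ ν n h hh x) := by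
  haveI := M.markov
  induction n generalizing h x with
  | zero => exact i.elim0
  | succ n ih =>
    have hG' : Measurable fun z => ∫⁻ x', G (z, x') ∂(M.P k z) := hG.lintegral_kernel_prod_right'
    rw [lintegral_rollout_succ M μ ν n h hh x (φ := fun ζ => G (ζ i, (ζ j).1))
      (hG.comp (by fun_prop)), lintegral_rollout_succ M μ ν n h hh x
      (φ := fun ζ => ∫⁻ x', G (ζ i, x') ∂(M.P k (ζ i))) (hG'.comp (measurable_pi_apply i))]
    refine Finset.sum_congr rfl fun a _ => Finset.sum_congr rfl fun b _ => ?_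
    congr 1
    obtain ⟨j, rfl⟩ := Fin.exists_succ_eq.2 (show j ≠ 0 from fun h0 => by simp [h0] at hij)
    -- For `i = 0` the next state is the starting state of the remaining rollout, so everything
    -- after it integrates to one. Otherwise the first step is peeled off and the induction
    -- hypothesis applies.
    rcases Fin.eq_zero_or_eq_succ i with rfl | ⟨i, rfl⟩
    · obtain ⟨n, rfl⟩ : ∃ m, n = m + 1 := ⟨n - 1, by have := j.2; omega⟩
      obtain rfl : j = 0 := Fin.ext (by simpa using hij.symm)
      have hk' : (⟨h, by omega⟩ : Fin H) = k := Fin.ext (by simpa using hk)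
      simp only [Fin.cons_zero, Fin.cons_succ, lintegral_const, measure_univ, mul_one, hk']
      refine lintegral_congr fun x' => ?_
      rw [lintegral_rollout_succ M μ ν n (h + 1) (by omega) x'
        (φ := fun ζ => G ((x, a, b), (ζ 0).1)) (hG.comp (by fun_prop))]
      simp only [Fin.cons_zero, lintegral_const, measure_univ, mul_one]
      simp only [← Finset.sum_mul, sum_ofReal_prob_mul_prob, one_mul]
    · simp only [Fin.cons_succ]
      refine lintegral_congr fun x' => ?_
      exact ih (h + 1) (by omega) i j (by simpa using hij) (by simp at hk; omega) x'

/-! ### Reachable states -/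

/-- A measure on the states at step `h` that dominates the law of the state under all policies:
the sum over all action sequences of the laws of the state. -/
def reachMeasure (M : MarkovGame H X A B) : ℕ → Measure X
  | 0 => Measure.dirac M.init
  | h + 1 => if hh : h < H then
      ∑ a, ∑ b, (reachMeasure M h).bind fun x => M.P ⟨h, hh⟩ (x, a, b) else 0

instance (M : MarkovGame H X A B) (h : ℕ) : IsFiniteMeasure (reachMeasure M h) := by
  induction h with
  | zero => unfold reachMeasure; infer_instance
  | succ h ih =>
    unfold reachMeasure
    split_ifs with hh
    · haveI := M.markov
      have : ∀ a b, IsFiniteMeasure ((reachMeasure M h).bind fun x => M.P ⟨h, hh⟩ (x, a, b)) := by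
        intro a b
        refine ⟨?_⟩
        have hm : Measurable fun x => M.P ⟨h, hh⟩ (x, a, b) :=
          (M.P ⟨h, hh⟩).measurable.comp (by fun_prop)
        rw [Measure.bind_apply .univ hm.aemeasurable]
        simp
      infer_instance
    · infer_instance

theorem ae_ae_of_reachMeasure_succ (M : MarkovGame H X A B) (h : Fin H) {p : X → Prop}
    (hp : ∀ᵐ x ∂(reachMeasure M (h + 1)), p x) :
    ∀ᵐ x ∂(reachMeasure M h), ∀ a b, ∀ᵐ x' ∂(M.P h (x, a, b)), p x' := by
  rw [reachMeasure, dif_pos h.2] at hp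
  refine ae_all_iff.2 fun a => ae_all_iff.2 fun b => ?_
  have hm : Measurable fun x => M.P h (x, a, b) := (M.P h).measurable.comp (by fun_prop)
  refine Measure.ae_ae_of_ae_bind hm.aemeasurable ?_
  refine (Measure.absolutelyContinuous_of_le ?_).ae_le hp
  refine le_trans ?_ (Finset.single_le_sum (f := fun a => ∑ b, (reachMeasure M h).bind
    fun x => M.P h (x, a, b)) (fun _ _ => Measure.zero_le _) (Finset.mem_univ a))
  exact Finset.single_le_sum (f := fun b => (reachMeasure M h).bind
    fun x => M.P h (x, a, b)) (fun _ _ => Measure.zero_le _) (Finset.mem_univ b)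

/-- A policy mixes finitely many action pairs, and each of them contributes a summand to
`reachMeasure`, so a null set of `reachMeasure` stays null under every policy. Exceptional sets can
thus be fixed once, before the policies are sampled. -/
theorem ae_rollout_of_reachMeasure (M : MarkovGame H X A B) (μ : Policy H X A) (ν : Policy H X B)
    (n h : ℕ) (hh : h + n = H) (i : Fin n) {s : Set X} (hs : MeasurableSet s)
    (hp : ∀ᵐ x ∂(reachMeasure M (h + i)), x ∈ s) :
    ∀ᵐ x ∂(reachMeasure M h), ∀ᵐ ζ ∂(rollout M μ ν n h hh x), (ζ i).1 ∈ s := by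
  induction n generalizing h with
  | zero => exact i.elim0
  | succ n ih =>
    have hms : MeasurableSet {ζ : Traj (n + 1) X A B | (ζ i).1 ∈ s}ᶜ :=
      ((by fun_prop : Measurable fun ζ : Traj (n + 1) X A B => (ζ i).1) hs).compl
    have key : ∀ x, (∀ a b, ∀ᵐ x' ∂(M.P ⟨h, by omega⟩ (x, a, b)),
        ∀ᵐ ζ ∂(rollout M μ ν n (h + 1) (by omega) x'),
          ((Fin.cons (x, a, b) ζ : Traj (n + 1) X A B) i).1 ∈ s) →
        ∀ᵐ ζ ∂(rollout M μ ν (n + 1) h hh x), (ζ i).1 ∈ s := by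
      intro x hx
      rw [ae_iff]
      change rollout M μ ν (n + 1) h hh x {ζ | (ζ i).1 ∈ s}ᶜ = 0
      rw [← lintegral_indicator_one hms, lintegral_rollout_succ _ _ _ _ _ _ _
        (measurable_one.indicator hms)]
      refine Finset.sum_eq_zero fun a _ => Finset.sum_eq_zero fun b _ => ?_
      rw [mul_eq_zero]
      right
      rw [lintegral_eq_zero_of_ae_eq_zero]
      filter_upwards [hx a b] with x' hx'
      rw [Pi.zero_apply, lintegral_eq_zero_of_ae_eq_zero]
      filter_upwards [hx'] with ζ hζ
      simpa using hζ
    rcases Fin.eq_zero_or_eq_succ i with rfl | ⟨i, rfl⟩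
    · filter_upwards [hp] with x hx
      exact key x fun a b => Filter.Eventually.of_forall fun _ =>
        Filter.Eventually.of_forall fun _ => hx
    · have h1 := ih (h + 1) (by omega) i (by rwa [Fin.val_succ, add_comm (i : ℕ), ← add_assoc] at hp)
      filter_upwards [ae_ae_of_reachMeasure_succ M ⟨h, by omega⟩ h1] with x hx
      exact key x fun a b => by simpa using hx a b

theorem ae_episodeLaw_of_reachMeasure (M : MarkovGame H X A B) (μ : Policy H X A)
    (ν : Policy H X B) (h : Fin H) {s : Set X} (hs : MeasurableSet s)
    (hp : ∀ᵐ x ∂(reachMeasure M h), x ∈ s) : ∀ᵐ ζ ∂(episodeLaw M μ ν), (ζ h).1 ∈ s := by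
  have h1 := ae_rollout_of_reachMeasure M μ ν H 0 (by omega) h hs (by simpa using hp)
  have hms : MeasurableSet {ζ : Traj H X A B | (ζ h).1 ∈ s} :=
    (by fun_prop : Measurable fun ζ : Traj H X A B => (ζ h).1) hs
  have hset : MeasurableSet {x | ∀ᵐ ζ ∂(rollout M μ ν H 0 (by omega) x), (ζ h).1 ∈ s} := by
    simp only [ae_iff]
    exact (Kernel.measurable_coe _ hms.compl) (measurableSet_singleton 0)
  rw [reachMeasure, ae_dirac_iff hset] at h1
  exact h1

end Rollout

section Values

variable {H : ℕ} {X A B : Type*} [MeasurableSpace X]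
  [Fintype A] [Nonempty A] [MeasurableSpace A] [MeasurableSingletonClass A]
  [Fintype B] [Nonempty B] [MeasurableSpace B] [MeasurableSingletonClass B]

/-! ### Bellman equations for the values of policies -/

/-- The expected total reward of the last `n` steps, which start at step `h` in the state `x`. -/
def valueToGo (M : MarkovGame H X A B) (μ : Policy H X A) (ν : Policy H X B) (n h : ℕ)
    (hh : h + n = H) (x : X) : ℝ :=
  ∫ ζ, totalReward M n h hh ζ ∂(rollout M μ ν n h hh x)

theorem measurable_totalReward (M : MarkovGame H X A B) (n h : ℕ) (hh : h + n = H) :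
    Measurable (totalReward M n h hh) := by
  unfold totalReward
  exact Finset.measurable_sum _ fun i _ => (measurable_reward M _).comp (measurable_pi_apply i)

theorem totalReward_mem_Icc (M : MarkovGame H X A B) (n h : ℕ) (hh : h + n = H)
    (ζ : Traj n X A B) : totalReward M n h hh ζ ∈ Set.Icc (0 : ℝ) n := by
  refine ⟨Finset.sum_nonneg fun i _ => (M.r_mem _ _ _ _).1, ?_⟩
  calc totalReward M n h hh ζ ≤ ∑ _i : Fin n, (1 : ℝ) :=
        Finset.sum_le_sum fun i _ => (M.r_mem _ _ _ _).2
    _ = n := by simp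

theorem abs_totalReward_le (M : MarkovGame H X A B) (n h : ℕ) (hh : h + n = H)
    (ζ : Traj n X A B) : |totalReward M n h hh ζ| ≤ n := by
  have := totalReward_mem_Icc M n h hh ζ
  rw [abs_of_nonneg this.1]
  exact this.2

theorem totalReward_cons (M : MarkovGame H X A B) (n h : ℕ) (hh : h + (n + 1) = H)
    (z : X × A × B) (ζ : Traj n X A B) :
    totalReward M (n + 1) h hh (Fin.cons z ζ) =
      M.r ⟨h, by omega⟩ z.1 z.2.1 z.2.2 + totalReward M n (h + 1) (by omega) ζ := by
  simp only [totalReward, Fin.sum_univ_succ, Fin.cons_zero, Fin.cons_succ]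
  congr 1
  refine Finset.sum_congr rfl fun i _ => ?_
  congr 2
  simp only [Fin.val_succ]
  omega

theorem measurable_valueToGo (M : MarkovGame H X A B) (μ : Policy H X A) (ν : Policy H X B)
    (n h : ℕ) (hh : h + n = H) : Measurable (valueToGo M μ ν n h hh) :=
  ((measurable_totalReward M n h hh).stronglyMeasurable.integral_kernel).measurable

theorem valueToGo_mem_Icc (M : MarkovGame H X A B) (μ : Policy H X A) (ν : Policy H X B)
    (n h : ℕ) (hh : h + n = H) (x : X) : valueToGo M μ ν n h hh x ∈ Set.Icc (0 : ℝ) n := by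
  refine ⟨integral_nonneg fun ζ => (totalReward_mem_Icc M n h hh ζ).1, ?_⟩
  calc valueToGo M μ ν n h hh x ≤ ∫ _, (n : ℝ) ∂(rollout M μ ν n h hh x) :=
        integral_mono (integrable_of_bounded (measurable_totalReward M n h hh)
          (abs_totalReward_le M n h hh)) (integrable_const _)
          fun ζ => (totalReward_mem_Icc M n h hh ζ).2
    _ = n := by simp

theorem integral_consKernel_totalReward (M : MarkovGame H X A B) (μ : Policy H X A)
    (ν : Policy H X B) (n h : ℕ) (hh : h + (n + 1) = H) (x : X) (a : A) (b : B) :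
    ∫ ζ, totalReward M (n + 1) h hh ζ ∂(consKernel M ⟨h, by omega⟩
      (rollout M μ ν n (h + 1) (by omega)) (x, a, b)) =
      backup M ⟨h, by omega⟩ (valueToGo M μ ν n (h + 1) (by omega)) x a b := by
  haveI := M.markov
  rw [integral_consKernel M _ _ _ (measurable_totalReward M _ h hh) (abs_totalReward_le M _ h hh)]
  simp only [totalReward_cons]
  have h1 : ∀ x', ∫ ζ, (M.r ⟨h, by omega⟩ x a b + totalReward M n (h + 1) (by omega) ζ)
      ∂(rollout M μ ν n (h + 1) (by omega) x') =
      M.r ⟨h, by omega⟩ x a b + valueToGo M μ ν n (h + 1) (by omega) x' := by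
    intro x'
    rw [integral_add (integrable_const _) (integrable_of_bounded (measurable_totalReward M n _ _)
      (abs_totalReward_le M n _ _))]
    simp [valueToGo]
  simp only [h1]
  rw [integral_add (integrable_const _) (Integrable.of_mem_Icc 0 n
    (measurable_valueToGo M μ ν n _ _).aemeasurable
    (Filter.Eventually.of_forall (valueToGo_mem_Icc M μ ν n _ _)))]
  simp [backup]

theorem valueToGo_succ (M : MarkovGame H X A B) (μ : Policy H X A) (ν : Policy H X B) (n h : ℕ)
    (hh : h + (n + 1) = H) (x : X) :
    valueToGo M μ ν (n + 1) h hh x = payoff (μ.prob ⟨h, by omega⟩ x)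
      (backup M ⟨h, by omega⟩ (valueToGo M μ ν n (h + 1) (by omega)) x)
      (ν.prob ⟨h, by omega⟩ x) := by
  rw [valueToGo, integral_rollout_succ_eq_consKernel M μ ν n h hh x
    (measurable_totalReward M _ h hh) (abs_totalReward_le M _ h hh)]
  simp only [integral_consKernel_totalReward]

theorem value_eq_valueToGo (M : MarkovGame H X A B) (μ : Policy H X A) (ν : Policy H X B) (n : ℕ)
    (h : Fin H) (hh : (h : ℕ) + n = H) (x : X) : value M μ ν h x = valueToGo M μ ν n h hh x := by
  obtain rfl : n = H - h := by omega
  rfl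

theorem qValue_eq_backup (M : MarkovGame H X A B) (μ : Policy H X A) (ν : Policy H X B) (n : ℕ)
    (h : Fin H) (hh : (h : ℕ) + 1 + n = H) (x : X) (a : A) (b : B) :
    qValue M μ ν h x a b = backup M h (valueToGo M μ ν n (h + 1) hh) x a b := by
  obtain rfl : n = H - (h + 1) := by omega
  exact integral_consKernel_totalReward M μ ν _ h (by omega) x a b

theorem initValue_eq_valueToGo (M : MarkovGame H X A B) (μ : Policy H X A) (ν : Policy H X B) :
    initValue M μ ν = valueToGo M μ ν H 0 (by omega) M.init :=
  rfl

theorem valueToGo_congr (M : MarkovGame H X A B) (μ : Policy H X A) {ν ν' : Policy H X B}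
    (n h : ℕ) (hh : h + n = H) (hν : ∀ k : Fin H, h ≤ k → ν.prob k = ν'.prob k) :
    valueToGo M μ ν n h hh = valueToGo M μ ν' n h hh := by
  induction n generalizing h with
  | zero => funext x; simp [valueToGo, totalReward]
  | succ n ih =>
    funext x
    rw [valueToGo_succ, valueToGo_succ, ih (h + 1) (by omega) fun k hk => hν k (by omega),
      hν _ le_rfl]

/-- The policy that plays the mixed action `q` at step `h` and follows `ν` otherwise. -/
def Policy.deviate (ν : Policy H X B) (h : Fin H) (q : B → ℝ) (hq : q ∈ stdSimplex ℝ B) :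
    Policy H X B where
  prob k x := if k = h then q else ν.prob k x
  mem k x := by split_ifs; exacts [hq, ν.mem k x]
  measurable_prob k b := by
    split_ifs
    exacts [measurable_const, ν.measurable_prob k b]

/-- Deviating at the single step `h` leaves the later values unchanged, so the saddle point property
yields one half of the Bellman optimality equation, as an inequality for every mixed reply. -/
theorem IsNash.valueToGo_le_payoff {M : MarkovGame H X A B} {μ : Policy H X A}
    {ν : Policy H X B} (hN : IsNash M μ ν) (n h : ℕ) (hh : h + (n + 1) = H) (x : X) {q : B → ℝ}
    (hq : q ∈ stdSimplex ℝ B) :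
    valueToGo M μ ν (n + 1) h hh x ≤ payoff (μ.prob ⟨h, by omega⟩ x)
      (backup M ⟨h, by omega⟩ (valueToGo M μ ν n (h + 1) (by omega)) x) q := by
  have h1 := (hN ⟨h, by omega⟩ x).2 (ν.deviate ⟨h, by omega⟩ q hq)
  rw [value_eq_valueToGo M μ ν (n + 1) ⟨h, by omega⟩ hh,
    value_eq_valueToGo M μ _ (n + 1) ⟨h, by omega⟩ hh] at h1
  refine h1.trans_eq ?_
  rw [valueToGo_succ, valueToGo_congr M μ (ν' := ν) n (h + 1) _ fun k hk => ?_]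
  · simp [Policy.deviate]
  · funext x
    exact if_neg fun hk' => by simp [hk'] at hk

theorem initValue_nonneg (M : MarkovGame H X A B) (μ : Policy H X A) (ν : Policy H X B) :
    0 ≤ initValue M μ ν :=
  integral_nonneg fun ζ => (totalReward_mem_Icc M H 0 (by omega) ζ).1

theorem initValue_le (M : MarkovGame H X A B) (μ : Policy H X A) (ν : Policy H X B) :
    initValue M μ ν ≤ H :=
  (valueToGo_mem_Icc M μ ν H 0 (by omega) M.init).2

variable {F : FunctionClass H X A B}

/-- The initial value is an average of `Q^*` at the first step, which belongs to the class and hence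
is at most `β - 1`; this gives the trivial regret bound `T(β - 1)`. -/
theorem Realizable.initValue_le {M : MarkovGame H X A B} {I : InducedPolicies F}
    {μs : Policy H X A} {νs : Policy H X B} (hR : Realizable M I μs νs) {β : ℝ} (hβ : 1 < β)
    (hF : BoundedBy F β) : initValue M μs νs ≤ β - 1 := by
  rw [initValue_eq_valueToGo]
  cases H with
  | zero => simp [valueToGo, totalReward]; linarith
  | succ n =>
    rw [valueToGo_succ]
    refine (payoff_mem_Icc (c := 0) (μs.mem _ _) (νs.mem _ _) fun a b => ?_).2
    have := hF 0 _ (hR.1 0) M.init a b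
    rwa [qValue_eq_backup M μs νs n 0 (by simp; omega)] at this

/-! ### Performance difference and optimism -/

/-- Substitute `f^h = E_h(f) + r^h + P_h V_{f,h+1}` repeatedly. At each step `V_{f,h} ≤ μ_fᵀ f^h ν`,
an inequality in the right direction for arbitrary `ν`. -/
theorem maxminValue_le_integral_rollout (M : MarkovGame H X A B) (I : InducedPolicies F) {β : ℝ}
    (hβ : 1 < β) (hF : BoundedBy F β) (f : F.Elems) (ν : Policy H X B) (n h : ℕ) (hh : h + n = H)
    (x : X) :
    maxminValue f h x ≤ ∫ ζ, ∑ i : Fin n, (residual M ⟨h + i, by omega⟩ f (ζ i) +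
      M.r ⟨h + i, by omega⟩ (ζ i).1 (ζ i).2.1 (ζ i).2.2)
        ∂(rollout M (I.maxPolicy f) ν n h hh x) := by
  haveI := M.markov
  have hm : ∀ k : Fin H, Measurable fun z : X × A × B =>
      residual M k f z + M.r k z.1 z.2.1 z.2.2 := fun k => by
    have := (measurable_residual M I k).comp (measurable_prodMk_left (x := f))
    exact Measurable.add this (measurable_reward M k)
  have hb : ∀ (k : Fin H) (z : X × A × B),
      |residual M k f z + M.r k z.1 z.2.1 z.2.2| ≤ β + 1 := fun k z => by
    refine (abs_add_le _ _).trans (add_le_add (abs_residual_le M I hβ hF k f z) ?_)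
    have := M.r_mem k z.1 z.2.1 z.2.2
    rw [abs_of_nonneg this.1]
    exact this.2
  have hms : ∀ (n h : ℕ) (hh : h + n = H), Measurable fun ζ : Traj n X A B =>
      ∑ i : Fin n, (residual M ⟨h + i, by omega⟩ f (ζ i) +
      M.r ⟨h + i, by omega⟩ (ζ i).1 (ζ i).2.1 (ζ i).2.2) := fun n h hh =>
    Finset.measurable_sum _ fun i _ => (hm _).comp (measurable_pi_apply i)
  have hbs : ∀ (n h : ℕ) (hh : h + n = H) (ζ : Traj n X A B),
      |∑ i : Fin n, (residual M ⟨h + i, by omega⟩ f (ζ i) +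
      M.r ⟨h + i, by omega⟩ (ζ i).1 (ζ i).2.1 (ζ i).2.2)| ≤ n * (β + 1) := fun n h hh ζ => by
    refine (Finset.abs_sum_le_sum_abs _ _).trans ?_
    refine (Finset.sum_le_sum fun i _ => hb _ _).trans_eq ?_
    rw [Finset.sum_const, Finset.card_univ, Fintype.card_fin, nsmul_eq_mul]
  induction n generalizing h x with
  | zero => simp [maxminValue_horizon f (show H ≤ h by omega)]
  | succ n ih =>
    rw [integral_rollout_succ M _ ν n h hh x (hms _ _ hh) (hbs _ _ hh)]
    have hlt : h < H := by omega
    refine (maxminValue_le_payoff I f hlt x (ν.mem ⟨h, hlt⟩ x)).trans ?_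
    refine payoff_mono (I.mu_mem _ _ _) (ν.mem _ _) fun a b => ?_
    have hsum : ∀ ζ : Traj n X A B,
        ∑ i : Fin (n + 1), (residual M ⟨h + i, by omega⟩ f
            ((Fin.cons (x, a, b) ζ : Traj (n + 1) X A B) i) +
          M.r ⟨h + i, by omega⟩ ((Fin.cons (x, a, b) ζ : Traj (n + 1) X A B) i).1
            ((Fin.cons (x, a, b) ζ : Traj (n + 1) X A B) i).2.1
            ((Fin.cons (x, a, b) ζ : Traj (n + 1) X A B) i).2.2) =
        (residual M ⟨h, hlt⟩ f (x, a, b) + M.r ⟨h, hlt⟩ x a b) +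
        ∑ i : Fin n, (residual M ⟨h + 1 + i, by omega⟩ f (ζ i) +
          M.r ⟨h + 1 + i, by omega⟩ (ζ i).1 (ζ i).2.1 (ζ i).2.2) := by
      intro ζ
      rw [Fin.sum_univ_succ]
      simp only [Fin.cons_zero, Fin.cons_succ]
      congr 1
      refine Finset.sum_congr rfl fun i _ => ?_
      have : (⟨h + (i.succ : ℕ), by rw [Fin.val_succ]; omega⟩ : Fin H) = ⟨h + 1 + i, by omega⟩ :=
        Fin.ext (by simp only [Fin.val_succ]; omega)
      rw [this]
    simp only [hsum]
    have hint : ∀ x', Integrable (fun ζ : Traj n X A B =>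
        ∑ i : Fin n, (residual M ⟨h + 1 + i, by omega⟩ f (ζ i) +
          M.r ⟨h + 1 + i, by omega⟩ (ζ i).1 (ζ i).2.1 (ζ i).2.2))
        (rollout M (I.maxPolicy f) ν n (h + 1) (by omega) x') := fun x' =>
      integrable_of_bounded (hms _ _ (by omega)) (hbs _ _ (by omega))
    simp only [integral_add (integrable_const _) (hint _), integral_const, probReal_univ, one_smul]
    have hint2 : Integrable (fun x' => ∫ ζ, ∑ i : Fin n, (residual M ⟨h + 1 + i, by omega⟩ f (ζ i) +
          M.r ⟨h + 1 + i, by omega⟩ (ζ i).1 (ζ i).2.1 (ζ i).2.2)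
          ∂(rollout M (I.maxPolicy f) ν n (h + 1) (by omega) x')) (M.P ⟨h, hlt⟩ (x, a, b)) := by
      refine integrable_of_bounded
        ((hms _ _ (by omega)).stronglyMeasurable.integral_kernel).measurable
        (c := n * (β + 1)) fun x' => ?_
      exact abs_integral_le_of_bounded (hbs n (h + 1) (by omega))
    rw [integral_add (integrable_const _) hint2]
    have hV : Integrable (maxminValue f (h + 1)) (M.P ⟨h, hlt⟩ (x, a, b)) :=
      Integrable.of_mem_Icc 0 (β - 1) (measurable_maxminValue_right I f _).aemeasurable
        (Filter.Eventually.of_forall (maxminValue_mem_Icc I hβ hF f _))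
    have := integral_mono hV hint2 fun x' => ih (h + 1) (by omega) x' hms hbs
    have hr : residual M ⟨h, hlt⟩ f (x, a, b) = (f ⟨h, hlt⟩).1 x a b - (M.r ⟨h, hlt⟩ x a b +
      ∫ x', maxminValue f (h + 1) x' ∂(M.P ⟨h, hlt⟩ (x, a, b))) := rfl
    rw [hr, integral_const, probReal_univ, one_smul]
    simp only at this
    linarith

theorem maxminValue_sub_initValue_le (M : MarkovGame H X A B) (I : InducedPolicies F) {β : ℝ}
    (hβ : 1 < β) (hF : BoundedBy F β) (f : F.Elems) (ν : Policy H X B) :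
    maxminValue f 0 M.init - initValue M (I.maxPolicy f) ν ≤
      ∑ h, ∫ ζ, residual M h f (ζ h) ∂(episodeLaw M (I.maxPolicy f) ν) := by
  have h1 := maxminValue_le_integral_rollout M I hβ hF f ν H 0 (by omega) M.init
  have hm : ∀ k : Fin H, Measurable fun z : X × A × B => residual M k f z := fun k => by
    have := (measurable_residual M I k).comp (measurable_prodMk_left (x := f))
    exact this
  have hint : ∀ k : Fin H, Integrable (fun ζ : Traj H X A B => residual M k f (ζ k))
      (episodeLaw M (I.maxPolicy f) ν) := fun k =>
    integrable_of_bounded ((hm k).comp (measurable_pi_apply k))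
      fun ζ => abs_residual_le M I hβ hF k f _
  rw [← integral_finsetSum _ fun k _ => hint k]
  have hR : Integrable (totalReward M H 0 (by omega)) (episodeLaw M (I.maxPolicy f) ν) :=
    integrable_of_bounded (measurable_totalReward M H 0 _) (abs_totalReward_le M H 0 _)
  rw [sub_le_iff_le_add, initValue, ← integral_add (integrable_finsetSum _ fun k _ => hint k) hR]
  refine h1.trans_eq ?_
  rw [episodeLaw]
  congr 1
  funext ζ
  rw [totalReward, ← Finset.sum_add_distrib]
  refine Finset.sum_congr rfl fun i _ => ?_
  have : (⟨0 + (i : ℕ), by omega⟩ : Fin H) = i := Fin.ext (by simp)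
  rw [this]

theorem measurable_residual_right (M : MarkovGame H X A B) (I : InducedPolicies F) (h : Fin H)
    (f : F.Elems) : Measurable fun z : X × A × B => residual M h f z := by
  have := (measurable_residual M I h).comp (measurable_prodMk_left (x := f))
  exact this

/-- `f` is an approximate solution of the optimality equation at the reachable states. -/
def NearOptimal (M : MarkovGame H X A B) (ε : ℝ) (h : Fin H) (f : F.Elems) : Prop :=
  ∀ᵐ x ∂(reachMeasure M h), ∀ a b, |residual M h f (x, a, b)| ≤ ε

/-- Backward induction: the max-min value of `f^h` is at least what `μs` guarantees on `f^h`, and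
`f^h` exceeds the backup of `V_{f,h+1}` up to `ε`. Each step loses one `ε`, and only reachable
states matter. -/
theorem IsNash.valueToGo_le_maxminValue {M : MarkovGame H X A B} (I : InducedPolicies F)
    {μs : Policy H X A} {νs : Policy H X B} (hN : IsNash M μs νs) {β : ℝ} (hβ : 1 < β)
    (hF : BoundedBy F β) {ε : ℝ} {f : F.Elems} (hf : ∀ h, NearOptimal M ε h f) (n h : ℕ)
    (hh : h + n = H) :
    ∀ᵐ x ∂(reachMeasure M h), valueToGo M μs νs n h hh x - n * ε ≤ maxminValue f h x := by
  haveI := M.markov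
  induction n generalizing h with
  | zero =>
    refine Filter.Eventually.of_forall fun x => ?_
    simp [maxminValue_horizon f (show H ≤ h by omega), valueToGo, totalReward]
  | succ n ih =>
    have hlt : h < H := by omega
    filter_upwards [hf ⟨h, hlt⟩, ae_ae_of_reachMeasure_succ M ⟨h, hlt⟩ (ih (h + 1) (by omega))]
      with x h1 h2
    refine le_trans (le_responseValue fun q hq => ?_)
      (responseValue_le_maxminValue I f hlt x (μs.mem ⟨h, hlt⟩ x))
    have h3 := hN.valueToGo_le_payoff n h hh x hq
    refine (sub_le_sub_right h3 _).trans ?_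
    -- The error is written as the payoff of a constant matrix, so that the two games can be
    -- compared entry by entry.
    conv_lhs => rw [← payoff_const (μs.mem ⟨h, hlt⟩ x) hq ((n + 1 : ℕ) * ε)]
    rw [← payoff_sub]
    refine payoff_mono (μs.mem _ _) hq fun a b => ?_
    have h4 := (abs_le.1 (h1 a b)).1
    have hV : Integrable (maxminValue f (h + 1)) (M.P ⟨h, hlt⟩ (x, a, b)) :=
      Integrable.of_mem_Icc 0 (β - 1) (measurable_maxminValue_right I f _).aemeasurable
        (Filter.Eventually.of_forall (maxminValue_mem_Icc I hβ hF f _))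
    have hV' : Integrable (valueToGo M μs νs n (h + 1) (by omega)) (M.P ⟨h, hlt⟩ (x, a, b)) :=
      Integrable.of_mem_Icc 0 n (measurable_valueToGo M μs νs n _ _).aemeasurable
        (Filter.Eventually.of_forall (valueToGo_mem_Icc M μs νs n _ _))
    have h5 := integral_mono_ae (hV'.sub (integrable_const (n * ε))) hV (h2 a b)
    rw [integral_sub' hV' (integrable_const _)] at h5
    simp only [residual, bellman, backup, integral_const, probReal_univ, one_smul] at h4 h5 ⊢
    push_cast
    linarith

theorem IsNash.initValue_le_maxminValue {M : MarkovGame H X A B} (I : InducedPolicies F)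
    {μs : Policy H X A} {νs : Policy H X B} (hN : IsNash M μs νs) {β : ℝ} (hβ : 1 < β)
    (hF : BoundedBy F β) {ε : ℝ} {f : F.Elems} (hf : ∀ h, NearOptimal M ε h f) :
    initValue M μs νs - H * ε ≤ maxminValue f 0 M.init := by
  have h1 := hN.valueToGo_le_maxminValue I hβ hF hf H 0 (by omega)
  -- At the first step the reachable states reduce to a point mass, so the almost sure statement is
  -- one about the initial state.
  rw [reachMeasure, ae_dirac_iff] at h1
  · exact h1
  · exact measurableSet_le ((measurable_valueToGo M μs νs H 0 _).sub_const _)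
      (measurable_maxminValue_right I f 0)

end Values

section Excess

variable {H : ℕ} {X A B : Type*} [MeasurableSpace X]
  [Fintype A] [Nonempty A] [MeasurableSpace A] [MeasurableSingletonClass A]
  [Fintype B] [Nonempty B] [MeasurableSpace B] [MeasurableSingletonClass B]
  {F : FunctionClass H X A B}

/-! ### The excess loss over the Bayes predictor -/

/-- The noise `E[V_{f,h+1}(x^{h+1}) | x^h, a^h, b^h] - V_{f,h+1}(x^{h+1})` of the regression target. -/
def noise (M : MarkovGame H X A B) (h : Fin H) (f : F.Elems) (ζ : Traj H X A B) : ℝ :=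
  ∫ x', maxminValue f (h + 1) x' ∂(M.P h (ζ h)) - maxminValue f (h + 1) (nextState ζ h)

/-- The squared loss of `f^h` on one episode minus that of the Bellman backup `T_h f`. -/
def excessLoss (M : MarkovGame H X A B) (h : Fin H) (f : F.Elems) (ζ : Traj H X A B) : ℝ :=
  residual M h f (ζ h) ^ 2 + 2 * residual M h f (ζ h) * noise M h f ζ

/-- The regression error `f^h - r^h - V_{f,h+1}(x^{h+1})` is residual plus noise. The squared noise
depends on `f^{h+1}` only, hence it cancels in the conditional likelihood of `f^h`. -/
theorem sqLoss_eq_excessLoss (M : MarkovGame H X A B) (h : Fin H) (f : F.Elems) {t : ℕ}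
    (S : Fin t → Traj H X A B) :
    sqLoss M h (f h).1 (maxminValue f (h + 1)) S =
      ∑ s, excessLoss M h f (S s) + ∑ s, noise M h f (S s) ^ 2 := by
  rw [sqLoss, ← Finset.sum_add_distrib]
  refine Finset.sum_congr rfl fun s _ => ?_
  simp only [excessLoss, noise, residual, bellman, backup]
  ring

theorem measurable_nextState (h : Fin H) :
    Measurable fun ζ : Traj H X A B => nextState ζ h := by
  unfold nextState
  split_ifs <;> fun_prop

theorem measurable_noise (M : MarkovGame H X A B) (I : InducedPolicies F) (h : Fin H) :
    Measurable fun p : F.Elems × Traj H X A B => noise M h p.1 p.2 := by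
  have h1 := (measurable_bellman M I h).comp (by fun_prop :
    Measurable fun p : F.Elems × Traj H X A B => (p.1, p.2 h))
  have h2 := (measurable_reward M h).comp (by fun_prop :
    Measurable fun p : F.Elems × Traj H X A B => p.2 h)
  have h3 := (measurable_maxminValue I (h + 1)).comp (measurable_fst.prodMk
    ((measurable_nextState h).comp measurable_snd) :
    Measurable fun p : F.Elems × Traj H X A B => (p.1, nextState p.2 h))
  convert (h1.sub h2).sub h3 using 1
  funext p
  simp [noise, bellman, backup]

theorem measurable_excessLoss (M : MarkovGame H X A B) (I : InducedPolicies F) (h : Fin H) :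
    Measurable fun p : F.Elems × Traj H X A B => excessLoss M h p.1 p.2 := by
  have h1 := (measurable_residual M I h).comp (by fun_prop :
    Measurable fun p : F.Elems × Traj H X A B => (p.1, p.2 h))
  exact (h1.pow_const 2).add ((h1.const_mul 2).mul (measurable_noise M I h))

theorem abs_noise_le (M : MarkovGame H X A B) (I : InducedPolicies F) {β : ℝ} (hβ : 1 < β)
    (hF : BoundedBy F β) (h : Fin H) (f : F.Elems) (ζ : Traj H X A B) : |noise M h f ζ| ≤ β := by
  have h1 := maxminValue_mem_Icc I hβ hF f (h + 1) (nextState ζ h)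
  have h2 := backup_sub_reward_mem_Icc M h (measurable_maxminValue_right I f (h + 1))
    (maxminValue_mem_Icc I hβ hF f (h + 1)) (ζ h).1 (ζ h).2.1 (ζ h).2.2
  have h3 : ∫ x', maxminValue f (h + 1) x' ∂(M.P h (ζ h)) ∈ Set.Icc 0 (β - 1) := h2
  rw [noise, abs_le]
  constructor <;> linarith [h1.1, h1.2, h3.1, h3.2]

theorem abs_excessLoss_le_of_residual (M : MarkovGame H X A B) (I : InducedPolicies F) {β : ℝ}
    (hβ : 1 < β) (hF : BoundedBy F β) (h : Fin H) (f : F.Elems) (ζ : Traj H X A B) {ε : ℝ}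
    (hε : |residual M h f (ζ h)| ≤ ε) : |excessLoss M h f ζ| ≤ ε ^ 2 + 2 * ε * β := by
  have h0 : 0 ≤ ε := (abs_nonneg _).trans hε
  have hn := abs_noise_le M I hβ hF h f ζ
  rw [excessLoss]
  refine (abs_add_le _ _).trans (add_le_add ?_ ?_)
  · rw [abs_pow]
    gcongr
  · rw [abs_mul, abs_mul, abs_of_pos (by norm_num : (0 : ℝ) < 2)]
    gcongr

theorem abs_excessLoss_le (M : MarkovGame H X A B) (I : InducedPolicies F) {β : ℝ}
    (hβ : 1 < β) (hF : BoundedBy F β) (h : Fin H) (f : F.Elems) (ζ : Traj H X A B) :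
    |excessLoss M h f ζ| ≤ 3 * β ^ 2 :=
  (abs_excessLoss_le_of_residual M I hβ hF h f ζ (abs_residual_le M I hβ hF h f _)).trans_eq
    (by ring)

/-- From `e^{-y} ≤ 1 / (1 + y)`; the product `(1 - 2y/3)(1 + y)` is at least `1` exactly on `[0,
1/2]`. -/
theorem exp_neg_le_one_sub {y : ℝ} (h0 : 0 ≤ y) (h1 : y ≤ 1 / 2) :
    Real.exp (-y) ≤ 1 - 2 / 3 * y := by
  rw [Real.exp_neg]
  have h2 : 1 + y ≤ Real.exp y := by linarith [Real.add_one_le_exp y]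
  refine (inv_anti₀ (by linarith) h2).trans ?_
  rw [inv_le_iff_one_le_mul₀ (by linarith)]
  nlinarith

/-- Hoeffding's lemma at `2θd` costs `θ²d²(β - 1)²/2 ≤ θd²/4`, which leaves `e^{-3θd²/4}`. The final
bound is linear in `d²` on purpose: it can then be averaged over `d`, whereas Jensen's inequality
goes the wrong way for `e^{-θd²}`. -/
theorem integral_exp_regression_le {Ω : Type*} [MeasurableSpace Ω] (P : Measure Ω)
    [IsProbabilityMeasure P] {V : Ω → ℝ} (hVm : Measurable V) {β θ d : ℝ} (hβ : 1 < β)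
    (hV : ∀ ω, V ω ∈ Set.Icc 0 (β - 1)) (hd : |d| ≤ β) (hθ0 : 0 ≤ θ) (hθ : θ * β ^ 2 ≤ 1 / 2) :
    ∫ ω, Real.exp (-θ * (d ^ 2 + 2 * d * (∫ ω', V ω' ∂P - V ω))) ∂P ≤ 1 - θ / 2 * d ^ 2 := by
  have hoeff := (hasSubgaussianMGF_of_mem_Icc (μ := P) hVm.aemeasurable
    (Filter.Eventually.of_forall hV)).mgf_le (2 * θ * d)
  have hc : (((‖β - 1 - 0‖₊ / 2) ^ 2 : NNReal) : ℝ) = ((β - 1) / 2) ^ 2 := by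
    push_cast
    rw [sub_zero, Real.norm_of_nonneg (by linarith)]
  rw [hc, mgf] at hoeff
  have h1 : ∀ ω, Real.exp (-θ * (d ^ 2 + 2 * d * (∫ ω', V ω' ∂P - V ω))) =
      Real.exp (-θ * d ^ 2) * Real.exp (2 * θ * d * (V ω - ∫ ω', V ω' ∂P)) := fun ω => by
    rw [← Real.exp_add]
    ring_nf
  simp only [h1, integral_const_mul]
  have hd2 : d ^ 2 ≤ β ^ 2 := sq_le_sq' (abs_le.1 hd).1 (abs_le.1 hd).2
  have hb : (β - 1) ^ 2 ≤ β ^ 2 := by nlinarith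
  have ht : 0 ≤ θ * d ^ 2 := by positivity
  have ht1 : θ * d ^ 2 ≤ 1 / 2 := (mul_le_mul_of_nonneg_left hd2 hθ0).trans hθ
  have htb : θ * (β - 1) ^ 2 ≤ 1 / 2 := (mul_le_mul_of_nonneg_left hb hθ0).trans hθ
  calc Real.exp (-θ * d ^ 2) * ∫ ω, Real.exp (2 * θ * d * (V ω - ∫ ω', V ω' ∂P)) ∂P
      ≤ Real.exp (-θ * d ^ 2) * Real.exp (((β - 1) / 2) ^ 2 * (2 * θ * d) ^ 2 / 2) := by gcongr
    _ = Real.exp (-θ * d ^ 2 + θ * d ^ 2 * (θ * (β - 1) ^ 2) / 2) := by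
        rw [← Real.exp_add]
        ring_nf
    _ ≤ Real.exp (-(3 / 4 * (θ * d ^ 2))) := by
        refine Real.exp_le_exp.2 ?_
        nlinarith
    _ ≤ 1 - 2 / 3 * (3 / 4 * (θ * d ^ 2)) := exp_neg_le_one_sub (by positivity) (by linarith)
    _ = 1 - θ / 2 * d ^ 2 := by ring

theorem measurable_excessLoss_right (M : MarkovGame H X A B) (I : InducedPolicies F) (h : Fin H)
    (f : F.Elems) : Measurable fun ζ : Traj H X A B => excessLoss M h f ζ := by
  have := (measurable_excessLoss M I h).comp (measurable_prodMk_left (x := f))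
  exact this

theorem lintegral_exp_excessLoss_le_lintegral (M : MarkovGame H X A B) (I : InducedPolicies F)
    {β θ : ℝ} (hβ : 1 < β) (hF : BoundedBy F β) (hθ0 : 0 ≤ θ) (hθ : θ * β ^ 2 ≤ 1 / 2)
    (μ : Policy H X A) (ν : Policy H X B) (h : Fin H) (f : F.Elems) :
    ∫⁻ ζ, ENNReal.ofReal (Real.exp (-θ * excessLoss M h f ζ)) ∂(episodeLaw M μ ν) ≤
      ∫⁻ ζ, ENNReal.ofReal (1 - θ / 2 * residual M h f (ζ h) ^ 2) ∂(episodeLaw M μ ν) := by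
  haveI := M.markov
  have hVm := measurable_maxminValue_right I f (h + 1)
  have hVb := maxminValue_mem_Icc I hβ hF f (h + 1)
  by_cases hh : (h : ℕ) + 1 < H
  · let G : (X × A × B) × X → ℝ≥0∞ := fun w => ENNReal.ofReal (Real.exp (-θ *
      (residual M h f w.1 ^ 2 + 2 * residual M h f w.1 *
        (∫ x', maxminValue f (h + 1) x' ∂(M.P h w.1) - maxminValue f (h + 1) w.2))))
    have hG : Measurable G := by
      have h1 : Measurable fun w : (X × A × B) × X => residual M h f w.1 :=
        (measurable_residual_right M I h f).comp measurable_fst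
      have h2 : Measurable fun w : (X × A × B) × X => ∫ x', maxminValue f (h + 1) x' ∂(M.P h w.1) :=
        (hVm.stronglyMeasurable.integral_kernel (κ := M.P h)).measurable.comp measurable_fst
      have h3 : Measurable fun w : (X × A × B) × X => maxminValue f (h + 1) w.2 :=
        hVm.comp measurable_snd
      exact (((h1.pow_const 2).add ((h1.const_mul 2).mul (h2.sub h3))).const_mul
        (-θ)).exp.ennreal_ofReal
    have h1 : ∀ ζ : Traj H X A B, ENNReal.ofReal (Real.exp (-θ * excessLoss M h f ζ)) =
        G (ζ h, (ζ ⟨h + 1, hh⟩).1) := fun ζ => by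
      simp only [excessLoss, noise, nextState, dif_pos hh, G]
    simp only [h1]
    rw [episodeLaw, lintegral_rollout_next M μ ν H 0 (by omega) h ⟨h + 1, hh⟩ rfl h (by simp)
      M.init hG]
    refine lintegral_mono fun ζ => ?_
    simp only [G]
    rw [← ofReal_integral_eq_lintegral_ofReal]
    · exact ENNReal.ofReal_le_ofReal (integral_exp_regression_le _ hVm hβ hVb
        (abs_residual_le M I hβ hF h f _) hθ0 hθ)
    · refine integrable_of_bounded (c := Real.exp (θ * (3 * β ^ 2))) ?_ fun x' => ?_
      · exact (((hVm.const_sub _).const_mul _).const_add _ |>.const_mul _).exp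
      · rw [Real.abs_exp]
        refine Real.exp_le_exp.2 ?_
        have hr := abs_residual_le M I hβ hF h f (ζ h)
        have hi := backup_sub_reward_mem_Icc M h hVm hVb (ζ h).1 (ζ h).2.1 (ζ h).2.2
        have hi' : ∫ x', maxminValue f (h + 1) x' ∂(M.P h (ζ h)) ∈ Set.Icc 0 (β - 1) := hi
        have hv := hVb x'
        have hn : |∫ x', maxminValue f (h + 1) x' ∂(M.P h (ζ h)) - maxminValue f (h + 1) x'| ≤
            β := by
          rw [abs_le]
          constructor <;> linarith [hi'.1, hi'.2, hv.1, hv.2]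
        have hp : -(β * β) ≤ residual M h f (ζ h) *
            (∫ x', maxminValue f (h + 1) x' ∂(M.P h (ζ h)) - maxminValue f (h + 1) x') := by
          refine (abs_le.1 ?_).1
          rw [abs_mul]
          gcongr
        have hq := sq_nonneg (residual M h f (ζ h))
        nlinarith [mul_nonneg hθ0 (sub_nonneg.2 hp), mul_nonneg hθ0 hq,
          mul_nonneg hθ0 (sq_nonneg β)]
    · exact Filter.Eventually.of_forall fun x' => (Real.exp_pos _).le
  -- At the last step the value after the transition is zero, so there is no noise and the
  -- conventional value of `nextState` plays no role.
  · refine lintegral_mono fun ζ => ENNReal.ofReal_le_ofReal ?_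
    have hn : noise M h f ζ = 0 := by
      simp [noise, maxminValue_horizon f (show H ≤ (h : ℕ) + 1 by omega)]
    rw [excessLoss, hn, mul_zero, add_zero]
    have hr := abs_residual_le M I hβ hF h f (ζ h)
    have hd2 : residual M h f (ζ h) ^ 2 ≤ β ^ 2 := sq_le_sq' (abs_le.1 hr).1 (abs_le.1 hr).2
    have ht : 0 ≤ θ * residual M h f (ζ h) ^ 2 := by positivity
    have ht1 := (mul_le_mul_of_nonneg_left hd2 hθ0).trans hθ
    rw [neg_mul]
    refine (exp_neg_le_one_sub ht ht1).trans ?_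
    linarith

/-- The mean square residual of `f` at step `h` when `(μ, ν)` is played. -/
def meanSq (M : MarkovGame H X A B) (h : Fin H) (f : F.Elems) (μ : Policy H X A)
    (ν : Policy H X B) : ℝ :=
  ∫ ζ, residual M h f (ζ h) ^ 2 ∂(episodeLaw M μ ν)

theorem residual_sq_le (M : MarkovGame H X A B) (I : InducedPolicies F) {β : ℝ} (hβ : 1 < β)
    (hF : BoundedBy F β) (h : Fin H) (f : F.Elems) (z : X × A × B) :
    residual M h f z ^ 2 ≤ β ^ 2 :=
  sq_le_sq' (abs_le.1 (abs_residual_le M I hβ hF h f z)).1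
    (abs_le.1 (abs_residual_le M I hβ hF h f z)).2

theorem integrable_residual_sq (M : MarkovGame H X A B) (I : InducedPolicies F) {β : ℝ}
    (hβ : 1 < β) (hF : BoundedBy F β) (h : Fin H) (f : F.Elems) (μ : Policy H X A)
    (ν : Policy H X B) :
    Integrable (fun ζ => residual M h f (ζ h) ^ 2) (episodeLaw M μ ν) :=
  integrable_of_bounded (((measurable_residual_right M I h f).comp
    (measurable_pi_apply h)).pow_const 2) (c := β ^ 2) fun ζ => by
      rw [abs_of_nonneg (sq_nonneg _)]
      exact residual_sq_le M I hβ hF h f _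

/-- Average the bound `1 - (θ/2) d²` over the episode and apply `1 - x ≤ e^{-x}`. This is the
one-round supermartingale inequality. -/
theorem lintegral_exp_excessLoss_le (M : MarkovGame H X A B) (I : InducedPolicies F)
    {β θ : ℝ} (hβ : 1 < β) (hF : BoundedBy F β) (hθ0 : 0 ≤ θ) (hθ : θ * β ^ 2 ≤ 1 / 2)
    (μ : Policy H X A) (ν : Policy H X B) (h : Fin H) (f : F.Elems) :
    ∫⁻ ζ, ENNReal.ofReal (Real.exp (-θ * excessLoss M h f ζ)) ∂(episodeLaw M μ ν) ≤
      ENNReal.ofReal (Real.exp (-(θ / 2) * meanSq M h f μ ν)) := by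
  refine (lintegral_exp_excessLoss_le_lintegral M I hβ hF hθ0 hθ μ ν h f).trans ?_
  have hint := integrable_residual_sq M I hβ hF h f μ ν
  rw [← ofReal_integral_eq_lintegral_ofReal (f := fun ζ : Traj H X A B =>
    1 - θ / 2 * residual M h f (ζ h) ^ 2)
    ((integrable_const _).sub (hint.const_mul _))]
  · refine ENNReal.ofReal_le_ofReal ?_
    rw [integral_sub (integrable_const _) (hint.const_mul _), integral_const_mul]
    have := Real.add_one_le_exp (-(θ / 2) * meanSq M h f μ ν)
    simp only [integral_const, probReal_univ, one_smul]
    unfold meanSq at this ⊢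
    linarith
  · refine Filter.Eventually.of_forall fun ζ => ?_
    have := mul_le_mul_of_nonneg_left (residual_sq_le M I hβ hF h f (ζ h)) hθ0
    simp only [Pi.zero_apply]
    linarith

end Excess

section Kernels

variable {H : ℕ} {X A B : Type*} [MeasurableSpace X]
  [Fintype A] [Nonempty A] [MeasurableSpace A] [MeasurableSingletonClass A]
  [Fintype B] [Nonempty B] [MeasurableSpace B] [MeasurableSingletonClass B]
  {F : FunctionClass H X A B}

/-! ### Measurability of the algorithm -/

/-- The policies are built from sampled functions, so the law of the episode has to be jointly
measurable in the parameter and the state. Peeling off one step at a time expresses it through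
kernel integrals. -/
theorem measurable_rollout {Θ : Type*} [MeasurableSpace Θ] (M : MarkovGame H X A B)
    (μ : Θ → Policy H X A) (ν : Θ → Policy H X B)
    (hμ : ∀ h a, Measurable fun w : Θ × X => (μ w.1).prob h w.2 a)
    (hν : ∀ h b, Measurable fun w : Θ × X => (ν w.1).prob h w.2 b) (n h : ℕ) (hh : h + n = H) :
    Measurable fun w : Θ × X => rollout M (μ w.1) (ν w.1) n h hh w.2 := by
  haveI := M.markov
  induction n generalizing h with
  | zero => simp only [rollout, Kernel.const_apply, measurable_const]
  | succ n ih =>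
    refine Measure.measurable_of_measurable_coe _ fun s hs => ?_
    have h1 : ∀ w : Θ × X, rollout M (μ w.1) (ν w.1) (n + 1) h hh w.2 s =
        ∫⁻ ζ, s.indicator 1 ζ ∂(rollout M (μ w.1) (ν w.1) (n + 1) h hh w.2) := fun w =>
      (lintegral_indicator_one hs).symm
    simp only [h1, lintegral_rollout_succ M _ _ n h hh _ (measurable_one.indicator hs)]
    refine Finset.measurable_sum _ fun a _ => Finset.measurable_sum _ fun b _ => ?_
    refine (((hμ ⟨h, by omega⟩ a).mul (hν ⟨h, by omega⟩ b)).ennreal_ofReal).mul ?_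
    let K : Kernel (Θ × X) (Traj n X A B) := ⟨_, ih (h + 1) (by omega)⟩
    haveI : IsMarkovKernel K := ⟨fun w => inferInstanceAs
      (IsProbabilityMeasure (rollout M (μ w.1) (ν w.1) n (h + 1) (by omega) w.2))⟩
    have hc1 : Measurable fun w : (Θ × X) × X => (w.1.1, w.2) := by fun_prop
    have hc2 : Measurable fun w : Θ × X => (w.2, a, b) := by fun_prop
    have hin : Measurable fun w : (Θ × X) × X =>
        ∫⁻ ζ, s.indicator (1 : Traj (n + 1) X A B → ℝ≥0∞) (Fin.cons (w.1.2, a, b) ζ)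
          ∂(K.comap _ hc1 w) := by
      refine Measurable.lintegral_kernel_prod_right (f := fun (w : (Θ × X) × X) ζ =>
        s.indicator (1 : Traj (n + 1) X A B → ℝ≥0∞) (Fin.cons (w.1.2, a, b) ζ)) ?_
      exact (measurable_one.indicator hs).comp (measurable_cons.comp (by fun_prop :
        Measurable fun p : ((Θ × X) × X) × Traj n X A B => ((p.1.1.2, a, b), p.2)))
    have hout : Measurable fun w : Θ × X => ∫⁻ x',
        ∫⁻ ζ, s.indicator (1 : Traj (n + 1) X A B → ℝ≥0∞) (Fin.cons (w.2, a, b) ζ)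
          ∂(K (w.1, x')) ∂((M.P ⟨h, by omega⟩).comap _ hc2 w) :=
      Measurable.lintegral_kernel_prod_right (f := fun (w : Θ × X) x' =>
        ∫⁻ ζ, s.indicator (1 : Traj (n + 1) X A B → ℝ≥0∞) (Fin.cons (w.2, a, b) ζ)
          ∂(K (w.1, x'))) hin
    exact hout

/-- The kernel that sends `(f, g)` to the law of an episode under `(μ_f, ν_{f,g})`. -/
def playKernel (M : MarkovGame H X A B) (I : InducedPolicies F) :
    Kernel (F.Elems × F.Elems) (Traj H X A B) where
  toFun p := episodeLaw M (I.maxPolicy p.1) (I.minPolicy p.1 p.2)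
  measurable' := by
    have h1 := measurable_rollout M (fun p : F.Elems × F.Elems => I.maxPolicy p.1)
      (fun p => I.minPolicy p.1 p.2)
      (fun h a => (I.measurable_mu h a).comp (by fun_prop : Measurable
        fun w : (F.Elems × F.Elems) × X => (w.1.1 h, w.2)))
      (fun h b => (I.measurable_nu h b).comp (by fun_prop : Measurable
        fun w : (F.Elems × F.Elems) × X => ((w.1.1 h, w.1.2 h), w.2))) H 0 (by omega)
    exact h1.comp (measurable_prodMk_right (y := M.init))

instance (M : MarkovGame H X A B) (I : InducedPolicies F) : IsMarkovKernel (playKernel M I) :=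
  ⟨fun p => inferInstanceAs
    (IsProbabilityMeasure (episodeLaw M (I.maxPolicy p.1) (I.minPolicy p.1 p.2)))⟩

theorem measurable_tilted {Θ E : Type*} [MeasurableSpace Θ] [MeasurableSpace E] (P : Measure E)
    [SFinite P] {W : Θ → E → ℝ} (hW : Measurable fun p : Θ × E => W p.1 p.2) :
    Measurable fun θ => P.tilted (W θ) := by
  have hZ : Measurable fun θ => ∫ e, Real.exp (W θ e) ∂P :=
    (StronglyMeasurable.integral_prod_right (f := fun θ e => Real.exp (W θ e))
      hW.exp.stronglyMeasurable).measurable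
  refine Measure.measurable_of_measurable_coe _ fun s hs => ?_
  simp only [Measure.tilted, withDensity_apply _ hs]
  exact Measurable.lintegral_prod_right' (f := fun p : Θ × E =>
    ENNReal.ofReal (Real.exp (W p.1 p.2) / ∫ e, Real.exp (W p.1 e) ∂P))
    (hW.exp.div (hZ.comp measurable_fst)).ennreal_ofReal

theorem measurable_sqLoss {Θ : Type*} [MeasurableSpace Θ] (M : MarkovGame H X A B) (h : Fin H)
    {t : ℕ} {u : Θ → F.Elem h} (hu : Measurable u) {V : Θ → X → ℝ}
    (hV : Measurable fun p : Θ × X => V p.1 p.2) {S : Θ → Fin t → Traj H X A B}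
    (hS : Measurable S) : Measurable fun θ => sqLoss M h (u θ).1 (V θ) (S θ) := by
  unfold sqLoss
  refine Finset.measurable_sum _ fun s _ => Measurable.pow_const (Measurable.sub
    (Measurable.sub ?_ ?_) ?_) 2
  · exact (measurable_elem h).comp (by fun_prop : Measurable fun θ => (u θ, S θ s h))
  · exact (measurable_reward M h).comp (by fun_prop : Measurable fun θ => S θ s h)
  · have h1 : Measurable fun θ => nextState (S θ s) h :=
      (measurable_nextState h).comp (by fun_prop)
    exact hV.comp (measurable_id.prodMk h1)

theorem measurable_logLikelihood {Θ : Type*} [MeasurableSpace Θ] (M : MarkovGame H X A B)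
    (p₀ : (h : Fin H) → Measure (F.Elem h)) [∀ h, IsProbabilityMeasure (p₀ h)] (η : ℝ) (h : Fin H)
    {t : ℕ} {u : Θ → F.Elem h} (hu : Measurable u) {V : Θ → X → ℝ}
    (hV : Measurable fun p : Θ × X => V p.1 p.2) {S : Θ → Fin t → Traj H X A B}
    (hS : Measurable S) : Measurable fun θ => logLikelihood M p₀ η h (u θ) (V θ) (S θ) := by
  unfold logLikelihood
  refine ((measurable_sqLoss M h hu hV hS).const_mul _).sub (Measurable.log ?_)
  refine (StronglyMeasurable.integral_prod_right (f := fun θ (u' : F.Elem h) =>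
    Real.exp (-η * sqLoss M h u'.1 (V θ) (S θ))) ?_).measurable
  refine Measurable.stronglyMeasurable ?_
  exact ((measurable_sqLoss M h (Θ := Θ × F.Elem h) (u := Prod.snd) measurable_snd
    (V := fun p => V p.1) (hV.comp (by fun_prop : Measurable fun p : (Θ × F.Elem h) × X =>
      (p.1.1, p.2))) (S := fun p => S p.1) (hS.comp measurable_fst)).const_mul (-η)).exp

theorem sqLoss_mem_Icc (M : MarkovGame H X A B) {β : ℝ} (hF : BoundedBy F β)
    (h : Fin H) (u : F.Elem h) {V : X → ℝ} (hV : ∀ x, V x ∈ Set.Icc 0 (β - 1)) {t : ℕ}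
    (S : Fin t → Traj H X A B) : sqLoss M h u.1 V S ∈ Set.Icc 0 (t * β ^ 2) := by
  refine ⟨Finset.sum_nonneg fun s _ => sq_nonneg _, ?_⟩
  calc sqLoss M h u.1 V S ≤ ∑ _s : Fin t, β ^ 2 := Finset.sum_le_sum fun s _ => by
        have h1 := hF h _ u.2 (S s h).1 (S s h).2.1 (S s h).2.2
        have h2 := M.r_mem h (S s h).1 (S s h).2.1 (S s h).2.2
        have h3 := hV (nextState (S s) h)
        exact sq_le_sq' (by linarith [h1.1, h2.2, h3.2]) (by linarith [h1.2, h2.1, h3.1])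
    _ = t * β ^ 2 := by simp

/-- A crude bound, growing with `t`. It serves only to make the posterior a probability measure and
the integrals finite. -/
theorem abs_logLikelihood_le (M : MarkovGame H X A B) (p₀ : (h : Fin H) → Measure (F.Elem h))
    [∀ h, IsProbabilityMeasure (p₀ h)] {β η : ℝ} (hF : BoundedBy F β) (hη : 0 ≤ η)
    (h : Fin H) (u : F.Elem h) {V : X → ℝ} (hVm : Measurable V)
    (hV : ∀ x, V x ∈ Set.Icc 0 (β - 1)) {t : ℕ} (S : Fin t → Traj H X A B) :
    |logLikelihood M p₀ η h u V S| ≤ η * (t * β ^ 2) := by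
  have hb := fun u => sqLoss_mem_Icc M hF h u hV S
  have hm : Measurable fun u' : F.Elem h => Real.exp (-η * sqLoss M h u'.1 V S) :=
    ((measurable_sqLoss M h measurable_id (V := fun _ => V) (hVm.comp measurable_snd)
      (S := fun _ => S) measurable_const).const_mul (-η)).exp
  have hint : Integrable (fun u' : F.Elem h => Real.exp (-η * sqLoss M h u'.1 V S)) (p₀ h) :=
    integrable_of_bounded hm (c := 1) fun u' => by
      rw [Real.abs_exp, Real.exp_le_one_iff]
      nlinarith [mul_nonneg hη (hb u').1]
  have hup : ∫ u' : F.Elem h, Real.exp (-η * sqLoss M h u'.1 V S) ∂(p₀ h) ≤ 1 := by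
    calc _ ≤ ∫ _u' : F.Elem h, (1 : ℝ) ∂(p₀ h) := integral_mono hint (integrable_const _) fun u' =>
          Real.exp_le_one_iff.2 (by nlinarith [mul_nonneg hη (hb u').1])
      _ = 1 := by simp
  have hlo : Real.exp (-η * (t * β ^ 2)) ≤
      ∫ u' : F.Elem h, Real.exp (-η * sqLoss M h u'.1 V S) ∂(p₀ h) := by
    calc _ = ∫ _u' : F.Elem h, Real.exp (-η * (t * β ^ 2)) ∂(p₀ h) := by simp
      _ ≤ _ := integral_mono (integrable_const _) hint fun u' => Real.exp_le_exp.2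
          (by nlinarith [mul_le_mul_of_nonneg_left (hb u').2 hη])
  have hpos := (Real.exp_pos (-η * (t * β ^ 2))).trans_le hlo
  have h1 := Real.log_nonpos hpos.le hup
  have h2 := (Real.le_log_iff_exp_le hpos).2 hlo
  have h3 := mul_nonneg hη (hb u).1
  have h4 := mul_le_mul_of_nonneg_left (hb u).2 hη
  rw [logLikelihood, abs_le]
  constructor <;> linarith

theorem isProbabilityMeasure_tilted_of_bounded {E : Type*} [MeasurableSpace E] (P : Measure E)
    [IsProbabilityMeasure P] {W : E → ℝ} (hW : Measurable W) {c : ℝ} (hc : ∀ e, |W e| ≤ c) :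
    IsProbabilityMeasure (P.tilted W) :=
  isProbabilityMeasure_tilted (integrable_of_bounded hW.exp (c := Real.exp c) fun e => by
    rw [Real.abs_exp]
    exact Real.exp_le_exp.2 ((le_abs_self _).trans (hc e)))

/-- The exponent in the density of the posterior of the main agent. -/
def mainExponent (M : MarkovGame H X A B) (p₀ : (h : Fin H) → Measure (F.Elem h)) (η lam : ℝ)
    {t : ℕ} (S : Fin t → Traj H X A B) (f : F.Elems) : ℝ :=
  lam * maxminValue f 0 M.init + ∑ h, logLikelihood M p₀ η h (f h) (maxminValue f (h + 1)) S

variable (p₀ : (h : Fin H) → Measure (F.Elem h)) [∀ h, IsProbabilityMeasure (p₀ h)]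

theorem measurable_mainExponent (M : MarkovGame H X A B) (I : InducedPolicies F) (η lam : ℝ)
    (t : ℕ) : Measurable fun p : (Fin t → Traj H X A B) × F.Elems =>
      mainExponent M p₀ η lam p.1 p.2 := by
  have h1 := (measurable_maxminValue I 0).comp (by fun_prop :
    Measurable fun p : (Fin t → Traj H X A B) × F.Elems => (p.2, M.init))
  refine (h1.const_mul lam).add (Finset.measurable_sum _ fun h _ => ?_)
  have h2 := (measurable_maxminValue I (h + 1)).comp (by fun_prop :
    Measurable fun p : ((Fin t → Traj H X A B) × F.Elems) × X => (p.1.2, p.2))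
  exact measurable_logLikelihood M p₀ η h (u := fun p : (Fin t → Traj H X A B) × F.Elems => p.2 h)
    (by fun_prop) (V := fun p => maxminValue p.2 (h + 1)) h2 measurable_fst

theorem abs_mainExponent_le (M : MarkovGame H X A B) (I : InducedPolicies F) {β η lam : ℝ}
    (hβ : 1 < β) (hF : BoundedBy F β) (hη : 0 ≤ η) {t : ℕ}
    (S : Fin t → Traj H X A B) (f : F.Elems) :
    |mainExponent M p₀ η lam S f| ≤ |lam| * β + H * (η * (t * β ^ 2)) := by
  refine (abs_add_le _ _).trans (add_le_add ?_ ?_)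
  · have := maxminValue_mem_Icc I hβ hF f 0 M.init
    rw [abs_mul, abs_of_nonneg this.1]
    exact mul_le_mul_of_nonneg_left (by linarith [this.2]) (abs_nonneg _)
  · refine (Finset.abs_sum_le_sum_abs _ _).trans ((Finset.sum_le_sum fun h _ =>
      abs_logLikelihood_le M p₀ hF hη h (f h) (measurable_maxminValue_right I f _)
        (maxminValue_mem_Icc I hβ hF f _) S).trans_eq ?_)
    simp

theorem isProbabilityMeasure_mainPosterior (M : MarkovGame H X A B) (I : InducedPolicies F)
    {β η lam : ℝ} (hβ : 1 < β) (hF : BoundedBy F β) (hη : 0 ≤ η) {t : ℕ}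
    (S : Fin t → Traj H X A B) : IsProbabilityMeasure (mainPosterior M p₀ η lam S) := by
  have hm := (measurable_mainExponent p₀ M I η lam t).comp (measurable_prodMk_left (x := S))
  exact isProbabilityMeasure_tilted_of_bounded _ (W := fun f => mainExponent M p₀ η lam S f) hm
    (abs_mainExponent_le p₀ M I hβ hF hη S)

/-- The posterior of the main agent as a kernel. -/
def mainKernel (M : MarkovGame H X A B) (I : InducedPolicies F) (η lam : ℝ) (t : ℕ) :
    Kernel (Fin t → Traj H X A B) F.Elems where
  toFun S := mainPosterior M p₀ η lam S
  measurable' := measurable_tilted _ (measurable_mainExponent p₀ M I η lam t)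

theorem measurable_boosterExponent (M : MarkovGame H X A B) (I : InducedPolicies F) (η lam : ℝ)
    (t : ℕ) : Measurable fun p : ((Fin t → Traj H X A B) × F.Elems) × F.Elems =>
      -lam * policyValue (I.maxPolicy p.1.2) p.2 0 M.init + ∑ h, logLikelihood M p₀ η h (p.2 h)
        (policyValue (I.maxPolicy p.1.2) p.2 (h + 1)) p.1.1 := by
  have h1 := (measurable_policyValue I 0).comp (by fun_prop :
    Measurable fun p : ((Fin t → Traj H X A B) × F.Elems) × F.Elems => ((p.1.2, p.2), M.init))
  refine (h1.const_mul (-lam)).add (Finset.measurable_sum _ fun h _ => ?_)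
  have h2 := (measurable_policyValue I (h + 1)).comp (by fun_prop :
    Measurable fun p : (((Fin t → Traj H X A B) × F.Elems) × F.Elems) × X =>
      ((p.1.1.2, p.1.2), p.2))
  exact measurable_logLikelihood M p₀ η h
    (u := fun p : ((Fin t → Traj H X A B) × F.Elems) × F.Elems => p.2 h) (by fun_prop)
    (V := fun p => policyValue (I.maxPolicy p.1.2) p.2 (h + 1)) h2
    (measurable_fst.comp measurable_fst)

/-- The posterior of the booster agent as a kernel. -/
def boosterKernel (M : MarkovGame H X A B) (I : InducedPolicies F) (η lam : ℝ) (t : ℕ) :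
    Kernel ((Fin t → Traj H X A B) × F.Elems) F.Elems where
  toFun p := boosterPosterior M p₀ η lam (I.maxPolicy p.2) p.1
  measurable' := measurable_tilted _ (measurable_boosterExponent p₀ M I η lam t)

theorem isProbabilityMeasure_boosterPosterior (M : MarkovGame H X A B) (I : InducedPolicies F)
    {β η lam : ℝ} (hβ : 1 < β) (hF : BoundedBy F β) (hη : 0 ≤ η) {t : ℕ}
    (S : Fin t → Traj H X A B) (f : F.Elems) :
    IsProbabilityMeasure (boosterPosterior M p₀ η lam (I.maxPolicy f) S) := by
  have hm := (measurable_boosterExponent p₀ M I η lam t).comp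
    (measurable_prodMk_left (x := (S, f)))
  refine isProbabilityMeasure_tilted_of_bounded _ (W := fun g =>
    -lam * policyValue (I.maxPolicy f) g 0 M.init + ∑ h, logLikelihood M p₀ η h (g h)
        (policyValue (I.maxPolicy f) g (h + 1)) S) hm
    (c := |lam| * β + H * (η * (t * β ^ 2))) fun g => ?_
  refine (abs_add_le _ _).trans (add_le_add ?_ ?_)
  · have := policyValue_mem_Icc I hβ hF f g 0 M.init
    rw [abs_mul, abs_neg, abs_of_nonneg this.1]
    exact mul_le_mul_of_nonneg_left (by linarith [this.2]) (abs_nonneg _)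
  · refine (Finset.abs_sum_le_sum_abs _ _).trans ((Finset.sum_le_sum fun h _ =>
      abs_logLikelihood_le M p₀ hF hη h (g h) ?_
        (policyValue_mem_Icc I hβ hF f g _) S).trans_eq ?_)
    · have := (measurable_policyValue I (h + 1)).comp (measurable_prodMk_left (x := (f, g)))
      exact this
    · simp

end Kernels

section Records

variable {H : ℕ} {X A B : Type*} [MeasurableSpace X]
  [Fintype A] [Nonempty A] [MeasurableSpace A] [MeasurableSingletonClass A]
  [Fintype B] [Nonempty B] [MeasurableSpace B] [MeasurableSingletonClass B]
  {F : FunctionClass H X A B}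

/-! ### The joint law of the sampled functions and the episodes -/

/-- The record `((f, g), ζ)` of one round: the sampled functions and the episode. -/
abbrev Round (F : FunctionClass H X A B) : Type _ := (F.Elems × F.Elems) × Traj H X A B

/-- The episodes of a sequence of rounds. -/
def episodes {t : ℕ} (ω : Fin t → Round F) : Fin t → Traj H X A B := fun s => (ω s).2

theorem measurable_episodes (t : ℕ) : Measurable (episodes : (Fin t → Round F) → _) := by
  unfold episodes
  fun_prop

theorem measurable_snoc {E : Type*} [MeasurableSpace E] (t : ℕ) :
    Measurable fun p : (Fin t → E) × E => (Fin.snoc p.1 p.2 : Fin (t + 1) → E) := by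
  refine measurable_pi_iff.2 fun i => ?_
  refine Fin.lastCases ?_ (fun i => ?_) i
  · simpa using measurable_snd
  · simp only [Fin.snoc_castSucc]
    exact (measurable_pi_apply i).comp measurable_fst

variable (p₀ : (h : Fin H) → Measure (F.Elem h)) [∀ h, IsProbabilityMeasure (p₀ h)]
  (M : MarkovGame H X A B) (I : InducedPolicies F) (η lam : ℝ)

/-- One round of the algorithm, given the episodes so far. -/
def stepKernel (t : ℕ) : Kernel (Fin t → Traj H X A B) (Round F) :=
  (mainKernel p₀ M I η lam t ⊗ₖ boosterKernel p₀ M I η lam t) ⊗ₖ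
    ((playKernel M I).comap Prod.snd measurable_snd)

/-- The joint law of the first `t` rounds. -/
def recordLaw : (t : ℕ) → Measure (Fin t → Round F)
  | 0 => Measure.dirac Fin.elim0
  | t + 1 => (recordLaw t ⊗ₘ ((stepKernel p₀ M I η lam t).comap episodes
      (measurable_episodes t))).map fun p => (Fin.snoc p.1 p.2 : Fin (t + 1) → Round F)

variable {β : ℝ} (hβ : 1 < β) (hF : BoundedBy F β) (hη : 0 ≤ η)

include hβ hF hη

theorem isMarkovKernel_mainKernel (t : ℕ) : IsMarkovKernel (mainKernel p₀ M I η lam t) :=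
  ⟨fun S => isProbabilityMeasure_mainPosterior p₀ M I hβ hF hη S⟩

theorem isMarkovKernel_boosterKernel (t : ℕ) : IsMarkovKernel (boosterKernel p₀ M I η lam t) :=
  ⟨fun p => isProbabilityMeasure_boosterPosterior p₀ M I hβ hF hη p.1 p.2⟩

theorem isMarkovKernel_stepKernel (t : ℕ) : IsMarkovKernel (stepKernel p₀ M I η lam t) := by
  haveI := isMarkovKernel_mainKernel p₀ M I η lam hβ hF hη t
  haveI := isMarkovKernel_boosterKernel p₀ M I η lam hβ hF hη t
  unfold stepKernel
  infer_instance

theorem isProbabilityMeasure_recordLaw (t : ℕ) :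
    IsProbabilityMeasure (recordLaw p₀ M I η lam t) := by
  induction t with
  | zero => unfold recordLaw; infer_instance
  | succ t ih =>
    haveI := isMarkovKernel_stepKernel p₀ M I η lam hβ hF hη t
    unfold recordLaw
    exact Measure.isProbabilityMeasure_map (measurable_snoc t).aemeasurable

theorem lintegral_stepKernel (t : ℕ) (S : Fin t → Traj H X A B) {φ : Round F → ℝ≥0∞}
    (hφ : Measurable φ) :
    ∫⁻ w, φ w ∂(stepKernel p₀ M I η lam t S) =
      ∫⁻ f, ∫⁻ g, ∫⁻ ζ, φ ((f, g), ζ) ∂(episodeLaw M (I.maxPolicy f) (I.minPolicy f g))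
        ∂(boosterPosterior M p₀ η lam (I.maxPolicy f) S) ∂(mainPosterior M p₀ η lam S) := by
  haveI := isMarkovKernel_mainKernel p₀ M I η lam hβ hF hη t
  haveI := isMarkovKernel_boosterKernel p₀ M I η lam hβ hF hη t
  rw [stepKernel, Kernel.lintegral_compProd _ _ _ hφ, Kernel.lintegral_compProd]
  · rfl
  · exact Measurable.lintegral_kernel_prod_right' (κ := playKernel M I) hφ

theorem lintegral_recordLaw_succ (t : ℕ) {φ : (Fin (t + 1) → Round F) → ℝ≥0∞}
    (hφ : Measurable φ) :
    ∫⁻ ω, φ ω ∂(recordLaw p₀ M I η lam (t + 1)) =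
      ∫⁻ ω, ∫⁻ w, φ (Fin.snoc ω w) ∂(stepKernel p₀ M I η lam t (episodes ω))
        ∂(recordLaw p₀ M I η lam t) := by
  haveI := isMarkovKernel_stepKernel p₀ M I η lam hβ hF hη t
  haveI := isProbabilityMeasure_recordLaw p₀ M I η lam hβ hF hη t
  rw [recordLaw, lintegral_map hφ (measurable_snoc t),
    Measure.lintegral_compProd (f := fun p : (Fin t → Round F) × Round F =>
      φ (Fin.snoc p.1 p.2)) (hφ.comp (measurable_snoc t))]
  rfl

/-- The history retains trajectories only, while the past policies `π_s` in the decoupling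
inequality depend on the sampled functions. `recordLaw` retains both, and this lemma transfers
expectations back to the history. -/
theorem map_episodes_recordLaw (t : ℕ) :
    (recordLaw p₀ M I η lam t).map episodes = historyLaw M I p₀ η lam t := by
  induction t with
  | zero =>
    rw [recordLaw, historyLaw, Measure.map_dirac' (measurable_episodes 0)]
    congr 1
    exact Subsingleton.elim _ _
  | succ t ih =>
    haveI := isMarkovKernel_mainKernel p₀ M I η lam hβ hF hη t
    haveI := isMarkovKernel_boosterKernel p₀ M I η lam hβ hF hη t
    -- The nested `bind`s of `historyLaw` carry no measurability. The kernels `L3`, `L2`, `L1`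
    -- realize them from the inside out and supply what `Measure.bind_apply` requires.
    let L3 : Kernel (((Fin t → Traj H X A B) × F.Elems) × F.Elems) (Fin (t + 1) → Traj H X A B) :=
      (Kernel.id ×ₖ (playKernel M I).comap (fun p : ((Fin t → Traj H X A B) × F.Elems) × F.Elems =>
        (p.1.2, p.2)) (by fun_prop)).map fun q => (Fin.snoc q.1.1.1 q.2 : Fin (t + 1) → _)
    have hsn : Measurable fun q : (((Fin t → Traj H X A B) × F.Elems) × F.Elems) × Traj H X A B =>
        (Fin.snoc q.1.1.1 q.2 : Fin (t + 1) → Traj H X A B) :=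
      (measurable_snoc t).comp (by fun_prop : Measurable
        fun q : (((Fin t → Traj H X A B) × F.Elems) × F.Elems) × Traj H X A B => (q.1.1.1, q.2))
    have hL3 : ∀ S f g, L3 ((S, f), g) = (episodeLaw M (I.maxPolicy f) (I.minPolicy f g)).map
        fun ζ => (Fin.snoc S ζ : Fin (t + 1) → Traj H X A B) := fun S f g => by
      simp only [L3]
      rw [Kernel.map_apply _ hsn, Kernel.prod_apply, Kernel.id_apply, Measure.dirac_prod,
        Measure.map_map hsn measurable_prodMk_left]
      rfl
    let L2 : Kernel ((Fin t → Traj H X A B) × F.Elems) (Fin (t + 1) → Traj H X A B) :=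
      L3 ∘ₖ (Kernel.id ×ₖ boosterKernel p₀ M I η lam t)
    have hL2 : ∀ S f, L2 (S, f) = (boosterPosterior M p₀ η lam (I.maxPolicy f) S).bind fun g =>
        (episodeLaw M (I.maxPolicy f) (I.minPolicy f g)).map
        fun ζ => (Fin.snoc S ζ : Fin (t + 1) → Traj H X A B) := fun S f => by
      simp only [L2, ← hL3]
      ext s hs
      rw [Kernel.comp_apply' _ _ _ hs, Kernel.prod_apply, Kernel.id_apply, Measure.dirac_prod,
        lintegral_map (Kernel.measurable_coe _ hs) measurable_prodMk_left, Measure.bind_apply hs]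
      · rfl
      · exact (L3.measurable.comp measurable_prodMk_left).aemeasurable
    let L1 : Kernel (Fin t → Traj H X A B) (Fin (t + 1) → Traj H X A B) :=
      L2 ∘ₖ (Kernel.id ×ₖ mainKernel p₀ M I η lam t)
    have hL1 : ∀ S, L1 S = (mainPosterior M p₀ η lam S).bind fun f =>
        (boosterPosterior M p₀ η lam (I.maxPolicy f) S).bind fun g =>
        (episodeLaw M (I.maxPolicy f) (I.minPolicy f g)).map
        fun ζ => (Fin.snoc S ζ : Fin (t + 1) → Traj H X A B) := fun S => by
      simp only [L1, ← hL2]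
      ext s hs
      rw [Kernel.comp_apply' _ _ _ hs, Kernel.prod_apply, Kernel.id_apply, Measure.dirac_prod,
        lintegral_map (Kernel.measurable_coe _ hs) measurable_prodMk_left, Measure.bind_apply hs]
      · rfl
      · exact (L2.measurable.comp measurable_prodMk_left).aemeasurable
    rw [historyLaw]
    simp only [← hL1]
    ext s hs
    have hind : Measurable (s.indicator (1 : (Fin (t + 1) → Traj H X A B) → ℝ≥0∞)) :=
      measurable_one.indicator hs
    rw [Measure.bind_apply hs L1.measurable.aemeasurable, ← ih,
      lintegral_map (Kernel.measurable_coe _ hs) (measurable_episodes t),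
      ← lintegral_indicator_one hs, lintegral_map hind (measurable_episodes _),
      lintegral_recordLaw_succ p₀ M I η lam hβ hF hη t
        (φ := fun ω => s.indicator 1 (episodes ω)) (hind.comp (measurable_episodes _))]
    refine lintegral_congr fun ω => ?_
    have hep : ∀ w : Round F, episodes (Fin.snoc ω w : Fin (t + 1) → Round F) =
        Fin.snoc (episodes ω) w.2 := fun w => by
      funext i
      refine Fin.lastCases ?_ (fun i => ?_) i <;> simp [episodes]
    simp only [hep]
    have hsn' : Measurable fun ζ : Traj H X A B =>
        (Fin.snoc (episodes ω) ζ : Fin (t + 1) → Traj H X A B) :=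
      (measurable_snoc t).comp (measurable_prodMk_left (x := episodes ω))
    rw [lintegral_stepKernel p₀ M I η lam hβ hF hη t (episodes ω)
      (φ := fun w => s.indicator 1 (Fin.snoc (episodes ω) w.2 : Fin (t + 1) → Traj H X A B))
      (hind.comp (hsn'.comp measurable_snd)), hL1, Measure.bind_apply hs]
    · refine lintegral_congr fun f => ?_
      rw [← hL2, hL2, Measure.bind_apply hs]
      · refine lintegral_congr fun g => ?_
        rw [← lintegral_indicator_one hs, lintegral_map hind hsn']
      · simp only [← hL3]
        exact (L3.measurable.comp measurable_prodMk_left).aemeasurable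
    · simp only [← hL2]
      exact (L2.measurable.comp measurable_prodMk_left).aemeasurable

theorem map_castSucc_recordLaw (t : ℕ) :
    (recordLaw p₀ M I η lam (t + 1)).map (fun ω (s : Fin t) => ω s.castSucc) =
      recordLaw p₀ M I η lam t := by
  haveI := isMarkovKernel_stepKernel p₀ M I η lam hβ hF hη t
  haveI := isProbabilityMeasure_recordLaw p₀ M I η lam hβ hF hη t
  rw [recordLaw, Measure.map_map (by fun_prop) (measurable_snoc t)]
  have : (fun (ω : Fin (t + 1) → Round F) (s : Fin t) => ω s.castSucc) ∘
      (fun p : (Fin t → Round F) × Round F => (Fin.snoc p.1 p.2 : Fin (t + 1) → Round F)) =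
      Prod.fst := by
    funext p s
    simp
  rw [this]
  exact Measure.fst_compProd _ _

theorem map_castLE_recordLaw {t T : ℕ} (htT : t ≤ T) :
    (recordLaw p₀ M I η lam T).map (fun ω (s : Fin t) => ω (Fin.castLE htT s)) =
      recordLaw p₀ M I η lam t := by
  induction T, htT using Nat.le_induction with
  | base => exact Measure.map_id
  | succ T h ih =>
    rw [← map_castSucc_recordLaw p₀ M I η lam hβ hF hη T, Measure.map_map (by fun_prop)
      (by fun_prop)] at ih
    exact ih

/-- The last factor has conditional mean at most one for every pair `(f, g)`, hence also after
averaging over the two posteriors. How the pair is chosen from the past is immaterial. -/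
theorem lintegral_prod_recordLaw_le {φ : Round F → ℝ≥0∞} (hφ : Measurable φ)
    (h1 : ∀ f g, ∫⁻ ζ, φ ((f, g), ζ) ∂(episodeLaw M (I.maxPolicy f) (I.minPolicy f g)) ≤ 1)
    (t : ℕ) : ∫⁻ ω, ∏ s, φ (ω s) ∂(recordLaw p₀ M I η lam t) ≤ 1 := by
  induction t with
  | zero => simp [recordLaw]
  | succ t ih =>
    haveI := isMarkovKernel_mainKernel p₀ M I η lam hβ hF hη t
    haveI := isMarkovKernel_boosterKernel p₀ M I η lam hβ hF hη t
    rw [lintegral_recordLaw_succ p₀ M I η lam hβ hF hη t (φ := fun ω => ∏ s, φ (ω s))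
      (Finset.measurable_prod _ fun s _ => hφ.comp (measurable_pi_apply s))]
    refine le_trans (lintegral_mono fun ω => ?_) ih
    simp only [Fin.prod_univ_castSucc, Fin.snoc_castSucc, Fin.snoc_last]
    rw [lintegral_const_mul _ hφ, lintegral_stepKernel p₀ M I η lam hβ hF hη t _ hφ]
    refine mul_le_of_le_one_right' ?_
    have hm : ∀ f, IsProbabilityMeasure
        (boosterPosterior M p₀ η lam (I.maxPolicy f) (episodes ω)) := fun f =>
      isProbabilityMeasure_boosterPosterior p₀ M I hβ hF hη _ f
    have hm' : IsProbabilityMeasure (mainPosterior M p₀ η lam (episodes ω)) :=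
      isProbabilityMeasure_mainPosterior p₀ M I hβ hF hη _
    calc _ ≤ ∫⁻ f, ∫⁻ g, 1 ∂(boosterPosterior M p₀ η lam (I.maxPolicy f) (episodes ω))
          ∂(mainPosterior M p₀ η lam (episodes ω)) :=
          lintegral_mono fun f => lintegral_mono fun g => h1 f g
      _ = 1 := by simp

theorem ae_recordLaw_of_ae_episodeLaw {s : Set (Traj H X A B)} (hs : MeasurableSet s)
    (h1 : ∀ f g, ∀ᵐ ζ ∂(episodeLaw M (I.maxPolicy f) (I.minPolicy f g)), ζ ∈ s) (t : ℕ) :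
    ∀ᵐ ω ∂(recordLaw p₀ M I η lam t), ∀ i, (ω i).2 ∈ s := by
  induction t with
  | zero => exact Filter.Eventually.of_forall fun ω i => i.elim0
  | succ t ih =>
    have hms : MeasurableSet {ω : Fin (t + 1) → Round F | ∀ i, (ω i).2 ∈ s}ᶜ := by
      refine (MeasurableSet.compl ?_)
      rw [Set.ofPred_forall]
      exact MeasurableSet.iInter fun i =>
        (by fun_prop : Measurable fun ω : Fin (t + 1) → Round F => (ω i).2) hs
    rw [ae_iff]
    change recordLaw p₀ M I η lam (t + 1) {ω | ∀ i, (ω i).2 ∈ s}ᶜ = 0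
    rw [← lintegral_indicator_one hms, lintegral_recordLaw_succ p₀ M I η lam hβ hF hη t
      (measurable_one.indicator hms)]
    rw [lintegral_eq_zero_of_ae_eq_zero]
    filter_upwards [ih] with ω hω
    have hsn : Measurable fun w : Round F => (Fin.snoc ω w : Fin (t + 1) → Round F) :=
      (measurable_snoc t).comp measurable_prodMk_left
    rw [lintegral_stepKernel p₀ M I η lam hβ hF hη t _
      (φ := fun w => Set.indicator {ω : Fin (t + 1) → Round F | ∀ i, (ω i).2 ∈ s}ᶜ 1
        (Fin.snoc ω w : Fin (t + 1) → Round F)) ((measurable_one.indicator hms).comp hsn)]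
    have hz : ∀ f g, ∫⁻ ζ, Set.indicator {ω : Fin (t + 1) → Round F | ∀ i, (ω i).2 ∈ s}ᶜ
        (1 : (Fin (t + 1) → Round F) → ℝ≥0∞) (Fin.snoc ω ((f, g), ζ) : Fin (t + 1) → Round F)
        ∂(episodeLaw M (I.maxPolicy f) (I.minPolicy f g)) = 0 := by
      intro f g
      rw [lintegral_eq_zero_of_ae_eq_zero]
      filter_upwards [h1 f g] with ζ hζ
      refine Set.indicator_of_notMem ?_ _
      simp only [Set.mem_compl_iff, Set.mem_ofPred_eq, not_not]
      intro i
      refine Fin.lastCases ?_ (fun i => ?_) i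
      · simpa using hζ
      · simpa using hω i
    simp [hz]

end Records

/-! ### Gibbs variational inequality -/

section Gibbs

variable {E : Type*} [MeasurableSpace E]

theorem integrable_exp_of_bounded {P : Measure E} [IsFiniteMeasure P] {W : E → ℝ}
    (hW : Measurable W) {c : ℝ} (hc : ∀ e, |W e| ≤ c) :
    Integrable (fun e => Real.exp (W e)) P :=
  integrable_of_bounded hW.exp (c := Real.exp c) fun e => by
    rw [Real.abs_exp]
    exact Real.exp_le_exp.2 ((le_abs_self _).trans (hc e))

theorem integral_exp_pos_of_bounded {P : Measure E} [IsProbabilityMeasure P] {W : E → ℝ}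
    (hW : Measurable W) {c : ℝ} (hc : ∀ e, |W e| ≤ c) : 0 < ∫ e, Real.exp (W e) ∂P :=
  integral_exp_pos (integrable_exp_of_bounded hW hc)

/-- Jensen's inequality, obtained by integrating `1 + x ≤ e^x` at `x = W - ln E e^W`. -/
theorem integral_le_log_integral_exp {P : Measure E} [IsProbabilityMeasure P] {W : E → ℝ}
    (hW : Measurable W) {c : ℝ} (hc : ∀ e, |W e| ≤ c) :
    ∫ e, W e ∂P ≤ Real.log (∫ e, Real.exp (W e) ∂P) := by
  have hpos := integral_exp_pos_of_bounded (P := P) hW hc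
  have hint : Integrable W P := integrable_of_bounded hW hc
  have h1 := integral_mono (hint.add (integrable_const (1 - Real.log (∫ e, Real.exp (W e) ∂P))))
    ((integrable_exp_of_bounded hW hc (P := P)).div_const (∫ e, Real.exp (W e) ∂P)) fun e => by
      have := Real.add_one_le_exp (W e - Real.log (∫ e, Real.exp (W e) ∂P))
      rw [Real.exp_sub, Real.exp_log hpos] at this
      simp only [Pi.add_apply]
      linarith
  rw [integral_add' hint (integrable_const _), integral_div, div_self hpos.ne'] at h1
  simp only [integral_const, probReal_univ, one_smul] at h1
  linarith

/-- Under the tilted measure `e^{G - W}` has mean `E_P e^G / E_P e^W`, because the density cancels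
`e^{-W}`; then apply Jensen's inequality. -/
theorem integral_tilted_sub_le {P : Measure E} [IsProbabilityMeasure P] {G W : E → ℝ}
    (hG : Measurable G) (hW : Measurable W) {c d : ℝ} (hc : ∀ e, |G e| ≤ c)
    (hd : ∀ e, |W e| ≤ d) :
    ∫ e, (G e - W e) ∂(P.tilted W) ≤
      Real.log (∫ e, Real.exp (G e) ∂P) - Real.log (∫ e, Real.exp (W e) ∂P) := by
  haveI := isProbabilityMeasure_tilted_of_bounded P hW hd
  refine (integral_le_log_integral_exp (hG.sub hW) (c := c + d) fun e =>
    (abs_sub _ _).trans (add_le_add (hc e) (hd e))).trans_eq ?_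
  rw [← Real.log_div (integral_exp_pos_of_bounded hG hc).ne'
    (integral_exp_pos_of_bounded hW hd).ne', integral_exp_tilted]
  simp

/-- Lower bound for the partition function by a measure with bounded density. -/
theorem neg_log_integral_exp_le {P Q : Measure E} [IsProbabilityMeasure P]
    [IsProbabilityMeasure Q] {k : ℝ} (hQ : Q ≤ ENNReal.ofReal (Real.exp k) • P) {W : E → ℝ}
    (hW : Measurable W) {d : ℝ} (hd : ∀ e, |W e| ≤ d) :
    -Real.log (∫ e, Real.exp (W e) ∂P) ≤ k + ∫ e, -W e ∂Q := by
  -- Jensen's inequality is used under `Q`. The density bound then replaces `E_Q e^W` by `e^k E_P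
  -- e^W`, as the integrand is positive.
  have h1 := integral_le_log_integral_exp (P := Q) hW hd
  have h2 : ∫ e, Real.exp (W e) ∂Q ≤ Real.exp k * ∫ e, Real.exp (W e) ∂P := by
    calc ∫ e, Real.exp (W e) ∂Q ≤ ∫ e, Real.exp (W e) ∂(ENNReal.ofReal (Real.exp k) • P) :=
          integral_mono_measure hQ (Filter.Eventually.of_forall fun e => (Real.exp_pos _).le)
            ((integrable_exp_of_bounded hW hd).smul_measure (by simp))
      _ = Real.exp k * ∫ e, Real.exp (W e) ∂P := by
          rw [integral_smul_measure, ENNReal.toReal_ofReal (Real.exp_pos k).le, smul_eq_mul]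
  have h3 := Real.log_le_log (integral_exp_pos_of_bounded hW hd) h2
  rw [Real.log_mul (Real.exp_pos k).ne' (integral_exp_pos_of_bounded hW hd).ne', Real.log_exp] at h3
  rw [integral_neg]
  linarith

end Gibbs

/-! ### Product measures -/

section Product

variable {H : ℕ} {E : Fin H → Type*} [∀ h, MeasurableSpace (E h)]
  (p : (h : Fin H) → Measure (E h)) [∀ h, IsProbabilityMeasure (p h)]

/-- A product of densities, each of which is normalized in its own coordinate and does not depend
on the earlier ones, is normalized. -/
theorem lintegral_prod_eq_one (K : Fin H → ((h : Fin H) → E h) → ℝ≥0∞)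
    (hKm : ∀ h, Measurable (K h))
    (hK : ∀ h j : Fin H, h < j → ∀ f u, K j (Function.update f h u) = K j f)
    (hK1 : ∀ h f, ∫⁻ u, K h (Function.update f h u) ∂(p h) = 1) :
    ∫⁻ f, ∏ h, K h f ∂(Measure.pi p) = 1 := by
  have hm : Measurable fun f => ∏ h, K h f := Finset.measurable_prod _ fun h _ => hKm h
  -- Integrate the coordinates in increasing order. When coordinate `j` is reached, only the factor
  -- `K_j` among the remaining ones involves it, and that factor integrates to one.
  have key : ∀ j : ℕ, j ≤ H → ∀ f,
      lmarginal p (Finset.univ.filter fun h : Fin H => (h : ℕ) < j) (fun f => ∏ h, K h f) f =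
        ∏ h ∈ Finset.univ.filter (fun h : Fin H => j ≤ (h : ℕ)), K h f := by
    intro j
    induction j with
    | zero => intro _ f; simp
    | succ j ih =>
      intro hj f
      have hins : (Finset.univ.filter fun h : Fin H => (h : ℕ) < j + 1) =
          insert ⟨j, hj⟩ (Finset.univ.filter fun h : Fin H => (h : ℕ) < j) := by
        ext h
        simp only [Finset.mem_filter, Finset.mem_univ, true_and, Finset.mem_insert, Fin.ext_iff]
        omega
      have hins' : (Finset.univ.filter fun h : Fin H => j ≤ (h : ℕ)) =
          insert ⟨j, hj⟩ (Finset.univ.filter fun h : Fin H => j + 1 ≤ (h : ℕ)) := by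
        ext h
        simp only [Finset.mem_filter, Finset.mem_univ, true_and, Finset.mem_insert, Fin.ext_iff]
        omega
      rw [hins, lmarginal_insert _ hm (by simp)]
      simp only [ih (by omega), hins']
      have h1 : ∀ u, ∏ h ∈ insert ⟨j, hj⟩ (Finset.univ.filter fun h : Fin H => j + 1 ≤ (h : ℕ)),
          K h (Function.update f ⟨j, hj⟩ u) = K ⟨j, hj⟩ (Function.update f ⟨j, hj⟩ u) *
            ∏ h ∈ Finset.univ.filter (fun h : Fin H => j + 1 ≤ (h : ℕ)), K h f := fun u => by
        rw [Finset.prod_insert (by simp)]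
        congr 1
        refine Finset.prod_congr rfl fun h hh => hK _ _ ?_ _ _
        simp only [Finset.mem_filter, Finset.mem_univ, true_and] at hh
        exact Fin.lt_def.2 (by simpa using hh)
      simp only [h1]
      rw [lintegral_mul_const (f := fun u => K ⟨j, hj⟩ (Function.update f ⟨j, hj⟩ u)) _
        ((hKm _).comp (measurable_update f)), hK1, one_mul]
  obtain ⟨f⟩ := nonempty_of_isProbabilityMeasure (Measure.pi p)
  rw [lintegral_eq_lmarginal_univ f]
  have h1 := key H le_rfl f
  rw [Finset.filter_true_of_mem fun h _ => h.2, Finset.filter_false_of_mem fun h _ =>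
    not_le.2 h.2, Finset.prod_empty] at h1
  exact h1

/-- Functions of disjoint blocks of coordinates are independent under a product measure. -/
theorem integral_mul_of_dependsOn {g g' : ((h : Fin H) → E h) → ℝ} (hg : Measurable g)
    (hg' : Measurable g') {s s' : Finset (Fin H)} (hs : DependsOn g s) (hs' : DependsOn g' s')
    (hd : Disjoint s s') :
    ∫ f, g f * g' f ∂(Measure.pi p) = (∫ f, g f ∂(Measure.pi p)) * ∫ f, g' f ∂(Measure.pi p) := by
  classical
  obtain ⟨f₀⟩ := nonempty_of_isProbabilityMeasure (Measure.pi p)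
  have hind : iIndepFun (fun h (f : (h : Fin H) → E h) => f h) (Measure.pi p) :=
    iIndepFun_pi (X := fun _ => id) fun _ => aemeasurable_id
  have h1 := hind.indepFun_finset s s' hd fun h => measurable_pi_apply h
  -- Filling the missing coordinates with a fixed point `f₀` exhibits a function that depends on `s`
  -- only as a measurable function of the restriction to `s`.
  let ext (s : Finset (Fin H)) (w : (h : s) → E h) (h : Fin H) : E h :=
    if hh : h ∈ s then w ⟨h, hh⟩ else f₀ h
  have hext : ∀ s, Measurable (ext s) := fun s => by
    refine measurable_pi_iff.2 fun h => ?_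
    simp only [ext]
    split_ifs
    · exact measurable_pi_apply _
    · exact measurable_const
  have h2 : IndepFun g g' (Measure.pi p) := by
    have h3 := h1.comp (hg.comp (hext s)) (hg'.comp (hext s'))
    convert h3 using 1
    · funext f
      exact hs fun h hh => by
        have hh' : h ∈ s := hh
        simp [ext, hh']
    · funext f
      exact hs' fun h hh => by
        have hh' : h ∈ s' := hh
        simp [ext, hh']
  exact h2.integral_fun_mul_eq_mul_integral hg.aestronglyMeasurable hg'.aestronglyMeasurable

theorem integral_prod_of_dependsOn {ι : Type*} (g : ι → ((h : Fin H) → E h) → ℝ)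
    (hg : ∀ i, Measurable (g i)) (S : ι → Finset (Fin H)) (hS : ∀ i, DependsOn (g i) (S i))
    (s : Finset ι) (hd : ∀ i ∈ s, ∀ j ∈ s, i ≠ j → Disjoint (S i) (S j)) :
    ∫ f, ∏ i ∈ s, g i f ∂(Measure.pi p) = ∏ i ∈ s, ∫ f, g i f ∂(Measure.pi p) := by
  classical
  induction s using Finset.induction_on with
  | empty => simp
  | insert a s ha ih =>
    simp only [Finset.prod_insert ha]
    rw [integral_mul_of_dependsOn p (hg a) (Finset.measurable_prod _ fun i _ => hg i) (hS a)
      (s' := s.biUnion S), ih fun i hi j hj => hd i (by simp [hi]) j (by simp [hj])]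
    · intro f f' hff
      refine Finset.prod_congr rfl fun i hi => hS i fun h hh => hff h ?_
      simp only [Finset.coe_biUnion, Set.mem_iUnion]
      exact ⟨i, hi, hh⟩
    · rw [Finset.disjoint_biUnion_right]
      intro i hi
      exact hd a (by simp) i (by simp [hi]) fun h => ha (h ▸ hi)

/-- The logarithmic moment generating function of a chain is at most half the sum of those of the
doubled links: the even links are independent, and so are the odd ones. -/
theorem integral_tilted_chain_le (G : Fin H → ((h : Fin H) → E h) → ℝ)
    (hG : ∀ h, Measurable (G h)) (hGd : ∀ h, DependsOn (G h) {j : Fin H | j = h ∨ (j : ℕ) = h + 1})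
    {W : ((h : Fin H) → E h) → ℝ} (hW : Measurable W) {c d : ℝ} (hc : ∀ h f, |G h f| ≤ c)
    (hd : ∀ f, |W f| ≤ d) :
    ∫ f, (∑ h, G h f - W f) ∂((Measure.pi p).tilted W) ≤
      1 / 2 * ∑ h, Real.log (∫ f, Real.exp (2 * G h f) ∂(Measure.pi p)) -
        Real.log (∫ f, Real.exp (W f) ∂(Measure.pi p)) := by
  classical
  haveI := isProbabilityMeasure_tilted_of_bounded (Measure.pi p) hW hd
  -- If `s` contains no two consecutive indices, the coordinate pairs `{h, h + 1}` with `h ∈ s` are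
  -- disjoint, so the exponential moment of the sum factorizes.
  have hpar : ∀ s : Finset (Fin H), (∀ i ∈ s, ∀ j ∈ s, (i : ℕ) + 1 ≠ j) →
      ∫ f, (∑ h ∈ s, 2 * G h f - W f) ∂((Measure.pi p).tilted W) ≤
        ∑ h ∈ s, Real.log (∫ f, Real.exp (2 * G h f) ∂(Measure.pi p)) -
          Real.log (∫ f, Real.exp (W f) ∂(Measure.pi p)) := by
    intro s hs
    refine (integral_tilted_sub_le (Finset.measurable_sum _ fun h _ => (hG h).const_mul 2) hW
      (c := ∑ _h ∈ s, 2 * c) (fun f => (Finset.abs_sum_le_sum_abs _ _).trans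
        (Finset.sum_le_sum fun h _ => ?_)) hd).trans_eq ?_
    · rw [abs_mul, abs_two]
      exact mul_le_mul_of_nonneg_left (hc h f) zero_le_two
    · congr 1
      simp only [Real.exp_sum]
      rw [integral_prod_of_dependsOn p (fun h f => Real.exp (2 * G h f))
        (fun h => ((hG h).const_mul 2).exp)
        (fun h => Finset.univ.filter fun j : Fin H => j = h ∨ (j : ℕ) = h + 1), Real.log_prod]
      · exact fun h _ => (integral_exp_pos_of_bounded ((hG h).const_mul 2) (c := 2 * c)
          fun f => by
            rw [abs_mul, abs_two]
            exact mul_le_mul_of_nonneg_left (hc h f) zero_le_two).ne'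
      · intro h f f' hff
        have : G h f = G h f' := hGd h fun j hj => hff j (by simpa using hj)
        simp only [this]
      · intro i hi j hj hij
        rw [Finset.disjoint_left]
        intro k hk hk'
        simp only [Finset.mem_filter, Finset.mem_univ, true_and, Fin.ext_iff] at hk hk'
        have h1 := hs i hi j hj
        have h2 := hs j hj i hi
        have h3 : (i : ℕ) ≠ j := fun h => hij (Fin.ext h)
        omega
  have he := hpar (Finset.univ.filter fun h : Fin H => Even (h : ℕ)) fun i hi j hj h => by
    simp only [Finset.mem_filter, Finset.mem_univ, true_and] at hi hj
    rw [← h, Nat.even_add_one] at hj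
    exact hj hi
  have ho := hpar (Finset.univ.filter fun h : Fin H => ¬ Even (h : ℕ)) fun i hi j hj h => by
    simp only [Finset.mem_filter, Finset.mem_univ, true_and] at hi hj
    rw [← h, Nat.even_add_one, not_not] at hj
    exact hi hj
  have hint : ∀ s : Finset (Fin H), Integrable (fun f => ∑ h ∈ s, 2 * G h f - W f)
      ((Measure.pi p).tilted W) := fun s => by
    have h1 : Integrable W ((Measure.pi p).tilted W) := integrable_of_bounded hW hd
    exact (integrable_finsetSum _ fun h _ => (integrable_of_bounded (hG h)
      (hc h)).const_mul 2).sub h1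
  have hsplit : ∀ φ : Fin H → ℝ, ∑ h, φ h =
      ∑ h ∈ Finset.univ.filter (fun h : Fin H => Even (h : ℕ)), φ h +
      ∑ h ∈ Finset.univ.filter (fun h : Fin H => ¬ Even (h : ℕ)), φ h := fun φ =>
    (Finset.sum_filter_add_sum_filter_not _ _ _).symm
  -- Averaging the even and the odd half restores `∑ G_h` from the doubled links and keeps a full
  -- copy of `W`.
  have heq : ∀ f, ∑ h, G h f - W f =
      1 / 2 * ((∑ h ∈ Finset.univ.filter (fun h : Fin H => Even (h : ℕ)), 2 * G h f - W f) +
      (∑ h ∈ Finset.univ.filter (fun h : Fin H => ¬ Even (h : ℕ)), 2 * G h f - W f)) := fun f => by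
    rw [hsplit]
    simp only [← Finset.mul_sum]
    ring
  simp only [heq]
  rw [integral_const_mul, integral_add (hint _) (hint _), hsplit fun h =>
    Real.log (∫ f, Real.exp (2 * G h f) ∂(Measure.pi p))]
  linarith

end Product

section Prior

variable {H : ℕ} {X A B : Type*} [MeasurableSpace X]
  [Fintype A] [Nonempty A] [MeasurableSpace A] [MeasurableSingletonClass A]
  [Fintype B] [Nonempty B] [MeasurableSpace B] [MeasurableSingletonClass B]
  {F : FunctionClass H X A B}

/-! ### Dependence on the coordinates of `f` -/

theorem maxminValue_succ_congr (h : Fin H) {f g : F.Elems}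
    (hfg : ∀ j : Fin H, (j : ℕ) = h + 1 → f j = g j) :
    maxminValue f (h + 1) = maxminValue g (h + 1) :=
  maxminValue_congr fun _ => hfg _ rfl

theorem residual_congr (M : MarkovGame H X A B) (h : Fin H) {f g : F.Elems}
    (hfg : ∀ j : Fin H, j = h ∨ (j : ℕ) = h + 1 → f j = g j) : residual M h f = residual M h g := by
  funext z
  rw [residual, residual, bellman, bellman, hfg h (Or.inl rfl),
    maxminValue_succ_congr h fun j hj => hfg j (Or.inr hj)]

theorem noise_congr (M : MarkovGame H X A B) (h : Fin H) {f g : F.Elems}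
    (hfg : ∀ j : Fin H, (j : ℕ) = h + 1 → f j = g j) : noise M h f = noise M h g := by
  funext ζ
  rw [noise, noise, maxminValue_succ_congr h hfg]

theorem excessLoss_congr (M : MarkovGame H X A B) (h : Fin H) {f g : F.Elems}
    (hfg : ∀ j : Fin H, j = h ∨ (j : ℕ) = h + 1 → f j = g j) :
    excessLoss M h f = excessLoss M h g := by
  funext ζ
  rw [excessLoss, excessLoss, residual_congr M h hfg,
    noise_congr M h fun j hj => hfg j (Or.inr hj)]

theorem update_eq_of_succ (f : F.Elems) (h : Fin H) (u : F.Elem h) (j : Fin H)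
    (hj : (j : ℕ) = h + 1) : Function.update f h u j = f j :=
  Function.update_of_ne (fun hjh => by simp [hjh] at hj) _ _

theorem residual_update (M : MarkovGame H X A B) (f : F.Elems) (h : Fin H) (u : F.Elem h)
    (z : X × A × B) : residual M h (Function.update f h u) z =
      u.1 z.1 z.2.1 z.2.2 - bellman M h f z.1 z.2.1 z.2.2 := by
  rw [residual, Function.update_self, bellman, maxminValue_succ_congr h (update_eq_of_succ f h u),
    ← bellman]

/-! ### The prior mass of approximate solutions -/

/-- The supremum-norm ball around `T_h f` is an uncountable intersection over states and may fail to
be measurable. The almost sure version with respect to `reachMeasure` is measurable, contains the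
ball, and is strong enough for all later estimates. -/
theorem measurableSet_nearOptimal (M : MarkovGame H X A B) (I : InducedPolicies F) (ε : ℝ)
    (h : Fin H) : MeasurableSet {f : F.Elems | NearOptimal M ε h f} := by
  have hs : MeasurableSet {p : F.Elems × X | ∀ a b, |residual M h p.1 (p.2, a, b)| ≤ ε} := by
    simp only [Set.ofPred_forall]
    refine MeasurableSet.iInter fun a => MeasurableSet.iInter fun b => ?_
    refine measurableSet_le (Measurable.abs ?_) measurable_const
    exact (measurable_residual M I h).comp (by fun_prop : Measurable fun p : F.Elems × X =>
      (p.1, (p.2, a, b)))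
  have := measurable_measure_prodMk_left (ν := reachMeasure M h) hs.compl
  exact this (measurableSet_singleton 0)

theorem nearOptimal_congr (M : MarkovGame H X A B) (ε : ℝ) (h : Fin H) {f g : F.Elems}
    (hfg : ∀ j : Fin H, j = h ∨ (j : ℕ) = h + 1 → f j = g j) :
    NearOptimal M ε h f ↔ NearOptimal M ε h g := by
  rw [NearOptimal, NearOptimal, residual_congr M h hfg]

/-- The functions of the class in the `ε`-ball around `T_h f`. -/
def bellmanBall (M : MarkovGame H X A B) (ε : ℝ) (h : Fin H) (f : F.Elems) : Set (F.Elem h) :=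
  {u | ∀ x a b, |u.1 x a b - bellman M h f x a b| ≤ ε}

theorem abs_residual_update_le (M : MarkovGame H X A B) {ε : ℝ} (h : Fin H) (f : F.Elems)
    {u : F.Elem h} (hu : u ∈ bellmanBall M ε h f) (z : X × A × B) :
    |residual M h (Function.update f h u) z| ≤ ε := by
  rw [residual_update]
  exact hu _ _ _

variable (p₀ : (h : Fin H) → Measure (F.Elem h)) [∀ h, IsProbabilityMeasure (p₀ h)]

theorem ennreal_log_prod {ι : Type*} (s : Finset ι) (φ : ι → ℝ≥0∞) :
    ENNReal.log (∏ i ∈ s, φ i) = ∑ i ∈ s, ENNReal.log (φ i) := by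
  classical
  induction s using Finset.induction_on with
  | empty => simp
  | insert a s ha ih => rw [Finset.prod_insert ha, Finset.sum_insert ha, ENNReal.log_mul_add, ih]

/-- The bound `∑ ln (1 / p₀) ≤ κ` with `g = f`, in exponential form. It is kept as a product of
extended nonnegative reals because it will bound a density. -/
theorem prod_inv_bellmanBall_le (M : MarkovGame H X A B) (I : InducedPolicies F) {ε κ : ℝ}
    (hκ : kappa M I p₀ ε < ⊤) (hκ' : κ = (kappa M I p₀ ε).toReal) (f : F.Elems) :
    ∏ h, (p₀ h (bellmanBall M ε h f))⁻¹ ≤ ENNReal.ofReal (Real.exp κ) := by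
  have h0 : ∑ h, ENNReal.log ((p₀ h (bellmanBall M ε h f))⁻¹) ≤ kappa M I p₀ ε := by
    refine le_trans (le_of_eq ?_) ((le_iSup (fun g : F.Elems => ∑ h, ENNReal.log (1 / p₀ h
      {u | ∀ x a b, |u.1 x a b - bellmanPolicy M (I.maxPolicy f) h g x a b| ≤ ε})) f).trans
      (le_iSup (fun f => kappaPolicy M p₀ (I.maxPolicy f) ε) f))
    simp only [bellmanBall, one_div, bellman_eq_bellmanPolicy M I]
  have h1 : (1 : ℝ≥0∞) ≤ ∏ h, (p₀ h (bellmanBall M ε h f))⁻¹ :=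
    Finset.one_le_prod' fun h _ => ENNReal.one_le_inv.2 prob_le_one
  rw [← ennreal_log_prod] at h0
  -- Every factor is at least one, so `kappa` is not `⊥` and its real value can be converted back.
  have h2 : kappa M I p₀ ε ≠ ⊥ := fun hb => by
    rw [hb, le_bot_iff, ENNReal.log_eq_bot_iff] at h0
    simp [h0] at h1
  rw [← ENNReal.log_le_log_iff, ENNReal.log_ofReal_of_pos (Real.exp_pos κ), Real.log_exp, hκ',
    EReal.coe_toReal hκ.ne h2]
  exact h0

theorem bellmanBall_ne_zero (M : MarkovGame H X A B) (I : InducedPolicies F) {ε : ℝ}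
    (hκ : kappa M I p₀ ε < ⊤) (f : F.Elems) (h : Fin H) : p₀ h (bellmanBall M ε h f) ≠ 0 := by
  intro h0
  have h1 := prod_inv_bellmanBall_le p₀ M I hκ rfl f
  have h2 : (p₀ h (bellmanBall M ε h f))⁻¹ ≤ ∏ h, (p₀ h (bellmanBall M ε h f))⁻¹ :=
    Finset.single_le_prod' (f := fun h => (p₀ h (bellmanBall M ε h f))⁻¹)
      (fun h _ => ENNReal.one_le_inv.2 prob_le_one) (Finset.mem_univ h)
  rw [h0, ENNReal.inv_zero] at h2
  exact absurd (h2.trans h1) (by simp)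

theorem neg_kappa_le_sum_log (M : MarkovGame H X A B) (I : InducedPolicies F) {ε κ : ℝ}
    (hκ : kappa M I p₀ ε < ⊤) (hκ' : κ = (kappa M I p₀ ε).toReal) (f : F.Elems) :
    -κ ≤ ∑ h, Real.log ((p₀ h).real (bellmanBall M ε h f)) := by
  have h1 := ENNReal.toReal_mono ENNReal.ofReal_ne_top (prod_inv_bellmanBall_le p₀ M I hκ hκ' f)
  have hpos : ∀ h, 0 < (p₀ h).real (bellmanBall M ε h f) := fun h =>
    ENNReal.toReal_pos (bellmanBall_ne_zero p₀ M I hκ f h) (measure_ne_top _ _)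
  rw [ENNReal.toReal_prod, ENNReal.toReal_ofReal (Real.exp_pos κ).le] at h1
  simp only [ENNReal.toReal_inv] at h1
  have h2 := Real.log_le_log (Finset.prod_pos fun h _ => inv_pos.2 (hpos h)) h1
  rw [Real.log_exp, Real.log_prod fun h _ => (inv_pos.2 (hpos h)).ne'] at h2
  simp only [Real.log_inv, Finset.sum_neg_distrib] at h2
  change -∑ h, Real.log ((p₀ h).real (bellmanBall M ε h f)) ≤ κ at h2
  linarith

/-- There is a probability measure with density at most `e^κ` with respect to the prior that is
supported by approximate solutions of the optimality equation. -/
theorem exists_comparator (M : MarkovGame H X A B) (I : InducedPolicies F) {ε κ : ℝ}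
    (hκ : kappa M I p₀ ε < ⊤) (hκ' : κ = (kappa M I p₀ ε).toReal) :
    ∃ Q : Measure F.Elems, IsProbabilityMeasure Q ∧
      Q ≤ ENNReal.ofReal (Real.exp κ) • Measure.pi p₀ ∧
      ∀ᵐ f ∂Q, ∀ h, NearOptimal M ε h f := by
  classical
  -- The comparator draws `f^h` from the prior conditioned on near optimality given `f^{h+1}`. The
  -- number `mass h f` is the probability of that event and does not depend on `f^h`.
  let mass (h : Fin H) (f : F.Elems) : ℝ≥0∞ :=
    p₀ h {u | NearOptimal M ε h (Function.update f h u)}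
  have hms := measurableSet_nearOptimal (F := F) M I ε
  have hmass : ∀ h, Measurable (mass h) := fun h => by
    have hs : MeasurableSet {p : F.Elems × F.Elem h |
        NearOptimal M ε h (Function.update p.1 h p.2)} := measurable_update' (hms h)
    exact measurable_measure_prodMk_left hs
  have hball : ∀ h f, p₀ h (bellmanBall M ε h f) ≤ mass h f := fun h f =>
    measure_mono fun u hu => by
      change NearOptimal M ε h (Function.update f h u)
      exact Filter.Eventually.of_forall fun x a b => abs_residual_update_le M h f hu (x, a, b)
  let K (h : Fin H) : F.Elems → ℝ≥0∞ :=
    Set.indicator {f | NearOptimal M ε h f} fun f => (mass h f)⁻¹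
  have hKm : ∀ h, Measurable (K h) := fun h => (hmass h).inv.indicator (hms h)
  have hup : ∀ h (f : F.Elems) (u : F.Elem h), mass h (Function.update f h u) = mass h f :=
    fun h f u => by simp only [mass, Function.update_idem]
  have hK1 : ∀ h f, ∫⁻ u, K h (Function.update f h u) ∂(p₀ h) = 1 := fun h f => by
    have hs : MeasurableSet {u : F.Elem h | NearOptimal M ε h (Function.update f h u)} :=
      measurable_update f (hms h)
    have : ∀ u, K h (Function.update f h u) =
        Set.indicator {u : F.Elem h | NearOptimal M ε h (Function.update f h u)}
          (fun _ => (mass h f)⁻¹) u := fun u => by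
      simp only [K, Set.indicator_apply, Set.mem_ofPred_eq, hup]
    simp only [this]
    rw [lintegral_indicator_const hs]
    exact ENNReal.inv_mul_cancel (fun h0 => bellmanBall_ne_zero p₀ M I hκ f h
      (le_antisymm ((hball h f).trans h0.le) zero_le)) (measure_ne_top _ _)
  have hK : ∀ h j : Fin H, h < j → ∀ f u, K j (Function.update f h u) = K j f := by
    intro h j hhj f u
    have hne : ∀ k : Fin H, k = j ∨ (k : ℕ) = j + 1 → k ≠ h := by
      rintro k hk rfl
      have := Fin.lt_def.1 hhj
      rcases hk with rfl | hk <;> omega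
    have h1 : NearOptimal M ε j (Function.update f h u) ↔ NearOptimal M ε j f :=
      nearOptimal_congr M ε j fun k hk => Function.update_of_ne (hne k hk) _ _
    have h2 : mass j (Function.update f h u) = mass j f := by
      simp only [mass]
      congr 1
      ext u'
      refine nearOptimal_congr M ε j fun k hk => ?_
      by_cases hkj : k = j
      · subst hkj
        simp
      · rw [Function.update_of_ne hkj, Function.update_of_ne hkj,
          Function.update_of_ne (hne k hk)]
    simp only [K, Set.indicator_apply, Set.mem_ofPred_eq, h1, h2]
  -- Each factor is at most the inverse mass of a set that contains the ball, so the density is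
  -- bounded by `e^κ` pointwise.
  have hKe : ∀ f, ∏ h, K h f ≤ ENNReal.ofReal (Real.exp κ) := fun f =>
    le_trans (Finset.prod_le_prod' fun h _ => (Set.indicator_le_self' (fun _ _ => zero_le) f).trans
      (ENNReal.inv_le_inv.2 (hball h f))) (prod_inv_bellmanBall_le p₀ M I hκ hκ' f)
  have hprod : Measurable fun f => ∏ h, K h f := Finset.measurable_prod _ fun h _ => hKm h
  refine ⟨(Measure.pi p₀).withDensity fun f => ∏ h, K h f, ⟨?_⟩, ?_, ?_⟩
  · rw [withDensity_apply _ .univ, Measure.restrict_univ]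
    exact lintegral_prod_eq_one p₀ K hKm hK hK1
  · rw [← withDensity_const]
    exact withDensity_mono (Filter.Eventually.of_forall hKe)
  · rw [ae_withDensity_iff hprod]
    refine Filter.Eventually.of_forall fun f hf h => ?_
    have := Finset.prod_ne_zero_iff.1 hf h (Finset.mem_univ h)
    exact (Set.mem_of_indicator_ne_zero this : f ∈ {f | NearOptimal M ε h f})

/-! ### The normalizing factors of the likelihood -/

/-- The normalizing factor of the likelihood, relative to the loss of `T_h f`. -/
def normalizer (M : MarkovGame H X A B) (η : ℝ) (h : Fin H) {t : ℕ} (S : Fin t → Traj H X A B)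
    (f : F.Elems) : ℝ :=
  ∫ u, Real.exp (-η * ∑ s, excessLoss M h (Function.update f h u) (S s)) ∂(p₀ h)

/-- The squared noise is the same for every candidate `u` in place of `f^h`, so it factors out of
the normalizing integral and cancels against the numerator. -/
theorem logLikelihood_eq (M : MarkovGame H X A B) {η : ℝ} (h : Fin H) {t : ℕ}
    (S : Fin t → Traj H X A B) (f : F.Elems) (hpos : 0 < normalizer p₀ M η h S f) :
    logLikelihood M p₀ η h (f h) (maxminValue f (h + 1)) S =
      -η * ∑ s, excessLoss M h f (S s) - Real.log (normalizer p₀ M η h S f) := by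
  have h1 : ∀ u : F.Elem h, Real.exp (-η * sqLoss M h u.1 (maxminValue f (h + 1)) S) =
      Real.exp (-η * ∑ s, noise M h f (S s) ^ 2) *
        Real.exp (-η * ∑ s, excessLoss M h (Function.update f h u) (S s)) := fun u => by
    have h2 := sqLoss_eq_excessLoss M h (Function.update f h u) S
    rw [Function.update_self, maxminValue_succ_congr h (update_eq_of_succ f h u),
      noise_congr M h (update_eq_of_succ f h u)] at h2
    rw [h2, ← Real.exp_add]
    ring_nf
  rw [logLikelihood]
  simp only [h1, integral_const_mul]
  rw [← normalizer, Real.log_mul (Real.exp_pos _).ne' hpos.ne', Real.log_exp,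
    sqLoss_eq_excessLoss]
  ring

theorem abs_sum_excessLoss_le (M : MarkovGame H X A B) (I : InducedPolicies F) {β : ℝ}
    (hβ : 1 < β) (hF : BoundedBy F β) (h : Fin H) {t : ℕ} (S : Fin t → Traj H X A B)
    (f : F.Elems) : |∑ s, excessLoss M h f (S s)| ≤ t * (3 * β ^ 2) := by
  refine (Finset.abs_sum_le_sum_abs _ _).trans ((Finset.sum_le_sum fun s _ =>
    abs_excessLoss_le M I hβ hF h f (S s)).trans_eq ?_)
  simp

theorem measurable_sum_excessLoss (M : MarkovGame H X A B) (I : InducedPolicies F) (h : Fin H)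
    (t : ℕ) : Measurable fun p : (Fin t → Traj H X A B) × F.Elems =>
      ∑ s, excessLoss M h p.2 (p.1 s) := by
  refine Finset.measurable_sum _ fun s _ => ?_
  exact (measurable_excessLoss M I h).comp (by fun_prop : Measurable
    fun p : (Fin t → Traj H X A B) × F.Elems => (p.2, p.1 s))

theorem measurable_sum_excessLoss_update (M : MarkovGame H X A B) (I : InducedPolicies F)
    (h : Fin H) (t : ℕ) : Measurable fun p : ((Fin t → Traj H X A B) × F.Elems) × F.Elem h =>
      ∑ s, excessLoss M h (Function.update p.1.2 h p.2) (p.1.1 s) := by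
  have h1 : Measurable fun p : ((Fin t → Traj H X A B) × F.Elems) × F.Elem h =>
      Function.update p.1.2 h p.2 :=
    measurable_update'.comp ((measurable_snd.comp measurable_fst).prodMk measurable_snd)
  have h2 : Measurable fun p : ((Fin t → Traj H X A B) × F.Elems) × F.Elem h =>
      (p.1.1, Function.update p.1.2 h p.2) := (measurable_fst.comp measurable_fst).prodMk h1
  have h3 := (measurable_sum_excessLoss M I h t).comp h2
  exact h3

theorem measurable_normalizer (M : MarkovGame H X A B) (I : InducedPolicies F) (η : ℝ)
    (h : Fin H) (t : ℕ) : Measurable fun p : (Fin t → Traj H X A B) × F.Elems =>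
      normalizer p₀ M η h p.1 p.2 :=
  (StronglyMeasurable.integral_prod_right
    (f := fun (p : (Fin t → Traj H X A B) × F.Elems) (u : F.Elem h) =>
      Real.exp (-η * ∑ s, excessLoss M h (Function.update p.2 h u) (p.1 s)))
    (((measurable_sum_excessLoss_update M I h t).const_mul
      (-η)).exp.stronglyMeasurable)).measurable

theorem measurable_sum_excessLoss_update_right (M : MarkovGame H X A B) (I : InducedPolicies F)
    (h : Fin H) {t : ℕ} (S : Fin t → Traj H X A B) (f : F.Elems) :
    Measurable fun u : F.Elem h => ∑ s, excessLoss M h (Function.update f h u) (S s) := by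
  have := (measurable_sum_excessLoss_update M I h t).comp (measurable_prodMk_left (x := (S, f)))
  exact this

theorem abs_neg_mul_sum_excessLoss_le (M : MarkovGame H X A B) (I : InducedPolicies F) {β η : ℝ}
    (hβ : 1 < β) (hF : BoundedBy F β) (hη : 0 ≤ η) (h : Fin H) {t : ℕ}
    (S : Fin t → Traj H X A B) (f : F.Elems) :
    |-η * ∑ s, excessLoss M h f (S s)| ≤ η * (t * (3 * β ^ 2)) := by
  rw [abs_mul, abs_neg, abs_of_nonneg hη]
  exact mul_le_mul_of_nonneg_left (abs_sum_excessLoss_le M I hβ hF h S f) hη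

theorem normalizer_pos (M : MarkovGame H X A B) (I : InducedPolicies F) {β η : ℝ} (hβ : 1 < β)
    (hF : BoundedBy F β) (hη : 0 ≤ η) (h : Fin H) {t : ℕ} (S : Fin t → Traj H X A B)
    (f : F.Elems) : 0 < normalizer p₀ M η h S f :=
  integral_exp_pos_of_bounded ((measurable_sum_excessLoss_update_right M I h S f).const_mul (-η))
    fun _ => abs_neg_mul_sum_excessLoss_le M I hβ hF hη h S _

theorem abs_log_normalizer_le (M : MarkovGame H X A B) (I : InducedPolicies F) {β η : ℝ}
    (hβ : 1 < β) (hF : BoundedBy F β) (hη : 0 ≤ η) (h : Fin H) {t : ℕ}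
    (S : Fin t → Traj H X A B) (f : F.Elems) :
    |Real.log (normalizer p₀ M η h S f)| ≤ η * (t * (3 * β ^ 2)) := by
  have hpos := normalizer_pos p₀ M I hβ hF hη h S f
  have hb := fun u : F.Elem h =>
    abs_le.1 (abs_neg_mul_sum_excessLoss_le M I hβ hF hη h S (Function.update f h u))
  have hint : Integrable (fun u : F.Elem h =>
      Real.exp (-η * ∑ s, excessLoss M h (Function.update f h u) (S s))) (p₀ h) :=
    integrable_exp_of_bounded
      ((measurable_sum_excessLoss_update_right M I h S f).const_mul (-η))
      fun _ => abs_neg_mul_sum_excessLoss_le M I hβ hF hη h S _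
  rw [abs_le]
  constructor
  · rw [Real.le_log_iff_exp_le hpos]
    calc Real.exp (-(η * (t * (3 * β ^ 2)))) =
          ∫ _u : F.Elem h, Real.exp (-(η * (t * (3 * β ^ 2)))) ∂(p₀ h) := by simp
      _ ≤ _ := integral_mono (integrable_const _) hint fun u => Real.exp_le_exp.2 (hb u).1
  · rw [Real.log_le_iff_le_exp hpos]
    calc _ ≤ ∫ _u : F.Elem h, Real.exp (η * (t * (3 * β ^ 2))) ∂(p₀ h) :=
          integral_mono hint (integrable_const _) fun u => Real.exp_le_exp.2 (hb u).2
      _ = _ := by simp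

/-- Restrict the normalizing integral to candidates close to `T_h f`: each past episode then
contributes an excess loss of at most `ε² + 2εβ`. -/
theorem log_bellmanBall_sub_le_log_normalizer (M : MarkovGame H X A B) (I : InducedPolicies F)
    {β η ε : ℝ} (hβ : 1 < β) (hF : BoundedBy F β) (hη : 0 ≤ η) (h : Fin H) {t : ℕ}
    (S : Fin t → Traj H X A B) (f : F.Elems) (hb : p₀ h (bellmanBall M ε h f) ≠ 0) :
    Real.log ((p₀ h).real (bellmanBall M ε h f)) - η * (t * (ε ^ 2 + 2 * ε * β)) ≤
      Real.log (normalizer p₀ M η h S f) := by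
  have hpos : 0 < (p₀ h).real (bellmanBall M ε h f) :=
    ENNReal.toReal_pos hb (measure_ne_top _ _)
  -- Only the residuals at the visited points matter. This larger set is measurable, unlike possibly
  -- the ball itself.
  let D : Set (F.Elem h) := {u | ∀ s, |residual M h (Function.update f h u) (S s h)| ≤ ε}
  have hD : MeasurableSet D := by
    simp only [D, Set.ofPred_forall]
    refine MeasurableSet.iInter fun s => measurableSet_le (Measurable.abs ?_) measurable_const
    exact (measurable_residual M I h).comp ((measurable_update f).prodMk measurable_const)
  have hsub : (p₀ h).real (bellmanBall M ε h f) ≤ (p₀ h).real D :=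
    measureReal_mono fun u hu s => abs_residual_update_le M h f hu _
  have hint : Integrable (fun u : F.Elem h =>
      Real.exp (-η * ∑ s, excessLoss M h (Function.update f h u) (S s))) (p₀ h) :=
    integrable_exp_of_bounded
      ((measurable_sum_excessLoss_update_right M I h S f).const_mul (-η))
      fun _ => abs_neg_mul_sum_excessLoss_le M I hβ hF hη h S _
  have h1 : (p₀ h).real D * Real.exp (-(η * (t * (ε ^ 2 + 2 * ε * β)))) ≤
      normalizer p₀ M η h S f := by
    calc _ = ∫ _u in D, Real.exp (-(η * (t * (ε ^ 2 + 2 * ε * β)))) ∂(p₀ h) := by simp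
      _ ≤ ∫ u in D, Real.exp (-η * ∑ s, excessLoss M h (Function.update f h u) (S s)) ∂(p₀ h) := by
          refine setIntegral_mono_on (integrable_const _).integrableOn hint.integrableOn hD
            fun u hu => Real.exp_le_exp.2 ?_
          have h2 : ∑ s, excessLoss M h (Function.update f h u) (S s) ≤
              t * (ε ^ 2 + 2 * ε * β) := by
            refine (Finset.sum_le_sum fun s _ => (le_abs_self _).trans
              (abs_excessLoss_le_of_residual M I hβ hF h _ (S s) (hu s))).trans_eq ?_
            rw [Finset.sum_const, Finset.card_univ, Fintype.card_fin, nsmul_eq_mul]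
          nlinarith [mul_le_mul_of_nonneg_left h2 hη]
      _ ≤ _ := setIntegral_le_integral hint (Filter.Eventually.of_forall
          fun u => (Real.exp_pos _).le)
  have h2 := Real.log_le_log (mul_pos hpos (Real.exp_pos _))
    ((mul_le_mul_of_nonneg_right hsub (Real.exp_pos _).le).trans h1)
  rw [Real.log_mul hpos.ne' (Real.exp_pos _).ne', Real.log_exp] at h2
  linarith

end Prior

section Posterior

variable {H : ℕ} {X A B : Type*} [MeasurableSpace X]
  [Fintype A] [Nonempty A] [MeasurableSpace A] [MeasurableSingletonClass A]
  [Fintype B] [Nonempty B] [MeasurableSpace B] [MeasurableSingletonClass B]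
  {F : FunctionClass H X A B}

/-! ### The in-sample error of the posterior of the main agent -/

theorem measurable_meanSq (M : MarkovGame H X A B) (I : InducedPolicies F) (h : Fin H) :
    Measurable fun p : F.Elems × (F.Elems × F.Elems) =>
      meanSq M h p.1 (I.maxPolicy p.2.1) (I.minPolicy p.2.1 p.2.2) := by
  have hs : Measurable (Prod.snd : F.Elems × (F.Elems × F.Elems) → F.Elems × F.Elems) :=
    measurable_snd
  have h1 : Measurable fun q : (F.Elems × (F.Elems × F.Elems)) × Traj H X A B =>
      residual M h q.1.1 (q.2 h) ^ 2 := by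
    have := (measurable_residual M I h).comp (by fun_prop : Measurable
      fun q : (F.Elems × (F.Elems × F.Elems)) × Traj H X A B => (q.1.1, q.2 h))
    exact this.pow_const 2
  exact (StronglyMeasurable.integral_kernel_prod_right (κ := (playKernel M I).comap _ hs)
    (f := fun (p : F.Elems × (F.Elems × F.Elems)) ζ => residual M h p.1 (ζ h) ^ 2)
    h1.stronglyMeasurable).measurable

theorem meanSq_nonneg (M : MarkovGame H X A B) (h : Fin H) (f : F.Elems) (μ : Policy H X A)
    (ν : Policy H X B) : 0 ≤ meanSq M h f μ ν :=
  integral_nonneg fun _ => sq_nonneg _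

theorem meanSq_le (M : MarkovGame H X A B) (I : InducedPolicies F) {β : ℝ} (hβ : 1 < β)
    (hF : BoundedBy F β) (h : Fin H) (f : F.Elems) (μ : Policy H X A) (ν : Policy H X B) :
    meanSq M h f μ ν ≤ β ^ 2 := by
  calc meanSq M h f μ ν ≤ ∫ _, β ^ 2 ∂(episodeLaw M μ ν) :=
        integral_mono (integrable_residual_sq M I hβ hF h f μ ν) (integrable_const _)
          fun ζ => residual_sq_le M I hβ hF h f _
    _ = β ^ 2 := by simp

/-- The sum over past rounds of the mean square residuals of `f`. -/
def cumSq (M : MarkovGame H X A B) (I : InducedPolicies F) (h : Fin H) {t : ℕ}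
    (ω : Fin t → Round F) (f : F.Elems) : ℝ :=
  ∑ s, meanSq M h f (I.maxPolicy (ω s).1.1) (I.minPolicy (ω s).1.1 (ω s).1.2)

theorem measurable_cumSq (M : MarkovGame H X A B) (I : InducedPolicies F) (h : Fin H) (t : ℕ) :
    Measurable fun p : (Fin t → Round F) × F.Elems => cumSq M I h p.1 p.2 := by
  refine Finset.measurable_sum _ fun s _ => ?_
  have := (measurable_meanSq M I h).comp (by fun_prop : Measurable
    fun p : (Fin t → Round F) × F.Elems => (p.2, (p.1 s).1))
  exact this

theorem cumSq_nonneg (M : MarkovGame H X A B) (I : InducedPolicies F) (h : Fin H) {t : ℕ}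
    (ω : Fin t → Round F) (f : F.Elems) : 0 ≤ cumSq M I h ω f :=
  Finset.sum_nonneg fun _ _ => meanSq_nonneg _ _ _ _ _

theorem cumSq_le (M : MarkovGame H X A B) (I : InducedPolicies F) {β : ℝ} (hβ : 1 < β)
    (hF : BoundedBy F β) (h : Fin H) {t : ℕ} (ω : Fin t → Round F) (f : F.Elems) :
    cumSq M I h ω f ≤ t * β ^ 2 :=
  (Finset.sum_le_sum fun s _ => meanSq_le M I hβ hF h f _ _).trans_eq (by simp)

/-- The potential `-η ΔL^h + (η / 2) ∑_s E_s [E_h(f)²]`, whose exponential is a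
supermartingale, also when it is doubled. -/
def linkPotential (M : MarkovGame H X A B) (I : InducedPolicies F) (η : ℝ) (h : Fin H) {t : ℕ}
    (ω : Fin t → Round F) (f : F.Elems) : ℝ :=
  -η * ∑ s, excessLoss M h f (episodes ω s) + η / 2 * cumSq M I h ω f

theorem measurable_sum_excessLoss_episodes (M : MarkovGame H X A B) (I : InducedPolicies F)
    (h : Fin H) (t : ℕ) : Measurable fun p : (Fin t → Round F) × F.Elems =>
      ∑ s, excessLoss M h p.2 (episodes p.1 s) := by
  have h1 : Measurable fun p : (Fin t → Round F) × F.Elems => (episodes p.1, p.2) :=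
    ((measurable_episodes t).comp measurable_fst).prodMk measurable_snd
  have := (measurable_sum_excessLoss M I h t).comp h1
  exact this

theorem measurable_linkPotential (M : MarkovGame H X A B) (I : InducedPolicies F) (η : ℝ)
    (h : Fin H) (t : ℕ) : Measurable fun p : (Fin t → Round F) × F.Elems =>
      linkPotential M I η h p.1 p.2 :=
  ((measurable_sum_excessLoss_episodes M I h t).const_mul _).add
    ((measurable_cumSq M I h t).const_mul _)

theorem abs_linkPotential_le (M : MarkovGame H X A B) (I : InducedPolicies F) {β η : ℝ}
    (hβ : 1 < β) (hF : BoundedBy F β) (hη : 0 ≤ η) (h : Fin H) {t : ℕ} (ω : Fin t → Round F)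
    (f : F.Elems) :
    |linkPotential M I η h ω f| ≤ η * (t * (3 * β ^ 2)) + η / 2 * (t * β ^ 2) := by
  refine (abs_add_le _ _).trans (add_le_add
    (abs_neg_mul_sum_excessLoss_le M I hβ hF hη h _ f) ?_)
  rw [abs_of_nonneg (mul_nonneg (by linarith) (cumSq_nonneg M I h ω f))]
  exact mul_le_mul_of_nonneg_left (cumSq_le M I hβ hF h ω f) (by linarith)

theorem linkPotential_dependsOn (M : MarkovGame H X A B) (I : InducedPolicies F) (η : ℝ)
    (h : Fin H) {t : ℕ} (ω : Fin t → Round F) :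
    DependsOn (linkPotential M I η h ω) {j : Fin H | j = h ∨ (j : ℕ) = h + 1} := by
  intro f g hfg
  have hfg' : ∀ j : Fin H, j = h ∨ (j : ℕ) = h + 1 → f j = g j := fun j hj => hfg j hj
  simp only [linkPotential, cumSq, meanSq, excessLoss_congr M h hfg', residual_congr M h hfg']

variable (p₀ : (h : Fin H) → Measure (F.Elem h)) [∀ h, IsProbabilityMeasure (p₀ h)]
  (M : MarkovGame H X A B) (I : InducedPolicies F) (η lam : ℝ)
  {β : ℝ} (hβ : 1 < β) (hF : BoundedBy F β) (hη : 0 ≤ η)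

include I hβ hF hη

theorem mainExponent_eq {t : ℕ} (S : Fin t → Traj H X A B) (f : F.Elems) :
    mainExponent M p₀ η lam S f = lam * maxminValue f 0 M.init +
      ∑ h, (-η * ∑ s, excessLoss M h f (S s) - Real.log (normalizer p₀ M η h S f)) := by
  rw [mainExponent]
  congr 1
  exact Finset.sum_congr rfl fun h _ => logLikelihood_eq p₀ M h S f
    (normalizer_pos p₀ M I hβ hF hη h S f)

/-- For a fixed history: the chain form of the Gibbs inequality with the link potentials as test
functions. The term `κ` comes from the normalizers of the likelihood. -/
theorem integral_mainPosterior_le {ε κ : ℝ} (hκ : kappa M I p₀ ε < ⊤)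
    (hκ' : κ = (kappa M I p₀ ε).toReal) {t : ℕ} (ω : Fin t → Round F) :
    ∫ f, (η / 2 * ∑ h, cumSq M I h ω f - lam * maxminValue f 0 M.init)
        ∂(mainPosterior M p₀ η lam (episodes ω)) ≤
      1 / 2 * ∑ h, Real.log (∫ f, Real.exp (2 * linkPotential M I η h ω f) ∂(Measure.pi p₀)) -
        Real.log (∫ f, Real.exp (mainExponent M p₀ η lam (episodes ω) f) ∂(Measure.pi p₀)) +
        (κ + H * (η * (t * (ε ^ 2 + 2 * ε * β)))) := by
  haveI := isProbabilityMeasure_mainPosterior p₀ M I (lam := lam) hβ hF hη (episodes ω)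
  have hGm : ∀ h, Measurable (linkPotential M I η h ω) := fun h => by
    have := (measurable_linkPotential M I η h t).comp (measurable_prodMk_left (x := ω))
    exact this
  have hWm : Measurable (mainExponent M p₀ η lam (episodes ω)) := by
    have := (measurable_mainExponent p₀ M I η lam t).comp
      (measurable_prodMk_left (x := episodes ω))
    exact this
  have hWb := abs_mainExponent_le (lam := lam) p₀ M I hβ hF hη (episodes ω)
  have hGb := fun h f => abs_linkPotential_le M I hβ hF hη h ω f
  have h1 := integral_tilted_chain_le p₀ (fun h => linkPotential M I η h ω) hGm
    (fun h => linkPotential_dependsOn M I η h ω) hWm hGb hWb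
  change ∫ f, _ ∂(mainPosterior M p₀ η lam (episodes ω)) ≤ _ at h1
  have hint1 : Integrable (fun f => ∑ h, linkPotential M I η h ω f -
      mainExponent M p₀ η lam (episodes ω) f) (mainPosterior M p₀ η lam (episodes ω)) := by
    have h2 : Integrable (mainExponent M p₀ η lam (episodes ω))
      (mainPosterior M p₀ η lam (episodes ω)) := integrable_of_bounded hWm hWb
    exact (integrable_finsetSum _ fun h _ => integrable_of_bounded (hGm h) (hGb h)).sub h2
  have hcm : ∀ h, Measurable (cumSq M I h ω) := fun h => by
    have := (measurable_cumSq M I h t).comp (measurable_prodMk_left (x := ω))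
    exact this
  have hVm : Measurable fun f : F.Elems => maxminValue f 0 M.init := by
    have := (measurable_maxminValue I 0).comp (measurable_prodMk_right (y := M.init))
    exact this
  have hint2 : Integrable (fun f => η / 2 * ∑ h, cumSq M I h ω f - lam * maxminValue f 0 M.init)
      (mainPosterior M p₀ η lam (episodes ω)) := by
    refine ((integrable_finsetSum _ fun h _ => integrable_of_bounded (hcm h) (c := t * β ^ 2)
      fun f => ?_).const_mul _).sub ((integrable_of_bounded hVm (c := β - 1) fun f => ?_).const_mul _)
    · rw [abs_of_nonneg (cumSq_nonneg M I h ω f)]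
      exact cumSq_le M I hβ hF h ω f
    · have := maxminValue_mem_Icc I hβ hF f 0 M.init
      rw [abs_of_nonneg this.1]
      exact this.2
  -- In `∑ G_h - W` the excess losses cancel, leaving the squared residuals, the optimism term and
  -- `∑ ln Z_h`; the last sum is bounded below uniformly in `f`.
  have h2 := integral_mono (hint2.sub (integrable_const
    (κ + H * (η * (t * (ε ^ 2 + 2 * ε * β)))))) hint1 fun f => by
      simp only [Pi.sub_apply]
      rw [mainExponent_eq p₀ M I η lam hβ hF hη]
      simp only [linkPotential, Finset.sum_add_distrib, Finset.sum_sub_distrib, ← Finset.mul_sum]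
      have h3 := neg_kappa_le_sum_log p₀ M I hκ hκ' f
      have h4 := Finset.sum_le_sum fun (h : Fin H) (_ : h ∈ Finset.univ) =>
        log_bellmanBall_sub_le_log_normalizer p₀ M I hβ hF hη h (episodes ω) f
          (bellmanBall_ne_zero p₀ M I hκ f h)
      simp only [Finset.sum_sub_distrib, Finset.sum_const, Finset.card_univ, Fintype.card_fin,
        nsmul_eq_mul] at h4
      linarith
  rw [integral_sub' hint2 (integrable_const _)] at h2
  simp only [integral_const, probReal_univ, one_smul] at h2
  linarith

/-- The exponential of the excess loss is a supermartingale. -/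
theorem integral_exp_potential_le {θ : ℝ} (hθ0 : 0 ≤ θ) (hθ : θ * β ^ 2 ≤ 1 / 2) (h : Fin H)
    (t : ℕ) (f : F.Elems) :
    ∫ ω, Real.exp (-θ * ∑ s, excessLoss M h f (episodes ω s) + θ / 2 * cumSq M I h ω f)
      ∂(recordLaw p₀ M I η lam t) ≤ 1 := by
  have hcm : Measurable fun p : F.Elems × F.Elems =>
      meanSq M h f (I.maxPolicy p.1) (I.minPolicy p.1 p.2) := by
    have := (measurable_meanSq M I h).comp (measurable_prodMk_left (x := f))
    exact this
  have hem := measurable_excessLoss_right M I h f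
  let φ : Round F → ℝ≥0∞ := fun w => ENNReal.ofReal (Real.exp (-θ * excessLoss M h f w.2 +
    θ / 2 * meanSq M h f (I.maxPolicy w.1.1) (I.minPolicy w.1.1 w.1.2)))
  have hφ : Measurable φ := (((hem.comp measurable_snd).const_mul (-θ)).add
    ((hcm.comp measurable_fst).const_mul (θ / 2))).exp.ennreal_ofReal
  -- Once `(f', g)` is given, the compensating factor is a constant that exactly offsets the decay
  -- of the exponential excess loss.
  have h1 : ∀ f' g, ∫⁻ ζ, φ ((f', g), ζ) ∂(episodeLaw M (I.maxPolicy f') (I.minPolicy f' g)) ≤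
      1 := by
    intro f' g
    have h2 := lintegral_exp_excessLoss_le M I hβ hF hθ0 hθ (I.maxPolicy f') (I.minPolicy f' g) h f
    simp only [φ, Real.exp_add, ENNReal.ofReal_mul (Real.exp_pos _).le]
    rw [lintegral_mul_const _ (hem.const_mul _).exp.ennreal_ofReal]
    refine (mul_le_mul_left h2 _).trans_eq ?_
    rw [← ENNReal.ofReal_mul (Real.exp_pos _).le, ← Real.exp_add]
    simp
  have h2 := lintegral_prod_recordLaw_le p₀ M I η lam hβ hF hη hφ h1 t
  rw [integral_eq_lintegral_of_nonneg_ae (Filter.Eventually.of_forall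
    fun ω => (Real.exp_pos _).le)]
  · refine ENNReal.toReal_le_of_le_ofReal zero_le_one ?_
    rw [ENNReal.ofReal_one]
    refine le_trans (le_of_eq (lintegral_congr fun ω => ?_)) h2
    rw [← ENNReal.ofReal_prod_of_nonneg fun _ _ => (Real.exp_pos _).le, ← Real.exp_sum,
      Finset.sum_add_distrib, ← Finset.mul_sum, ← Finset.mul_sum]
    rfl
  · have h3 := ((measurable_sum_excessLoss_episodes M I h t).const_mul (-θ)).add
      ((measurable_cumSq M I h t).const_mul (θ / 2))
    have h4 := h3.comp (measurable_prodMk_right (y := f))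
    exact h4.exp.aestronglyMeasurable

/-- Use `ln x ≤ x - 1`, exchange the prior with the law of the rounds, and apply the supermartingale
bound at `θ = 2η`. The doubling from the even-odd splitting is what requires `2ηβ² ≤ 1/2`. -/
theorem integral_log_linkPotential_nonpos (hηβ : 2 * η * β ^ 2 ≤ 1 / 2) (h : Fin H) (t : ℕ) :
    ∫ ω, Real.log (∫ f, Real.exp (2 * linkPotential M I η h ω f) ∂(Measure.pi p₀))
      ∂(recordLaw p₀ M I η lam t) ≤ 0 := by
  haveI := isProbabilityMeasure_recordLaw p₀ M I η lam hβ hF hη t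
  have hm := (measurable_linkPotential M I η h t).const_mul 2
  have hb : ∀ p : (Fin t → Round F) × F.Elems, |2 * linkPotential M I η h p.1 p.2| ≤
      2 * (η * (t * (3 * β ^ 2)) + η / 2 * (t * β ^ 2)) := fun p => by
    rw [abs_mul, abs_two]
    exact mul_le_mul_of_nonneg_left (abs_linkPotential_le M I hβ hF hη h p.1 p.2) zero_le_two
  have hint : Integrable (fun p : (Fin t → Round F) × F.Elems =>
      Real.exp (2 * linkPotential M I η h p.1 p.2))
      ((recordLaw p₀ M I η lam t).prod (Measure.pi p₀)) := integrable_exp_of_bounded hm hb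
  have hlin := hint.integral_prod_left
  have h1 : ∫ ω, ∫ f, Real.exp (2 * linkPotential M I η h ω f) ∂(Measure.pi p₀)
      ∂(recordLaw p₀ M I η lam t) ≤ 1 := by
    rw [integral_integral_swap hint]
    calc _ ≤ ∫ _f : F.Elems, (1 : ℝ) ∂(Measure.pi p₀) := by
          refine integral_mono hint.integral_prod_right (integrable_const _) fun f => ?_
          have h2 := integral_exp_potential_le p₀ M I η lam hβ hF hη (θ := 2 * η) (by linarith)
            hηβ h t f
          refine le_trans (le_of_eq (integral_congr_ae (Filter.Eventually.of_forall
            fun ω => ?_))) h2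
          simp only [linkPotential]
          congr 1
          ring
      _ = 1 := by simp
  -- A non-integrable function has integral `0` by convention, which also satisfies the claim.
  by_cases hlog : Integrable (fun ω => Real.log (∫ f, Real.exp (2 * linkPotential M I η h ω f)
      ∂(Measure.pi p₀))) (recordLaw p₀ M I η lam t)
  · have h3 := integral_mono hlog (hlin.sub (integrable_const 1)) fun ω => by
      have hmω : Measurable fun f => 2 * linkPotential M I η h ω f := by
        have := hm.comp (measurable_prodMk_left (x := ω))
        exact this
      exact Real.log_le_sub_one_of_pos (integral_exp_pos_of_bounded hmω fun f => hb (ω, f))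
    rw [integral_sub' hlin (integrable_const _)] at h3
    simp only [integral_const, probReal_univ, one_smul] at h3
    linarith
  · rw [integral_undef hlog]

/-- Here `f` is fixed independently of the data, so the normalizer is a prior average of exponential
supermartingales and has mean at most one. -/
theorem integral_log_normalizer_nonpos (hηβ : η * β ^ 2 ≤ 1 / 2) (h : Fin H) (t : ℕ)
    (f : F.Elems) :
    ∫ ω, Real.log (normalizer p₀ M η h (episodes ω) f) ∂(recordLaw p₀ M I η lam t) ≤ 0 := by
  haveI := isProbabilityMeasure_recordLaw p₀ M I η lam hβ hF hη t
  have hm : Measurable fun p : (Fin t → Round F) × F.Elem h =>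
      -η * ∑ s, excessLoss M h (Function.update f h p.2) (episodes p.1 s) := by
    have h1 : Measurable fun p : (Fin t → Round F) × F.Elem h =>
        (p.1, Function.update f h p.2) :=
      measurable_fst.prodMk ((measurable_update f).comp measurable_snd)
    have := (measurable_sum_excessLoss_episodes M I h t).comp h1
    exact this.const_mul (-η)
  have hint : Integrable (fun p : (Fin t → Round F) × F.Elem h =>
      Real.exp (-η * ∑ s, excessLoss M h (Function.update f h p.2) (episodes p.1 s)))
      ((recordLaw p₀ M I η lam t).prod (p₀ h)) := integrable_exp_of_bounded hm
    fun p => abs_neg_mul_sum_excessLoss_le M I hβ hF hη h _ _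
  have hlin := hint.integral_prod_left
  have h1 : ∫ ω, normalizer p₀ M η h (episodes ω) f ∂(recordLaw p₀ M I η lam t) ≤ 1 := by
    simp only [normalizer]
    rw [integral_integral_swap hint]
    calc _ ≤ ∫ _u : F.Elem h, (1 : ℝ) ∂(p₀ h) := by
          refine integral_mono hint.integral_prod_right (integrable_const _) fun u => ?_
          have h2 := integral_exp_potential_le p₀ M I η lam hβ hF hη hη hηβ h t
            (Function.update f h u)
          have hmu : Measurable fun ω : Fin t → Round F =>
              -η * ∑ s, excessLoss M h (Function.update f h u) (episodes ω s) +
              η / 2 * cumSq M I h ω (Function.update f h u) := by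
            have h3 := measurable_linkPotential M I η h t
            have h4 := h3.comp (measurable_prodMk_right (y := Function.update f h u))
            exact h4
          have hmu' : Measurable fun ω : Fin t → Round F =>
              -η * ∑ s, excessLoss M h (Function.update f h u) (episodes ω s) := by
            have h4 := hm.comp (measurable_prodMk_right (y := u))
            exact h4
          refine le_trans (integral_mono (integrable_exp_of_bounded hmu' fun ω =>
            abs_neg_mul_sum_excessLoss_le M I hβ hF hη h _ _) (integrable_exp_of_bounded hmu
            fun ω => abs_linkPotential_le M I hβ hF hη h ω _) fun ω => ?_) h2
          -- The nonnegative squared residuals are added for free to reach the form of the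
          -- supermartingale bound.
          refine Real.exp_le_exp.2 ?_
          have := mul_nonneg (by linarith : 0 ≤ η / 2)
            (cumSq_nonneg M I h ω (Function.update f h u))
          linarith
      _ = 1 := by simp
  by_cases hlog : Integrable (fun ω => Real.log (normalizer p₀ M η h (episodes ω) f))
      (recordLaw p₀ M I η lam t)
  · have h3 := integral_mono hlog (hlin.sub (integrable_const 1)) fun ω =>
      Real.log_le_sub_one_of_pos (normalizer_pos p₀ M I hβ hF hη h (episodes ω) f)
    rw [integral_sub' hlin (integrable_const _)] at h3
    simp only [integral_const, probReal_univ, one_smul] at h3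
    simp only [normalizer] at h1 h3 ⊢
    linarith
  · rw [integral_undef hlog]

end Posterior

/-! ### Logarithms of partition functions with bounded exponent -/

theorem abs_log_integral_exp_le {E : Type*} [MeasurableSpace E] {P : Measure E}
    [IsProbabilityMeasure P] {W : E → ℝ} (hW : Measurable W) {c : ℝ} (hc : ∀ e, |W e| ≤ c) :
    |Real.log (∫ e, Real.exp (W e) ∂P)| ≤ c := by
  have hpos := integral_exp_pos_of_bounded (P := P) hW hc
  have hint := integrable_exp_of_bounded (P := P) hW hc
  have h1 : Real.exp (-c) ≤ ∫ e, Real.exp (W e) ∂P := by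
    have := integral_mono (integrable_const (Real.exp (-c))) hint fun e =>
      Real.exp_le_exp.2 (abs_le.1 (hc e)).1
    simpa using this
  have h2 : ∫ e, Real.exp (W e) ∂P ≤ Real.exp c := by
    have := integral_mono hint (integrable_const (Real.exp c)) fun e =>
      Real.exp_le_exp.2 (abs_le.1 (hc e)).2
    simpa using this
  exact abs_le.2 ⟨(Real.le_log_iff_exp_le hpos).2 h1, (Real.log_le_iff_le_exp hpos).2 h2⟩

theorem integrable_log_integral_exp {E E' : Type*} [MeasurableSpace E] [MeasurableSpace E']
    {P : Measure E} [IsProbabilityMeasure P] {R : Measure E'} [IsFiniteMeasure R]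
    {W : E' → E → ℝ} (hW : Measurable fun p : E' × E => W p.1 p.2) {c : ℝ}
    (hc : ∀ ω e, |W ω e| ≤ c) :
    Integrable (fun ω => Real.log (∫ e, Real.exp (W ω e) ∂P)) R := by
  have h1 : StronglyMeasurable fun p : E' × E => Real.exp (W p.1 p.2) :=
    hW.exp.stronglyMeasurable
  refine integrable_of_bounded h1.integral_prod_right.measurable.log (c := c) fun ω => ?_
  refine abs_log_integral_exp_le ?_ (hc ω)
  have := hW.comp (measurable_prodMk_left (x := ω))
  exact this

section Evidence

variable {H : ℕ} {X A B : Type*} [MeasurableSpace X]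
  [Fintype A] [Nonempty A] [MeasurableSpace A] [MeasurableSingletonClass A]
  [Fintype B] [Nonempty B] [MeasurableSpace B] [MeasurableSingletonClass B]
  {F : FunctionClass H X A B}
  (p₀ : (h : Fin H) → Measure (F.Elem h)) [∀ h, IsProbabilityMeasure (p₀ h)]
  (M : MarkovGame H X A B) (I : InducedPolicies F) (η lam : ℝ)
  {β : ℝ} (hβ : 1 < β) (hF : BoundedBy F β) (hη : 0 ≤ η)

/-! ### The evidence of the main agent -/

include hβ hF hη

/-- Near optimality holds off a null set of `reachMeasure`, which almost surely no episode visits,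
whatever policies the algorithm selects. -/
theorem NearOptimal.ae_abs_residual_le {ε : ℝ} {h : Fin H} {f : F.Elems}
    (hf : NearOptimal M ε h f) (t : ℕ) :
    ∀ᵐ ω ∂(recordLaw p₀ M I η lam t), ∀ s, |residual M h f (episodes ω s h)| ≤ ε := by
  let N : Set X := {x | ∀ a b, |residual M h f (x, a, b)| ≤ ε}
  have hN : MeasurableSet N := by
    simp only [N, Set.ofPred_forall]
    refine MeasurableSet.iInter fun a => MeasurableSet.iInter fun b => ?_
    have h1 := (measurable_residual_right M I h f).comp
      (by fun_prop : Measurable fun x : X => (x, a, b))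
    have h2 : Measurable fun x : X => |residual M h f (x, a, b)| := measurable_norm.comp h1
    exact measurableSet_le h2 measurable_const
  have hN' : MeasurableSet {ζ : Traj H X A B | (ζ h).1 ∈ N} :=
    (by fun_prop : Measurable fun ζ : Traj H X A B => (ζ h).1) hN
  have h1 := ae_recordLaw_of_ae_episodeLaw p₀ M I η lam hβ hF hη hN'
    (fun f' g => ae_episodeLaw_of_reachMeasure M (I.maxPolicy f') (I.minPolicy f' g) h hN hf) t
  filter_upwards [h1] with ω hω s
  exact hω s ((ω s).2 h).2.1 ((ω s).2 h).2.2

/-- For a fixed near optimal `f` the excess losses are small along the data, optimism gives `V_f ≥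
V^* - Hε`, and the logarithms of the normalizers have nonpositive mean. -/
theorem integral_neg_mainExponent_le {μs : Policy H X A} {νs : Policy H X B}
    (hN : IsNash M μs νs) (hlam : 0 ≤ lam) (hηβ : η * β ^ 2 ≤ 1 / 2) {ε : ℝ} {f : F.Elems}
    (hf : ∀ h, NearOptimal M ε h f) (t : ℕ) :
    ∫ ω, -mainExponent M p₀ η lam (episodes ω) f ∂(recordLaw p₀ M I η lam t) ≤
      H * (η * (t * (ε ^ 2 + 2 * ε * β))) - lam * (initValue M μs νs - H * ε) := by
  haveI := isProbabilityMeasure_recordLaw p₀ M I η lam hβ hF hη t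
  have hWm : Measurable fun ω : Fin t → Round F => mainExponent M p₀ η lam (episodes ω) f := by
    have h1 : Measurable fun ω : Fin t → Round F => (episodes ω, f) :=
      (measurable_episodes t).prodMk measurable_const
    have := (measurable_mainExponent p₀ M I η lam t).comp h1
    exact this
  have hLm : ∀ h, Measurable fun ω : Fin t → Round F =>
      Real.log (normalizer p₀ M η h (episodes ω) f) := fun h => by
    have h1 : Measurable fun ω : Fin t → Round F => (episodes ω, f) :=
      (measurable_episodes t).prodMk measurable_const
    have := (measurable_normalizer p₀ M I η h t).comp h1
    exact this.log
  have hLi : ∀ h, Integrable (fun ω : Fin t → Round F =>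
      Real.log (normalizer p₀ M η h (episodes ω) f)) (recordLaw p₀ M I η lam t) := fun h =>
    integrable_of_bounded (hLm h) fun ω => abs_log_normalizer_le p₀ M I hβ hF hη h _ f
  have hV := hN.initValue_le_maxminValue I hβ hF hf
  have hae : ∀ᵐ ω ∂(recordLaw p₀ M I η lam t), -mainExponent M p₀ η lam (episodes ω) f ≤
      (H * (η * (t * (ε ^ 2 + 2 * ε * β))) - lam * (initValue M μs νs - H * ε)) +
        ∑ h, Real.log (normalizer p₀ M η h (episodes ω) f) := by
    filter_upwards [ae_all_iff.2 fun h =>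
      (hf h).ae_abs_residual_le p₀ M I η lam hβ hF hη t] with ω hω
    rw [mainExponent_eq p₀ M I η lam hβ hF hη]
    have h1 : ∀ h : Fin H, η * ∑ s, excessLoss M h f (episodes ω s) ≤
        η * (t * (ε ^ 2 + 2 * ε * β)) := fun h => by
      refine mul_le_mul_of_nonneg_left ?_ hη
      refine (Finset.sum_le_sum fun s _ => (le_abs_self _).trans
        (abs_excessLoss_le_of_residual M I hβ hF h f _ (hω h s))).trans_eq ?_
      rw [Finset.sum_const, Finset.card_univ, Fintype.card_fin, nsmul_eq_mul]
    have h2 := Finset.sum_le_sum fun (h : Fin H) (_ : h ∈ Finset.univ) => h1 h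
    rw [Finset.sum_const, Finset.card_univ, Fintype.card_fin, nsmul_eq_mul] at h2
    have h3 := mul_le_mul_of_nonneg_left hV hlam
    simp only [Finset.sum_sub_distrib, neg_mul, Finset.sum_neg_distrib]
    linarith
  refine (integral_mono_ae (integrable_of_bounded hWm fun ω =>
    abs_mainExponent_le p₀ M I hβ hF hη (episodes ω) f).neg
    ((integrable_const _).add (integrable_finsetSum _ fun h _ => hLi h)) hae).trans ?_
  rw [integral_add' (integrable_const _) (integrable_finsetSum _ fun h _ => hLi h),
    integral_finsetSum _ fun h _ => hLi h]
  have h4 := Finset.sum_nonpos fun (h : Fin H) (_ : h ∈ Finset.univ) =>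
    integral_log_normalizer_nonpos p₀ M I η lam hβ hF hη hηβ h t f
  simp only [integral_const, probReal_univ, one_smul]
  linarith

/-- Compare the prior with the near optimal comparator `Q` at the price `κ`. As `Q` does not depend
on the data, Fubini reduces the claim to a single fixed `f`. -/
theorem integral_neg_log_evidence_le {μs : Policy H X A} {νs : Policy H X B}
    (hN : IsNash M μs νs) (hlam : 0 ≤ lam) (hηβ : η * β ^ 2 ≤ 1 / 2) {ε κ : ℝ}
    (hκ : kappa M I p₀ ε < ⊤) (hκ' : κ = (kappa M I p₀ ε).toReal) (t : ℕ) :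
    ∫ ω, -Real.log (∫ f, Real.exp (mainExponent M p₀ η lam (episodes ω) f) ∂(Measure.pi p₀))
        ∂(recordLaw p₀ M I η lam t) ≤
      κ + (H * (η * (t * (ε ^ 2 + 2 * ε * β))) - lam * (initValue M μs νs - H * ε)) := by
  haveI := isProbabilityMeasure_recordLaw p₀ M I η lam hβ hF hη t
  obtain ⟨Q, hQ, hQP, hQae⟩ := exists_comparator p₀ M I hκ hκ'
  have hWm : Measurable fun p : (Fin t → Round F) × F.Elems =>
      mainExponent M p₀ η lam (episodes p.1) p.2 := by
    have h1 : Measurable fun p : (Fin t → Round F) × F.Elems => (episodes p.1, p.2) :=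
      ((measurable_episodes t).comp measurable_fst).prodMk measurable_snd
    have := (measurable_mainExponent p₀ M I η lam t).comp h1
    exact this
  have hWb : ∀ (ω : Fin t → Round F) (f : F.Elems), _ := fun ω f =>
    abs_mainExponent_le (lam := lam) p₀ M I hβ hF hη (episodes ω) f
  have hWω : ∀ ω : Fin t → Round F, Measurable (mainExponent M p₀ η lam (episodes ω)) :=
    fun ω => by
      have := hWm.comp (measurable_prodMk_left (x := ω))
      exact this
  have hint : Integrable (fun p : (Fin t → Round F) × F.Elems =>
      -mainExponent M p₀ η lam (episodes p.1) p.2) ((recordLaw p₀ M I η lam t).prod Q) :=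
    (integrable_of_bounded hWm fun p => hWb p.1 p.2).neg
  calc _ ≤ ∫ ω, (κ + ∫ f, -mainExponent M p₀ η lam (episodes ω) f ∂Q)
        ∂(recordLaw p₀ M I η lam t) :=
        integral_mono (integrable_log_integral_exp hWm hWb).neg
          ((integrable_const κ).add hint.integral_prod_left) fun ω =>
            neg_log_integral_exp_le hQP (hWω ω) (hWb ω)
    _ = κ + ∫ f, ∫ ω, -mainExponent M p₀ η lam (episodes ω) f ∂(recordLaw p₀ M I η lam t) ∂Q := by
        rw [integral_add (integrable_const κ) hint.integral_prod_left,
          integral_integral_swap hint]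
        simp
    _ ≤ κ + ∫ _f : F.Elems, (H * (η * (t * (ε ^ 2 + 2 * ε * β))) -
          lam * (initValue M μs νs - H * ε)) ∂Q := by
        refine add_le_add le_rfl
          (integral_mono_ae hint.integral_prod_right (integrable_const _) ?_)
        filter_upwards [hQae] with f hf
        exact integral_neg_mainExponent_le p₀ M I η lam hβ hF hη hN hlam hηβ hf t
    _ = _ := by simp

omit hβ hF hη in
theorem measurable_cumSq_sub_optimism (t : ℕ) : Measurable fun p : (Fin t → Round F) × F.Elems =>
    η / 2 * ∑ h, cumSq M I h p.1 p.2 - lam * maxminValue p.2 0 M.init := by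
  have h1 := (measurable_maxminValue I 0).comp (by fun_prop : Measurable
    fun p : (Fin t → Round F) × F.Elems => (p.2, M.init))
  exact ((Finset.measurable_sum _ fun h _ => measurable_cumSq M I h t).const_mul _).sub
    (h1.const_mul lam)

theorem abs_cumSq_sub_optimism_le (hlam : 0 ≤ lam) {t : ℕ} (ω : Fin t → Round F)
    (f : F.Elems) : |η / 2 * ∑ h, cumSq M I h ω f - lam * maxminValue f 0 M.init| ≤
      η / 2 * (H * (t * β ^ 2)) + lam * (β - 1) := by
  have h1 := maxminValue_mem_Icc I hβ hF f 0 M.init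
  have h2 : 0 ≤ ∑ h, cumSq M I h ω f := Finset.sum_nonneg fun h _ => cumSq_nonneg M I h ω f
  have h3 := Finset.sum_le_sum fun (h : Fin H) (_ : h ∈ Finset.univ) =>
    cumSq_le M I hβ hF h ω f
  rw [Finset.sum_const, Finset.card_univ, Fintype.card_fin, nsmul_eq_mul] at h3
  refine (abs_sub _ _).trans (add_le_add ?_ ?_)
  · rw [abs_of_nonneg (mul_nonneg (by linarith) h2)]
    exact mul_le_mul_of_nonneg_left h3 (by linarith)
  · rw [abs_of_nonneg (mul_nonneg hlam h1.1)]
    exact mul_le_mul_of_nonneg_left h1.2 hlam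

/-- The in-sample error of the main agent, minus its optimism, is small in every round. -/
theorem integral_cumSq_sub_optimism_le {μs : Policy H X A} {νs : Policy H X B}
    (hN : IsNash M μs νs) (hlam : 0 ≤ lam) (hηβ : 2 * η * β ^ 2 ≤ 1 / 2) {ε κ : ℝ}
    (hκ : kappa M I p₀ ε < ⊤) (hκ' : κ = (kappa M I p₀ ε).toReal) (t : ℕ) :
    ∫ ω, ∫ f, (η / 2 * ∑ h, cumSq M I h ω f - lam * maxminValue f 0 M.init)
        ∂(mainPosterior M p₀ η lam (episodes ω)) ∂(recordLaw p₀ M I η lam t) ≤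
      2 * κ + 2 * (H * (η * (t * (ε ^ 2 + 2 * ε * β)))) + lam * (H * ε) -
        lam * initValue M μs νs := by
  haveI := isProbabilityMeasure_recordLaw p₀ M I η lam hβ hF hη t
  haveI := isMarkovKernel_mainKernel p₀ M I η lam hβ hF hη t
  have hWm : Measurable fun p : (Fin t → Round F) × F.Elems =>
      mainExponent M p₀ η lam (episodes p.1) p.2 := by
    have h1 : Measurable fun p : (Fin t → Round F) × F.Elems => (episodes p.1, p.2) :=
      ((measurable_episodes t).comp measurable_fst).prodMk measurable_snd
    have := (measurable_mainExponent p₀ M I η lam t).comp h1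
    exact this
  have hWi := integrable_log_integral_exp (P := Measure.pi p₀) (R := recordLaw p₀ M I η lam t)
    (W := fun ω f => mainExponent M p₀ η lam (episodes ω) f) hWm
    fun ω f => abs_mainExponent_le (lam := lam) p₀ M I hβ hF hη (episodes ω) f
  have hGi := fun h => integrable_log_integral_exp (P := Measure.pi p₀)
    (R := recordLaw p₀ M I η lam t) (W := fun ω f => 2 * linkPotential M I η h ω f)
    ((measurable_linkPotential M I η h t).const_mul 2)
    (c := 2 * (η * (t * (3 * β ^ 2)) + η / 2 * (t * β ^ 2))) fun ω f => by
      rw [abs_mul, abs_two]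
      exact mul_le_mul_of_nonneg_left (abs_linkPotential_le M I hβ hF hη h ω f) zero_le_two
  have hGi' := (integrable_finsetSum Finset.univ fun h _ => hGi h).const_mul (1 / 2)
  have hle := fun ω : Fin t → Round F =>
    integral_mainPosterior_le p₀ M I η lam hβ hF hη hκ hκ' ω
  have hE := integral_neg_log_evidence_le p₀ M I η lam hβ hF hη hN hlam
    (by nlinarith [mul_nonneg hη (sq_nonneg β)]) hκ hκ' t
  rw [integral_neg] at hE
  have hG := Finset.sum_nonpos fun (h : Fin H) (_ : h ∈ Finset.univ) =>
    integral_log_linkPotential_nonpos p₀ M I η lam hβ hF hη hηβ h t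
  have hφm := measurable_cumSq_sub_optimism M I η lam t
  have hφb := fun ω : Fin t → Round F => abs_cumSq_sub_optimism_le M I η lam hβ hF hη hlam ω
  have hLi : Integrable (fun ω : Fin t → Round F =>
      ∫ f, (η / 2 * ∑ h, cumSq M I h ω f - lam * maxminValue f 0 M.init)
        ∂(mainPosterior M p₀ η lam (episodes ω))) (recordLaw p₀ M I η lam t) := by
    have h1 := StronglyMeasurable.integral_kernel_prod_right
      (κ := (mainKernel p₀ M I η lam t).comap episodes (measurable_episodes t))
      (f := fun (ω : Fin t → Round F) f =>
        η / 2 * ∑ h, cumSq M I h ω f - lam * maxminValue f 0 M.init) hφm.stronglyMeasurable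
    refine integrable_of_bounded h1.measurable (c := η / 2 * (H * (t * β ^ 2)) + lam * (β - 1))
      fun ω => ?_
    haveI := isProbabilityMeasure_mainPosterior p₀ M I (lam := lam) hβ hF hη (episodes ω)
    exact abs_integral_le_of_bounded (P := mainPosterior M p₀ η lam (episodes ω)) (hφb ω)
  -- Average the bound for a fixed history over the rounds. The link terms have nonpositive mean;
  -- the evidence term brings the second `κ` and `-lam V^*`.
  refine (integral_mono hLi ((hGi'.sub hWi).add (integrable_const _)) hle).trans ?_
  rw [integral_add' (hGi'.sub hWi) (integrable_const _), integral_sub' hGi' hWi,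
    integral_const_mul, integral_finsetSum _ fun h _ => hGi h]
  simp only [integral_const, probReal_univ, one_smul]
  linarith

end Evidence

section Decoupling

variable {H : ℕ} {X A B : Type*} [MeasurableSpace X]
  [Fintype A] [Nonempty A] [MeasurableSpace A] [MeasurableSingletonClass A]
  [Fintype B] [Nonempty B] [MeasurableSpace B] [MeasurableSingletonClass B]
  {F : FunctionClass H X A B}

/-! ### The decoupling inequality -/

theorem abs_residualPolicy_le (M : MarkovGame H X A B) (I : InducedPolicies F) {β : ℝ}
    (hβ : 1 < β) (hF : BoundedBy F β) (h : Fin H) (f g : F.Elems) (z : X × A × B) :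
    |residualPolicy M (I.maxPolicy f) h g z| ≤ β := by
  have hm : Measurable (policyValue (I.maxPolicy f) g (h + 1)) := by
    have := (measurable_policyValue I (h + 1)).comp (measurable_prodMk_left (x := (f, g)))
    exact this
  have h1 := hF h _ (g h).2 z.1 z.2.1 z.2.2
  have h2 := backup_mem_Icc M h hm
    (fun x => policyValue_mem_Icc I hβ hF f g (h + 1) x) z.1 z.2.1 z.2.2
  rw [residualPolicy, bellmanPolicy, abs_le]
  constructor <;> linarith [h1.1, h1.2, h2.1, h2.2]

/-- The crude bound on the left side alone fits into `K / (4m)`. It shows that some integer is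
admissible in the definition of the coefficient. -/
theorem decouples_of_bounded {T : ℕ} (π : Fin T → Measure (Traj H X A B))
    [∀ t, IsProbabilityMeasure (π t)] {e : Fin T → Fin H → X × A × B → ℝ} {c m : ℝ} (hm : 0 < m)
    (he : ∀ t h z, |e t h z| ≤ c) {K : ℤ} (hK : 4 * m * (H * (T * c)) ≤ K) :
    Decouples π e m K := by
  have h1 : ∑ h, ∑ t, ∫ ζ, e t h (ζ h) ∂(π t) ≤ H * (T * c) := by
    calc _ ≤ ∑ _h : Fin H, ∑ _t : Fin T, c := Finset.sum_le_sum fun h _ =>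
          Finset.sum_le_sum fun t _ => (le_abs_self _).trans
            (abs_integral_le_of_bounded fun ζ => he t h (ζ h))
      _ = H * (T * c) := by simp
  have h2 : 0 ≤ ∑ h, ∑ t, ∑ s ∈ Finset.Iio t, ∫ ζ, (e t h (ζ h)) ^ 2 ∂(π s) :=
    Finset.sum_nonneg fun h _ => Finset.sum_nonneg fun t _ => Finset.sum_nonneg fun s _ =>
      integral_nonneg fun ζ => sq_nonneg _
  have h3 : H * (T * c) ≤ K / (4 * m) := by
    rw [le_div_iff₀ (by positivity)]
    linarith
  have h4 := mul_nonneg hm.le h2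
  unfold Decouples
  linarith

/-- An infimum of integers satisfies the inequality only if the admissible set is nonempty and
bounded below; only then is it attained. -/
theorem decouples_residual (M : MarkovGame H X A B) (I : InducedPolicies F) {β : ℝ}
    (hβ : 1 < β) (hF : BoundedBy F β) {T : ℕ} {m : ℝ} (hm : 0 < m) (f g : Fin T → F.Elems) :
    Decouples (fun t => episodeLaw M (I.maxPolicy (f t)) (I.minPolicy (f t) (g t)))
      (fun t h => residual M h (f t)) m (decouplingCoeff M I T m) := by
  have hmem : decouplingCoeff M I T m ∈ {K : ℤ | ∀ f g : Fin T → F.Elems,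
      Decouples (fun t => episodeLaw M (I.maxPolicy (f t)) (I.minPolicy (f t) (g t)))
        (fun t h => residualPolicy M (I.maxPolicy (f t)) h (g t)) m K ∧
      Decouples (fun t => episodeLaw M (I.maxPolicy (f t)) (I.minPolicy (f t) (g t)))
        (fun t h => residual M h (f t)) m K} := by
    -- An admissible integer is the ceiling of `4mHTβ`. The given `f, g` provide the lower bound:
    -- solving their inequality for `K` bounds every admissible integer from below.
    refine Int.csInf_mem ⟨⌈4 * m * (H * (T * β))⌉, fun f g => ⟨?_, ?_⟩⟩
      ⟨⌊4 * m * (∑ h, ∑ t, ∫ ζ, residual M h (f t) (ζ h)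
        ∂(episodeLaw M (I.maxPolicy (f t)) (I.minPolicy (f t) (g t))) -
        m * ∑ h, ∑ t, ∑ s ∈ Finset.Iio t, ∫ ζ, (residual M h (f t) (ζ h)) ^ 2
        ∂(episodeLaw M (I.maxPolicy (f s)) (I.minPolicy (f s) (g s))))⌋, fun K hK => ?_⟩
    · exact decouples_of_bounded _ hm
        (fun t h z => abs_residualPolicy_le M I hβ hF h (f t) (g t) z) (Int.le_ceil _)
    · exact decouples_of_bounded _ hm (fun t h z => abs_residual_le M I hβ hF h (f t) z)
        (Int.le_ceil _)
    · have h1 := (hK f g).2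
      unfold Decouples at h1
      rw [← sub_le_iff_le_add', le_div_iff₀ (by positivity), mul_comm] at h1
      exact_mod_cast (Int.floor_le _).trans h1
  exact (hmem f g).2

variable (p₀ : (h : Fin H) → Measure (F.Elem h)) [∀ h, IsProbabilityMeasure (p₀ h)]
  (M : MarkovGame H X A B) (I : InducedPolicies F) (η lam : ℝ)
  {β : ℝ} (hβ : 1 < β) (hF : BoundedBy F β) (hη : 0 ≤ η)

/-! ### The regret as an integral over the joint law of all rounds -/

theorem measurable_initValue : Measurable fun p : F.Elems × F.Elems =>
    initValue M (I.maxPolicy p.1) (I.minPolicy p.1 p.2) := by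
  have h1 : Measurable fun q : (F.Elems × F.Elems) × Traj H X A B =>
      totalReward M H 0 (by omega) q.2 :=
    (measurable_totalReward M H 0 (by omega)).comp measurable_snd
  exact (StronglyMeasurable.integral_kernel_prod_right (κ := playKernel M I)
    (f := fun (_ : F.Elems × F.Elems) ζ => totalReward M H 0 (by omega) ζ)
    h1.stronglyMeasurable).measurable

include hβ hF hη

theorem integral_stepKernel (t : ℕ) (S : Fin t → Traj H X A B) {φ : F.Elems × F.Elems → ℝ}
    (hφ : Measurable φ) {c : ℝ} (hc : ∀ p, |φ p| ≤ c) :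
    ∫ w, φ w.1 ∂(stepKernel p₀ M I η lam t S) =
      ∫ f, ∫ g, φ (f, g) ∂(boosterPosterior M p₀ η lam (I.maxPolicy f) S)
        ∂(mainPosterior M p₀ η lam S) := by
  haveI := isMarkovKernel_mainKernel p₀ M I η lam hβ hF hη t
  haveI := isMarkovKernel_boosterKernel p₀ M I η lam hβ hF hη t
  rw [stepKernel, ProbabilityTheory.integral_compProd (f := fun w : Round F => φ w.1)
    (integrable_of_bounded (hφ.comp measurable_fst) fun w => hc w.1)]
  simp only [integral_const, probReal_univ, one_smul]
  rw [ProbabilityTheory.integral_compProd (integrable_of_bounded hφ hc)]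
  rfl

/-- Round `t` under the joint law of `T` rounds: forget the later rounds, then disintegrate into the
past and the two posteriors. It allows the decoupling inequality, which couples all rounds, to be
applied pathwise. -/
theorem integral_recordLaw {t T : ℕ} (htT : t < T)
    {φ : (Fin t → Round F) → F.Elems × F.Elems → ℝ}
    (hφ : Measurable fun p : (Fin t → Round F) × (F.Elems × F.Elems) => φ p.1 p.2) {c : ℝ}
    (hc : ∀ ω p, |φ ω p| ≤ c) :
    ∫ ω, φ (fun s => ω (Fin.castLE htT.le s)) (ω ⟨t, htT⟩).1 ∂(recordLaw p₀ M I η lam T) =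
      ∫ ω, ∫ f, ∫ g, φ ω (f, g) ∂(boosterPosterior M p₀ η lam (I.maxPolicy f) (episodes ω))
        ∂(mainPosterior M p₀ η lam (episodes ω)) ∂(recordLaw p₀ M I η lam t) := by
  haveI := isMarkovKernel_stepKernel p₀ M I η lam hβ hF hη t
  haveI := isProbabilityMeasure_recordLaw p₀ M I η lam hβ hF hη t
  have hm : Measurable fun q : (Fin t → Round F) × Round F => φ q.1 q.2.1 := by
    have := hφ.comp (by fun_prop : Measurable
      fun q : (Fin t → Round F) × Round F => (q.1, q.2.1))
    exact this
  have hm' : Measurable fun ω : Fin (t + 1) → Round F =>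
      φ (fun s => ω s.castSucc) (ω (Fin.last t)).1 := by
    have := hφ.comp (by fun_prop : Measurable
      fun ω : Fin (t + 1) → Round F => ((fun s : Fin t => ω s.castSucc), (ω (Fin.last t)).1))
    exact this
  have hr : Measurable fun (ω : Fin T → Round F) (s : Fin (t + 1)) =>
      ω (Fin.castLE (Nat.succ_le_of_lt htT) s) :=
    measurable_pi_lambda _ fun s => measurable_pi_apply _
  calc _ = ∫ ω, φ (fun s => ω s.castSucc) (ω (Fin.last t)).1
          ∂(recordLaw p₀ M I η lam (t + 1)) := by
        rw [← map_castLE_recordLaw p₀ M I η lam hβ hF hη (Nat.succ_le_of_lt htT),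
          integral_map hr.aemeasurable hm'.aestronglyMeasurable]
        rfl
    _ = ∫ ω, ∫ w, φ ω w.1 ∂(stepKernel p₀ M I η lam t (episodes ω))
          ∂(recordLaw p₀ M I η lam t) := by
        rw [recordLaw, integral_map (measurable_snoc t).aemeasurable hm'.aestronglyMeasurable]
        simp only [Fin.snoc_castSucc, Fin.snoc_last]
        rw [Measure.integral_compProd (integrable_of_bounded hm fun q => hc q.1 q.2.1)]
        rfl
    _ = _ := by
        refine integral_congr_ae (Filter.Eventually.of_forall fun ω => ?_)
        have hmω : Measurable (φ ω) := by
          have := hφ.comp (measurable_prodMk_left (x := ω))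
          exact this
        exact integral_stepKernel p₀ M I η lam hβ hF hη t _ hmω (hc ω)

theorem mainRegret_eq (μs : Policy H X A) (νs : Policy H X B) (T : ℕ) :
    mainRegret M I p₀ η lam μs νs T =
      ∑ t : Fin T, ∫ ω, (initValue M μs νs - initValue M (I.maxPolicy (ω t).1.1)
        (I.minPolicy (ω t).1.1 (ω t).1.2)) ∂(recordLaw p₀ M I η lam T) := by
  rw [mainRegret, Finset.sum_range]
  refine Finset.sum_congr rfl fun t _ => ?_
  haveI := isMarkovKernel_mainKernel p₀ M I η lam hβ hF hη t
  haveI := isMarkovKernel_boosterKernel p₀ M I η lam hβ hF hη t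
  have hψ : Measurable fun p : F.Elems × F.Elems =>
      initValue M μs νs - initValue M (I.maxPolicy p.1) (I.minPolicy p.1 p.2) :=
    (measurable_initValue M I).const_sub _
  have hb : ∀ p : F.Elems × F.Elems,
      |initValue M μs νs - initValue M (I.maxPolicy p.1) (I.minPolicy p.1 p.2)| ≤ H := fun p => by
    have h1 := initValue_nonneg M μs νs
    have h2 := initValue_le M μs νs
    have h3 := initValue_nonneg M (I.maxPolicy p.1) (I.minPolicy p.1 p.2)
    have h4 := initValue_le M (I.maxPolicy p.1) (I.minPolicy p.1 p.2)
    rw [abs_le]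
    constructor <;> linarith
  have h1 := integral_recordLaw p₀ M I η lam hβ hF hη t.2
    (φ := fun _ p => initValue M μs νs - initValue M (I.maxPolicy p.1) (I.minPolicy p.1 p.2))
    (by have := hψ.comp (measurable_snd : Measurable
          (Prod.snd : (Fin t → Round F) × (F.Elems × F.Elems) → _)); exact this)
    (fun _ p => hb p)
  have hm : StronglyMeasurable fun S : Fin t → Traj H X A B =>
      ∫ f, ∫ g, (initValue M μs νs - initValue M (I.maxPolicy f) (I.minPolicy f g))
        ∂(boosterPosterior M p₀ η lam (I.maxPolicy f) S) ∂(mainPosterior M p₀ η lam S) := by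
    have h2 : Measurable fun q : ((Fin t → Traj H X A B) × F.Elems) × F.Elems =>
        initValue M μs νs - initValue M (I.maxPolicy q.1.2) (I.minPolicy q.1.2 q.2) := by
      have := hψ.comp (by fun_prop : Measurable
        fun q : ((Fin t → Traj H X A B) × F.Elems) × F.Elems => (q.1.2, q.2))
      exact this
    have h3 := StronglyMeasurable.integral_kernel_prod_right
      (κ := boosterKernel p₀ M I η lam t)
      (f := fun (q : (Fin t → Traj H X A B) × F.Elems) g =>
        initValue M μs νs - initValue M (I.maxPolicy q.2) (I.minPolicy q.2 g))
      h2.stronglyMeasurable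
    exact StronglyMeasurable.integral_kernel_prod_right (κ := mainKernel p₀ M I η lam t)
      (f := fun S f => ∫ g, (initValue M μs νs - initValue M (I.maxPolicy f) (I.minPolicy f g))
        ∂(boosterKernel p₀ M I η lam t (S, f))) h3
  rw [← map_episodes_recordLaw p₀ M I η lam hβ hF hη t,
    integral_map (measurable_episodes _).aemeasurable hm.aestronglyMeasurable]
  exact h1.symm

end Decoupling

theorem sum_Iio_eq_sum_castLE {T : ℕ} (t : Fin T) (φ : Fin T → ℝ) :
    ∑ s ∈ Finset.Iio t, φ s = ∑ s : Fin t, φ (Fin.castLE t.2.le s) := by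
  symm
  refine Finset.sum_nbij (Fin.castLE t.2.le) (fun s _ => ?_) (fun s _ s' _ h => ?_)
    (fun s hs => ?_) fun _ _ => rfl
  · exact Finset.mem_Iio.2 (Fin.lt_def.2 s.2)
  · exact Fin.castLE_injective _ h
  · have hs' : (s : ℕ) < t := Fin.lt_def.1 (Finset.mem_Iio.1 (Finset.mem_coe.1 hs))
    exact ⟨⟨s, hs'⟩, Finset.mem_coe.2 (Finset.mem_univ _), rfl⟩

section Regret

variable {H : ℕ} {X A B : Type*} [MeasurableSpace X]
  [Fintype A] [Nonempty A] [MeasurableSpace A] [MeasurableSingletonClass A]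
  [Fintype B] [Nonempty B] [MeasurableSpace B] [MeasurableSingletonClass B]
  {F : FunctionClass H X A B}

/-! ### The regret bound -/

/-- The decoupling inequality along one realization of all sampled functions, with the sum over
earlier rounds rewritten as the in-sample error of `f_t`. -/
theorem sum_optimism_sub_value_le (M : MarkovGame H X A B) (I : InducedPolicies F) {β : ℝ}
    (hβ : 1 < β) (hF : BoundedBy F β) {T : ℕ} {m D : ℝ} (hm : 0 < m)
    (hD : (decouplingCoeff M I T m : ℝ) ≤ D) (ω : Fin T → Round F) :
    ∑ t, (maxminValue (ω t).1.1 0 M.init - initValue M (I.maxPolicy (ω t).1.1)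
        (I.minPolicy (ω t).1.1 (ω t).1.2)) ≤
      m * ∑ t, ∑ h, cumSq M I h (fun s => ω (Fin.castLE t.2.le s)) (ω t).1.1 + D / (4 * m) := by
  have h1 := decouples_residual M I hβ hF hm (fun t => (ω t).1.1) (fun t => (ω t).1.2)
  unfold Decouples at h1
  have h2 : (decouplingCoeff M I T m : ℝ) / (4 * m) ≤ D / (4 * m) := by gcongr
  have h3 := Finset.sum_le_sum fun (t : Fin T) (_ : t ∈ Finset.univ) =>
    maxminValue_sub_initValue_le M I hβ hF (ω t).1.1 (I.minPolicy (ω t).1.1 (ω t).1.2)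
  rw [Finset.sum_comm] at h3
  have h4 : ∑ h, ∑ t, ∑ s ∈ Finset.Iio t, ∫ ζ, (residual M h (ω t).1.1 (ζ h)) ^ 2
      ∂(episodeLaw M (I.maxPolicy (ω s).1.1) (I.minPolicy (ω s).1.1 (ω s).1.2)) =
      ∑ t, ∑ h, cumSq M I h (fun s => ω (Fin.castLE t.2.le s)) (ω t).1.1 := by
    rw [Finset.sum_comm]
    refine Finset.sum_congr rfl fun t _ => Finset.sum_congr rfl fun h _ => ?_
    rw [sum_Iio_eq_sum_castLE]
    rfl
  rw [h4] at h1
  linarith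

variable (p₀ : (h : Fin H) → Measure (F.Elem h)) [∀ h, IsProbabilityMeasure (p₀ h)]
  (M : MarkovGame H X A B) (I : InducedPolicies F) {η lam : ℝ}
  {β : ℝ} (hβ : 1 < β) (hF : BoundedBy F β) (hη : 0 < η)

include hβ hF hη

/-- Values are nonnegative, so each round loses at most `V^*`. -/
theorem mainRegret_le_of_initValue_le {μs : Policy H X A} {νs : Policy H X B} {c : ℝ}
    (hc : initValue M μs νs ≤ c) (T : ℕ) : mainRegret M I p₀ η lam μs νs T ≤ T * c := by
  haveI := isProbabilityMeasure_recordLaw p₀ M I η lam hβ hF hη.le T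
  rw [mainRegret_eq p₀ M I η lam hβ hF hη.le]
  calc _ ≤ ∑ _t : Fin T, c := Finset.sum_le_sum fun t _ => ?_
    _ = T * c := by simp
  have h0 := (initValue_nonneg M μs νs).trans hc
  by_cases hi : Integrable (fun ω : Fin T → Round F => initValue M μs νs -
      initValue M (I.maxPolicy (ω t).1.1) (I.minPolicy (ω t).1.1 (ω t).1.2))
      (recordLaw p₀ M I η lam T)
  · have h2 := integral_mono hi (integrable_const c) fun ω => by
      have := initValue_nonneg M (I.maxPolicy (ω t).1.1) (I.minPolicy (ω t).1.1 (ω t).1.2)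
      change _ - _ ≤ c
      linarith
    simpa using h2
  · rw [integral_undef hi]
    exact h0

/-- The decoupling parameter `m = η / (2 lam)` is chosen so that `lam · m = η / 2`, the weight at
which the posterior estimate controls the squared residuals. The terms `lam V^*` then cancel. -/
theorem mainRegret_le {μs : Policy H X A} {νs : Policy H X B} (hN : IsNash M μs νs)
    (hlam : 0 < lam) (hηβ : 2 * η * β ^ 2 ≤ 1 / 2) {ε κ D : ℝ} (hε : 0 ≤ ε)
    (hκ : kappa M I p₀ ε < ⊤) (hκ' : κ = (kappa M I p₀ ε).toReal) (T : ℕ)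
    (hD : (decouplingCoeff M I T (η / (2 * lam)) : ℝ) ≤ D) :
    mainRegret M I p₀ η lam μs νs T ≤
      T * (2 * κ + 2 * (H * (η * (T * (ε ^ 2 + 2 * ε * β)))) + lam * (H * ε)) / lam +
        D * lam / (2 * η) := by
  haveI := isProbabilityMeasure_recordLaw p₀ M I η lam hβ hF hη.le T
  have hvi : ∀ t : Fin T, Integrable (fun ω : Fin T → Round F => initValue M μs νs -
      initValue M (I.maxPolicy (ω t).1.1) (I.minPolicy (ω t).1.1 (ω t).1.2))
      (recordLaw p₀ M I η lam T) := fun t => by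
    have h1 := (measurable_initValue M I).comp
      (by fun_prop : Measurable fun ω : Fin T → Round F => (ω t).1)
    refine integrable_of_bounded (h1.const_sub (initValue M μs νs)) (c := H) fun ω => ?_
    have h2 := initValue_nonneg M μs νs
    have h3 := initValue_le M μs νs
    have h4 := initValue_nonneg M (I.maxPolicy (ω t).1.1) (I.minPolicy (ω t).1.1 (ω t).1.2)
    have h5 := initValue_le M (I.maxPolicy (ω t).1.1) (I.minPolicy (ω t).1.1 (ω t).1.2)
    rw [abs_le]
    constructor <;> linarith
  let G : (t : Fin T) → (Fin T → Round F) → ℝ := fun t ω =>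
    η / 2 * ∑ h, cumSq M I h (fun s => ω (Fin.castLE t.2.le s)) (ω t).1.1 -
      lam * maxminValue (ω t).1.1 0 M.init
  have hGi : ∀ t, Integrable (G t) (recordLaw p₀ M I η lam T) := fun t => by
    have h1 : Measurable fun ω : Fin T → Round F =>
        ((fun s : Fin t => ω (Fin.castLE t.2.le s)), (ω t).1.1) :=
      (measurable_pi_lambda _ fun s => measurable_pi_apply _).prodMk (by fun_prop)
    have h2 := (measurable_cumSq_sub_optimism M I η lam t).comp h1
    exact integrable_of_bounded h2 fun ω =>
      abs_cumSq_sub_optimism_le M I η lam hβ hF hη.le hlam.le _ _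
  have hG : ∀ t : Fin T, ∫ ω, G t ω ∂(recordLaw p₀ M I η lam T) ≤
      2 * κ + 2 * (H * (η * (T * (ε ^ 2 + 2 * ε * β)))) + lam * (H * ε) -
        lam * initValue M μs νs := fun t => by
    have h1 := integral_recordLaw p₀ M I η lam hβ hF hη.le t.2
      (φ := fun ω p => η / 2 * ∑ h, cumSq M I h ω p.1 - lam * maxminValue p.1 0 M.init)
      (by
        have := (measurable_cumSq_sub_optimism M I η lam t).comp (by fun_prop : Measurable
          fun p : (Fin t → Round F) × (F.Elems × F.Elems) => (p.1, p.2.1))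
        exact this)
      (fun ω p => abs_cumSq_sub_optimism_le M I η lam hβ hF hη.le hlam.le ω p.1)
    -- The integrand does not involve `g`, so the booster's posterior integrates out, being a
    -- probability measure.
    haveI := fun (ω : Fin t → Round F) f =>
      isProbabilityMeasure_boosterPosterior p₀ M I (lam := lam) hβ hF hη.le (episodes ω) f
    simp only [integral_const, probReal_univ, one_smul] at h1
    refine h1.le.trans ((integral_cumSq_sub_optimism_le p₀ M I η lam hβ hF hη.le hN hlam.le hηβ
      hκ hκ' t).trans ?_)
    have h2 : ((t : ℕ) : ℝ) ≤ T := by exact_mod_cast t.2.le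
    have h3 : (0 : ℝ) < β := by linarith
    gcongr
  -- Multiply the pathwise decoupling bound by `lam` and add `T lam V^*` minus the total optimism to
  -- both sides.
  have hpt : ∀ ω : Fin T → Round F, lam * ∑ t, (initValue M μs νs -
      initValue M (I.maxPolicy (ω t).1.1) (I.minPolicy (ω t).1.1 (ω t).1.2)) ≤
      ∑ t, G t ω + (T * (lam * initValue M μs νs) + D * lam ^ 2 / (2 * η)) := fun ω => by
    have h1 := mul_le_mul_of_nonneg_left
      (sum_optimism_sub_value_le M I hβ hF (by positivity) hD ω) hlam.le
    have h2 : lam * (D / (4 * (η / (2 * lam)))) = D * lam ^ 2 / (2 * η) := by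
      field_simp
      ring
    have h3 : ∀ c : ℝ, lam * (η / (2 * lam) * c) = η / 2 * c := fun c => by field_simp
    rw [mul_add, h2, h3] at h1
    simp only [G, Finset.sum_sub_distrib, ← Finset.mul_sum, mul_sub, Finset.sum_const,
      Finset.card_univ, Fintype.card_fin, nsmul_eq_mul] at h1 ⊢
    linarith
  have hle := integral_mono ((integrable_finsetSum Finset.univ fun t _ => hvi t).const_mul lam)
    ((integrable_finsetSum Finset.univ fun t _ => hGi t).add (integrable_const _)) hpt
  rw [integral_const_mul, integral_finsetSum _ fun t _ => hvi t,
    integral_add' (integrable_finsetSum _ fun t _ => hGi t) (integrable_const _),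
    integral_finsetSum _ fun t _ => hGi t, ← mainRegret_eq p₀ M I η lam hβ hF hη.le] at hle
  have hsum := Finset.sum_le_sum fun (t : Fin T) (_ : t ∈ Finset.univ) => hG t
  rw [Finset.sum_const, Finset.card_univ, Fintype.card_fin, nsmul_eq_mul] at hsum
  simp only [integral_const, probReal_univ, one_smul] at hle
  have h1 : T * (2 * κ + 2 * (H * (η * (T * (ε ^ 2 + 2 * ε * β)))) + lam * (H * ε)) / lam +
        D * lam / (2 * η) = (T * (2 * κ + 2 * (H * (η * (T * (ε ^ 2 + 2 * ε * β)))) +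
        lam * (H * ε)) + D * lam ^ 2 / (2 * η)) / lam := by
    field_simp
  rw [h1, le_div_iff₀ hlam, mul_comm]
  linarith

end Regret

/-! ### Tuning of the parameters -/

section Arithmetic

variable {β D κ lam T H : ℝ}

/-- With this `lam` both leading terms equal `2β√(DκT)`. At `ε = β/T²` the discretization error
`2ηT²(ε² + 2εβ)` is `1/(2T²) + 1 ≤ 3/2`, to be multiplied by `H/lam`. -/
theorem tuned_bound_le (hβ : 1 < β) (hD : 1 ≤ D) (hT : 1 ≤ T) (hκ : 0 ≤ κ) (hH : 0 ≤ H)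
    (hlam : 0 < lam) (hs : lam * (β * D) = √(D * κ * T)) :
    T * (2 * κ + 2 * (H * (1 / (4 * β ^ 2) * (T * ((β / T ^ 2) ^ 2 + 2 * (β / T ^ 2) * β)))) +
        lam * (H * (β / T ^ 2))) / lam + D * lam / (2 * (1 / (4 * β ^ 2))) ≤
      4 * (β * √(D * κ * T)) + 3 / 2 * (H / lam) + H * β / T ∧
    T * κ / lam = β * √(D * κ * T) := by
  have hs2 : √(D * κ * T) ^ 2 = D * κ * T := Real.sq_sqrt (by positivity)
  have hβ0 : 0 < β := by linarith
  have hD0 : 0 < D := by linarith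
  have hT0 : 0 < T := by linarith
  have h1 : T * κ / lam = β * √(D * κ * T) := by
    rw [div_eq_iff hlam.ne']
    rw [← hs] at hs2 ⊢
    have : D * (T * κ) = D * (β * (lam * (β * D)) * lam) := by linarith
    exact mul_left_cancel₀ hD0.ne' this
  refine ⟨?_, h1⟩
  have h2 : D * lam / (2 * (1 / (4 * β ^ 2))) = 2 * (β * √(D * κ * T)) := by
    rw [← hs]
    field_simp
    ring
  have h3 : T * (2 * κ + 2 * (H * (1 / (4 * β ^ 2) * (T * ((β / T ^ 2) ^ 2 +
      2 * (β / T ^ 2) * β)))) + lam * (H * (β / T ^ 2))) / lam =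
      2 * (T * κ / lam) + H / lam * (1 / 2 * (1 / T ^ 2) + 1) + H * β / T := by
    field_simp
    ring
  have h4 : 1 / T ^ 2 ≤ 1 := by
    rw [div_le_one (by positivity)]
    nlinarith
  have h5 : H / lam * (1 / 2 * (1 / T ^ 2) + 1) ≤ H / lam * (3 / 2) := by
    refine mul_le_mul_of_nonneg_left ?_ (by positivity)
    linarith
  rw [h2, h3, h1]
  linarith

/-- The assumption `lam β² ≥ 1` gives `1/lam ≤ β²`, so the remaining terms depend on `H` and `β`
only and are absorbed by `D ≥ 1`. -/
theorem tuned_bound_le_of_horizon {s : ℝ} (hβ : 1 < β) (hD : 1 ≤ D) (hT : 1 ≤ T) (hH : 0 ≤ H)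
    (hlam : 0 < lam) (hlamβ : 1 ≤ lam * β ^ 2) (hs : 0 ≤ s) :
    4 * (β * s) + 3 / 2 * (H / lam) + H * β / T ≤
      (4 + 2 * H * β ^ 2 + H * β) * (β * s + D) := by
  have hβ0 : 0 < β := by linarith
  have h1 : H / lam ≤ H * β ^ 2 := by
    rw [div_le_iff₀ hlam]
    have := mul_le_mul_of_nonneg_left hlamβ hH
    linarith
  have h2 : H * β / T ≤ H * β := div_le_self (by positivity) hT
  have h3 : 0 ≤ 2 * H * β ^ 2 + H * β := by positivity
  have h4 := mul_nonneg h3 (mul_nonneg hβ0.le hs)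
  have h5 := mul_le_mul_of_nonneg_left hD h3
  have h6 : 0 ≤ H * β ^ 2 := by positivity
  linarith

/-- If `H ≤ Tκ`, then `H/lam ≤ Tκ/lam = β√(DκT)` and `Hβ/T ≤ βκ`; the latter is at most `β√(DκT)`
when `κ ≤ DT`. The total constant is `4 + 3/2 + 1 ≤ 7`. -/
theorem tuned_bound_le_of_le (hβ : 1 < β) (hD : 1 ≤ D) (hT : 1 ≤ T) (hκ : 0 ≤ κ)
    (hlam : 0 < lam) (hTκ : T * κ / lam = β * √(D * κ * T)) (hH : H ≤ T * κ)
    (hκD : κ ≤ D * T) :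
    4 * (β * √(D * κ * T)) + 3 / 2 * (H / lam) + H * β / T ≤ 7 * (β * √(D * κ * T) + D) := by
  have hβ0 : 0 < β := by linarith
  have hT0 : 0 < T := by linarith
  have h1 : H / lam ≤ β * √(D * κ * T) := by
    rw [← hTκ]
    gcongr
  have h2 : H * β / T ≤ β * κ := by
    rw [div_le_iff₀ hT0]
    have := mul_le_mul_of_nonneg_right hH hβ0.le
    linarith
  have h3 : κ ≤ √(D * κ * T) := by
    refine Real.le_sqrt_of_sq_le ?_
    have := mul_le_mul_of_nonneg_left hκD hκ
    linarith
  have h4 := mul_le_mul_of_nonneg_left h3 hβ0.le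
  have h5 : 0 ≤ β * √(D * κ * T) := by positivity
  linarith

/-- When `κ ≥ DT ≥ T` the square root already exceeds `T`, so the bound on the regret by `T(β - 1)`
suffices. -/
theorem trivial_bound_le_of_le (hβ : 1 < β) (hD : 1 ≤ D) (hT : 1 ≤ T) (hκD : D * T ≤ κ) :
    T * (β - 1) ≤ 7 * (β * √(D * κ * T) + D) := by
  have h1 : T ≤ D * T := le_mul_of_one_le_left (by linarith) hD
  have h2 : T ≤ √(D * κ * T) := by
    refine Real.le_sqrt_of_sq_le ?_
    have h3 : κ ≤ D * κ := le_mul_of_one_le_left (by linarith) hD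
    rw [sq]
    exact mul_le_mul_of_nonneg_right (h1.trans (hκD.trans h3)) (by linarith)
  have h4 := mul_le_mul_of_nonneg_left h2 (by linarith : 0 ≤ β)
  have h5 : 0 ≤ β * √(D * κ * T) := by positivity
  linarith

end Arithmetic

end SelfPlay

end

theorem theorem2 :
    ∃ (C : ℝ) (C' : ℕ → ℝ → ℝ), ∀ (H : ℕ) (X A B : Type*)
      [MeasurableSpace X]
      [Fintype A] [Nonempty A] [MeasurableSpace A] [MeasurableSingletonClass A]
      [Fintype B] [Nonempty B] [MeasurableSpace B] [MeasurableSingletonClass B]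
      (M : MarkovGame H X A B) (F : FunctionClass H X A B) (I : InducedPolicies F)
      (p₀ : (h : Fin H) → Measure (F.Elem h)) (_ : ∀ h, IsProbabilityMeasure (p₀ h))
      (μs : Policy H X A) (νs : Policy H X B) (_ : IsNash M μs νs)
      (_ : Realizable M I μs νs) (_ : Complete M I)
      (β : ℝ) (_ : 1 < β) (_ : BoundedBy F β)
      (T : ℕ) (_ : 0 < T)
      (_ : kappa M I p₀ (β / (T : ℝ) ^ 2) < ⊤)
      (D : ℝ) (_ : 1 ≤ D)
      (_ : ∀ m : ℝ, 0 < m → m ≤ 1 → (decouplingCoeff M I T m : ℝ) ≤ D)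
      (κ : ℝ) (_ : κ = (kappa M I p₀ (β / (T : ℝ) ^ 2)).toReal)
      (η lam : ℝ) (_ : η = 1 / (4 * β ^ 2)) (_ : lam = √(T * κ / (β ^ 2 * D)))
      (_ : η * β ^ 2 ≤ 0.5) (_ : 1 ≤ lam * β ^ 2),
      mainRegret M I p₀ η lam μs νs T ≤ C' H β * (β * √(D * κ * T) + D) ∧
      ((H : ℝ) ≤ T * κ →
        mainRegret M I p₀ η lam μs νs T ≤ C * (β * √(D * κ * T) + D)) := by
  refine ⟨7, fun H β => 4 + 2 * H * β ^ 2 + H * β, ?_⟩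
  intro H X A B _ _ _ _ _ _ _ _ _ M F I p₀ hp₀ μs νs hN hR _ β hβ hF T hT hκ D hD1 hD κ hκ' η lam
    hη hlam _ hlamβ
  have hβ0 : 0 < β := by linarith
  have hD0 : 0 < D := by linarith
  have hlam0 : 0 < lam := by
    by_contra h
    nlinarith [sq_nonneg β]
  have hT1 : (1 : ℝ) ≤ T := by exact_mod_cast hT
  have hT0 : (0 : ℝ) < T := by linarith
  -- Positivity of `lam` forces a positive radicand, hence `κ > 0`.
  have hκ0 : 0 < κ := by
    rw [hlam, Real.sqrt_pos] at hlam0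
    by_contra h
    exact absurd hlam0 (not_lt.2 (div_nonpos_of_nonpos_of_nonneg
      (mul_nonpos_of_nonneg_of_nonpos hT0.le (not_lt.1 h)) (by positivity)))
  have hη0 : 0 < η := by rw [hη]; positivity
  have hs : lam * (β * D) = √(D * κ * T) := by
    rw [hlam, ← Real.sqrt_sq (by positivity : 0 ≤ β * D), ← Real.sqrt_mul (by positivity)]
    congr 1
    field_simp
  -- The decoupling parameter is `1 / (8 lam β²) ≤ 1/8`, so the assumption on the coefficient for `m
  -- ≤ 1` covers it.
  have hm1 : η / (2 * lam) ≤ 1 := by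
    rw [hη, div_le_one (by positivity), div_le_iff₀ (by positivity)]
    linarith
  have hηβ : 2 * η * β ^ 2 ≤ 1 / 2 := by
    rw [hη]
    field_simp
    norm_num
  have hmain := mainRegret_le p₀ M I hβ hF hη0 hN hlam0 hηβ (by positivity) hκ hκ' T
    (hD _ (by positivity) hm1)
  obtain ⟨hbound, hTκ⟩ := tuned_bound_le hβ hD1 hT1 hκ0.le (Nat.cast_nonneg H) hlam0 hs
  rw [← hη] at hbound
  have hreg := hmain.trans hbound
  refine ⟨hreg.trans (tuned_bound_le_of_horizon hβ hD1 hT1 (Nat.cast_nonneg H) hlam0 hlamβ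
    (Real.sqrt_nonneg _)), fun hH => ?_⟩
  -- The universal constant needs both regimes: `Hβ/T` is dominated by the main term only for `κ ≤
  -- DT`, and otherwise the trivial bound takes over.
  rcases le_total κ (D * T) with h | h
  · exact hreg.trans (tuned_bound_le_of_le hβ hD1 hT1 hκ0.le hlam0 hTκ hH h)
  · exact (mainRegret_le_of_initValue_le p₀ M I hβ hF hη0 (hR.initValue_le hβ hF) T).trans
      (trivial_bound_le_of_le hβ hD1 hT1 h)
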